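/- A weighted context-free grammar (WCFG) $\mathcal W=\langle\mathcal G,\theta\rangle$ consists of a context-free grammar $\mathcal G=\langle\mathcal V,\Sigma,R,S\rangle$ with finite sets $\mathcal V$ of non-terminals, $\Sigma$ of terminals and $R$ of production rules, and of weights $\theta:R\to\mathbb R$. A derivation tree is a finite tree whose leaves are labeled by terminals and whose inner nodes are labeled by non-terminals, such that at every inner node the rule "label of the node $\to$ labels of its children" is in $R$; its root may be any symbol. (A production with empty right-hand side gives an inner node without children.) Its weight is the product of the weights of all occurrences of productions in it. The skeleton (structured string) of a derivation tree is obtained by replacing the label of every inner node by $?$. For a skeletal tree $s$, $\mathcal W(s)$ is the sum of the weights of all derivation trees with root $S$ and skeleton $s$. $\mathcal W$ is structurally unambiguous (an SUWCFG) if no two different derivation trees have the same skeleton. A learner knows $\Sigma$ and a bound $p$ on the length of the right-hand sides of the rules of an unknown SUWCFG $\mathcal W$. A structured membership query (SMQ) on a skeletal tree $s$ is answered by the real number $\mathcal W(s)$. A structured equivalence query (SEQ) on an SUWCFG $\mathcal W'$ over $\Sigma$ is answered by "yes" if $\mathcal W'(s)=\mathcal W(s)$ for all skeletal trees $s$, and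 otherwise by a pair $(s,\mathcal W(s))$ with $\mathcal W'(s)\neq\mathcal W(s)$, the counterexample $s$ being chosen arbitrarily, possibly adaptively. Running time is measured for programs on lists and real numbers (no real constants other than natural numbers), where field operations, tests for equality of numbers and list operations have unit cost and a query costs the sizes of the question and of the answer. **Claim.** There are one learning program and a constant $c$ such that for every finite $\Sigma$, every $p$, every SUWCFG $\mathcal W$ over $\Sigma$ with right-hand sides of length at most $p$, and every correct teacher, the program halts and outputs an SUWCFG $\mathcal W'$ with $\mathcal W'(s)=\mathcal W(s)$ for every skeletal tree $s$; if no weight of $\mathcal W$ is negative, then no weight of $\mathcal W'$ is negative. It asks at most $|\mathcal V|$ SEQs (including the last one), and its running time is at most $$c\,\bigl(|\mathcal V|+|\Sigma|+p+m+1\bigr)^{c(p+1)},$$ where $m$ is the number of nodes of the largest counterexample received ($m=0$ if there is none). In particular, for every fixed $p$ the running time is polynomial in $|\mathcal V|$, $|\Sigma|$ and $m$. -/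

import Mathlib

noncomputable section

namespace StructLearn

/-! ### Skeletal trees and derivation trees -/

/-- Skeletal trees (structured strings) over the terminals `T`: the leaves carry terminals and the
inner nodes carry no label (they are marked `?`). The tree `node []` is the skeleton of a
production with empty right-hand side. -/
inductive SkelTree (T : Type) : Type
  | leaf (a : T) : SkelTree T
  | node (ts : List (SkelTree T)) : SkelTree T

/-- The number of nodes. -/
def SkelTree.size {T : Type} : SkelTree T → ℕ
  | .leaf _ => 1
  | .node ts => 1 + (ts.map SkelTree.size).sum

/-- Trees whose leaves carry terminals and whose inner nodes carry nonterminals. -/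
inductive LabTree (T N : Type) : Type
  | leaf (a : T) : LabTree T N
  | node (A : N) (ts : List (LabTree T N)) : LabTree T N

namespace LabTree

variable {T N : Type}

/-- The label of the root. -/
def root : LabTree T N → Symbol T N
  | .leaf a => .terminal a
  | .node A _ => .nonterminal A

/-- The skeletal description: forget the nonterminals. -/
def skeleton : LabTree T N → SkelTree T
  | .leaf a => .leaf a
  | .node _ ts => .node (ts.map skeleton)

/-- The list of all occurrences of productions in the tree. -/
def productions : LabTree T N → List (ContextFreeRule T N)
  | .leaf _ => []
  | .node A ts => ⟨A, ts.map root⟩ :: ts.flatMap productions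

end LabTree

/-! ### Weighted grammars -/

/-- A weighted context-free grammar with terminals `T` and nonterminals `N`: a start symbol, finitely
many production rules, and their weights. Only the values of `weight` on `rules` matter. -/
structure WCFG (T N : Type) where
  initial : N
  rules : Finset (ContextFreeRule T N)
  weight : ContextFreeRule T N → ℝ

namespace WCFG

variable {T N : Type} (W : WCFG T N)

/-- `t` is a derivation tree (with an arbitrary root). -/
def IsDerivationTree (t : LabTree T N) : Prop :=
  ∀ r ∈ t.productions, r ∈ W.rules

/-- The weight of a tree: each production contributes its weight once per occurrence. -/
def treeWeight (t : LabTree T N) : ℝ :=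
  (t.productions.map W.weight).prod

/-- The skeletal tree series of the grammar: the sum of the weights of all derivation trees that are
rooted at the start symbol and have the skeleton `s` (there are finitely many of them if the set of
nonterminals is finite). -/
def series (s : SkelTree T) : ℝ :=
  ∑ᶠ t ∈ {t : LabTree T N |
    W.IsDerivationTree t ∧ t.root = .nonterminal W.initial ∧ t.skeleton = s}, W.treeWeight t

/-- Structural unambiguity: a skeletal tree is the skeleton of at most one derivation tree. -/
def IsStructurallyUnambiguous : Prop :=
  ∀ t t' : LabTree T N, W.IsDerivationTree t → W.IsDerivationTree t' →
    t.skeleton = t'.skeleton → t = t'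

/-- All right-hand sides have length at most `p`. -/
def RankLE (p : ℕ) : Prop :=
  ∀ r ∈ W.rules, r.output.length ≤ p

/-- No rule has a negative weight. -/
def IsNonneg : Prop :=
  ∀ r ∈ W.rules, 0 ≤ W.weight r

end WCFG

/-! ### Values of the machine, and how trees and grammars are written as values -/

/-- Values: binary trees (S-expressions) whose atoms are `nil` and real numbers. -/
inductive Val : Type
  | nil : Val
  | num (r : ℝ) : Val
  | pair (x y : Val) : Val

namespace Val

/-- The number of nodes. -/
def size : Val → ℕ
  | .nil => 1
  | .num _ => 1
  | .pair x y => x.size + y.size + 1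

/-- First component (`nil` for an atom). -/
def hd : Val → Val
  | .pair x _ => x
  | _ => .nil

/-- Second component (`nil` for an atom). -/
def tl : Val → Val
  | .pair _ y => y
  | _ => .nil

/-- The number held by a numeric atom (`0` for all other values). -/
def toReal : Val → ℝ
  | .num r => r
  | _ => 0

/-- Truth values: `nil` is false, everything else is true. -/
def ofProp (q : Prop) [Decidable q] : Val := if q then .num 1 else .nil

def IsPair (v : Val) : Prop := ∃ x y, v = .pair x y

def IsNum (v : Val) : Prop := ∃ r, v = .num r

/-- A list of values as a value. -/
def ofList : List Val → Val
  | [] => .nil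
  | v :: vs => .pair v (ofList vs)

end Val

/-- A skeletal tree as a value: a leaf is the number of its terminal, a node is the list of its
children. -/
def SkelTree.toVal {a : ℕ} : SkelTree (Fin a) → Val
  | .leaf i => .num (i : ℕ)
  | .node ts => Val.ofList (ts.map SkelTree.toVal)

/-- A weighted grammar over the terminals `Fin a` written out explicitly: the nonterminals are
`Fin n`, and the weighted productions are listed. -/
structure Code (a : ℕ) where
  n : ℕ
  start : Fin n
  entries : List (ContextFreeRule (Fin a) (Fin n) × ℝ)

/-- The grammar given by a code (if a production is listed repeatedly, its weights add up). -/
def Code.toWCFG {a : ℕ} (H : Code a) : WCFG (Fin a) (Fin H.n) where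
  initial := H.start
  rules := (H.entries.map Prod.fst).toFinset
  weight := fun r => ((H.entries.filter (fun e => e.1 = r)).map Prod.snd).sum

def symbolToVal {a n : ℕ} : Symbol (Fin a) (Fin n) → Val
  | .terminal i => .num (i : ℕ)
  | .nonterminal j => .pair (.num (j : ℕ)) .nil

def entryToVal {a n : ℕ} (e : ContextFreeRule (Fin a) (Fin n) × ℝ) : Val :=
  .pair (.num (e.1.input : ℕ)) (.pair (Val.ofList (e.1.output.map symbolToVal)) (.num e.2))

/-- The code of a grammar as a value. -/
def Code.toVal {a : ℕ} (H : Code a) : Val :=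
  .pair (.num (H.n : ℕ)) (.pair (.num (H.start : ℕ)) (Val.ofList (H.entries.map entryToVal)))

/-! ### Learners: programs with two oracles and a step count -/

/-- The field operations. -/
inductive ArithOp : Type
  | add | sub | mul | div

def ArithOp.apply : ArithOp → ℝ → ℝ → ℝ
  | .add, x, y => x + y
  | .sub, x, y => x - y
  | .mul, x, y => x * y
  | .div, x, y => x / y

/-- Expressions of a first-order call-by-value language on `Val` with recursive functions. Variables
are numbered from the innermost binder outwards. The only numeric constants are natural numbers. -/
inductive Expr : Type
  | var (i : ℕ)
  | nil
  | const (k : ℕ)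
  | cons (e₁ e₂ : Expr)
  | hd (e : Expr)
  | tl (e : Expr)
  | isPair (e : Expr)
  | isNum (e : Expr)
  | arith (o : ArithOp) (e₁ e₂ : Expr)
  | eqNum (e₁ e₂ : Expr)
  | ite (e e₁ e₂ : Expr)
  | letIn (e₁ e₂ : Expr)
  | call (f : ℕ) (e : Expr)
  | smq (e : Expr)
  | seq (e : Expr)

/-- A program is a finite list of function bodies. Each function has one argument, variable `0` of
its body. -/
abbrev Program : Type := List Expr

/-- The structured equivalence queries asked so far, with their answers: `none` stands for "yes",
`some s` for the counterexample `s`. -/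
abbrev History (a : ℕ) : Type := List (Code a × Option (SkelTree (Fin a)))

/-- The size of the largest counterexample received (`0` if there is none). -/
def History.maxCex {a : ℕ} (h : History a) : ℕ :=
  ((h.filterMap Prod.snd).map SkelTree.size).foldr max 0

/-- A strategy for answering structured equivalence queries, which may depend on the history. -/
abbrev Teacher (a : ℕ) : Type := History a → Code a → Option (SkelTree (Fin a))

/-- The teacher answers the queries truthfully with respect to the tree series `f`: "yes" only if
the queried grammar has the series `f`, and otherwise a skeletal tree on which they differ. -/
def Teacher.IsCorrect {a : ℕ} (τ : Teacher a) (f : SkelTree (Fin a) → ℝ) : Prop :=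
  ∀ (h : History a) (H : Code a),
    (τ h H = none → ∀ s, H.toWCFG.series s = f s) ∧
    (∀ s, τ h H = some s → H.toWCFG.series s ≠ f s)

open Classical in
/-- `Eval f τ P h env e v h' t`: in the environment `env`, after the equivalence queries `h`, the
expression `e` has the value `v`; afterwards the equivalence queries are `h'`, and `t` steps were
made. Every evaluation step, in particular every field operation and every test for equality of
numbers, costs one unit; a query costs moreover the size of the question and of the answer, written
out in full. A structured membership query must be asked about a skeletal tree and is answered by
its value under `f`; a structured equivalence query must be asked about a structurally unambiguous
weighted grammar, and is answered by `nil` for "yes" or by the pair of the counterexample and its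
value under `f`. -/
inductive Eval {a : ℕ} (f : SkelTree (Fin a) → ℝ) (τ : Teacher a) (P : Program) :
    History a → List Val → Expr → Val → History a → ℕ → Prop
  | var {h env i v} : env[i]? = some v → Eval f τ P h env (.var i) v h 1
  | nil {h env} : Eval f τ P h env .nil .nil h 1
  | const {h env k} : Eval f τ P h env (.const k) (.num (k : ℝ)) h 1
  | cons {h env e₁ e₂ v₁ v₂ h₁ h₂ t₁ t₂} :
      Eval f τ P h env e₁ v₁ h₁ t₁ → Eval f τ P h₁ env e₂ v₂ h₂ t₂ →
      Eval f τ P h env (.cons e₁ e₂) (.pair v₁ v₂) h₂ (t₁ + t₂ + 1)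
  | hd {h env e v h' t} : Eval f τ P h env e v h' t → Eval f τ P h env (.hd e) v.hd h' (t + 1)
  | tl {h env e v h' t} : Eval f τ P h env e v h' t → Eval f τ P h env (.tl e) v.tl h' (t + 1)
  | isPair {h env e v h' t} : Eval f τ P h env e v h' t →
      Eval f τ P h env (.isPair e) (Val.ofProp v.IsPair) h' (t + 1)
  | isNum {h env e v h' t} : Eval f τ P h env e v h' t →
      Eval f τ P h env (.isNum e) (Val.ofProp v.IsNum) h' (t + 1)
  | arith {h env o e₁ e₂ v₁ v₂ h₁ h₂ t₁ t₂} :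
      Eval f τ P h env e₁ v₁ h₁ t₁ → Eval f τ P h₁ env e₂ v₂ h₂ t₂ →
      Eval f τ P h env (.arith o e₁ e₂) (.num (o.apply v₁.toReal v₂.toReal)) h₂ (t₁ + t₂ + 1)
  | eqNum {h env e₁ e₂ v₁ v₂ h₁ h₂ t₁ t₂} :
      Eval f τ P h env e₁ v₁ h₁ t₁ → Eval f τ P h₁ env e₂ v₂ h₂ t₂ →
      Eval f τ P h env (.eqNum e₁ e₂) (Val.ofProp (v₁.toReal = v₂.toReal)) h₂ (t₁ + t₂ + 1)
  | iteTrue {h env e e₁ e₂ v w h₁ h₂ t₁ t₂} :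
      Eval f τ P h env e v h₁ t₁ → v ≠ .nil → Eval f τ P h₁ env e₁ w h₂ t₂ →
      Eval f τ P h env (.ite e e₁ e₂) w h₂ (t₁ + t₂ + 1)
  | iteFalse {h env e e₁ e₂ w h₁ h₂ t₁ t₂} :
      Eval f τ P h env e .nil h₁ t₁ → Eval f τ P h₁ env e₂ w h₂ t₂ →
      Eval f τ P h env (.ite e e₁ e₂) w h₂ (t₁ + t₂ + 1)
  | letIn {h env e₁ e₂ v w h₁ h₂ t₁ t₂} :
      Eval f τ P h env e₁ v h₁ t₁ → Eval f τ P h₁ (v :: env) e₂ w h₂ t₂ →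
      Eval f τ P h env (.letIn e₁ e₂) w h₂ (t₁ + t₂ + 1)
  | call {h env g e body v w h₁ h₂ t₁ t₂} :
      Eval f τ P h env e v h₁ t₁ → P[g]? = some body → Eval f τ P h₁ [v] body w h₂ t₂ →
      Eval f τ P h env (.call g e) w h₂ (t₁ + t₂ + 1)
  | smq {h env e h' t} (s : SkelTree (Fin a)) :
      Eval f τ P h env e s.toVal h' t →
      Eval f τ P h env (.smq e) (.num (f s)) h' (t + s.toVal.size + 1)
  | seqYes {h env e h' t} (H : Code a) :
      Eval f τ P h env e H.toVal h' t → H.toWCFG.IsStructurallyUnambiguous → τ h' H = none →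
      Eval f τ P h env (.seq e) .nil (h' ++ [(H, none)]) (t + H.toVal.size + 1)
  | seqNo {h env e h' t} (H : Code a) (s : SkelTree (Fin a)) :
      Eval f τ P h env e H.toVal h' t → H.toWCFG.IsStructurallyUnambiguous → τ h' H = some s →
      Eval f τ P h env (.seq e) (.pair s.toVal (.num (f s))) (h' ++ [(H, some s)])
        (t + H.toVal.size + s.toVal.size + 1)

/-- Started on the input `x`, the program `P` halts with the output `v` after `t` steps, having asked
the structured equivalence queries `h`. -/
def Program.Halts {a : ℕ} (P : Program) (f : SkelTree (Fin a) → ℝ) (τ : Teacher a)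
    (x v : Val) (h : History a) (t : ℕ) : Prop :=
  Eval f τ P [] [x] (.call 0 (.var 0)) v h t

/-! ### Runs are deterministic -/

theorem Val.ofList_injective : Function.Injective Val.ofList := by
  intro l
  induction l with
  | nil => intro l' h; cases l' <;> simp_all [Val.ofList]
  | cons v vs ih =>
    intro l' h
    cases l' with
    | nil => simp [Val.ofList] at h
    | cons w ws =>
      simp only [Val.ofList, Val.pair.injEq] at h
      rw [h.1, ih h.2]

theorem SkelTree.toVal_injective {a : ℕ} :
    ∀ s s' : SkelTree (Fin a), s.toVal = s'.toVal → s = s'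
  | .leaf i, .leaf j, h => by
    simp only [SkelTree.toVal, Val.num.injEq, Nat.cast_inj] at h
    rw [Fin.ext h]
  | .leaf i, .node ts, h => by
    cases ts <;> simp [SkelTree.toVal, Val.ofList] at h
  | .node ts, .leaf i, h => by
    cases ts <;> simp [SkelTree.toVal, Val.ofList] at h
  | .node ts, .node ts', h => by
    simp only [SkelTree.toVal] at h
    have h' := Val.ofList_injective h
    have key : ∀ l : List (SkelTree (Fin a)), (∀ t ∈ l, t ∈ ts) →
        ∀ l', l.map SkelTree.toVal = l'.map SkelTree.toVal → l = l' := by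
      intro l
      induction l with
      | nil => intro _ l' hl; cases l' <;> simp_all
      | cons t l ih =>
        intro hmem l' hl
        cases l' with
        | nil => simp at hl
        | cons t' l' =>
          simp only [List.map_cons, List.cons.injEq] at hl
          have : t ∈ ts := hmem t (by simp)
          rw [SkelTree.toVal_injective t t' hl.1,
            ih (fun u hu => hmem u (by simp [hu])) l' hl.2]
    rw [key ts (fun _ h => h) ts' h']
termination_by s => s

theorem symbolToVal_injective {a n : ℕ} :
    Function.Injective (symbolToVal : Symbol (Fin a) (Fin n) → Val) := by
  intro x y h
  cases x <;> cases y <;> simp_all [symbolToVal, Fin.ext_iff]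

theorem entryToVal_injective {a n : ℕ} :
    Function.Injective (entryToVal : ContextFreeRule (Fin a) (Fin n) × ℝ → Val) := by
  rintro ⟨⟨A, u⟩, x⟩ ⟨⟨B, v⟩, y⟩ h
  simp only [entryToVal, Val.pair.injEq, Val.num.injEq, Nat.cast_inj] at h
  obtain ⟨h1, h2, h3⟩ := h
  have h4 := symbolToVal_injective.list_map (Val.ofList_injective h2)
  rw [Fin.ext h1, h4, h3]

theorem Code.toVal_injective {a : ℕ} : Function.Injective (Code.toVal : Code a → Val) := by
  rintro ⟨n, s, l⟩ ⟨n', s', l'⟩ h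
  simp only [Code.toVal, Val.pair.injEq, Val.num.injEq, Nat.cast_inj] at h
  obtain ⟨h1, h2, h3⟩ := h
  subst h1
  rw [Fin.ext h2, entryToVal_injective.list_map (Val.ofList_injective h3)]

/-- The answers of the teacher being given, a run is determined by the program and the input. -/
theorem Eval.deterministic {a : ℕ} {f : SkelTree (Fin a) → ℝ} {τ : Teacher a} {P : Program}
    {h : History a} {env : List Val} {e : Expr} {v w : Val} {h₁ h₂ : History a} {t₁ t₂ : ℕ}
    (H₁ : Eval f τ P h env e v h₁ t₁) (H₂ : Eval f τ P h env e w h₂ t₂) :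
    v = w ∧ h₁ = h₂ ∧ t₁ = t₂ := by
  induction H₁ generalizing w h₂ t₂ with
  | var hv => cases H₂ with | var hv' => simp_all
  | nil => cases H₂; simp
  | const => cases H₂; simp
  | cons _ _ ih ih' =>
    cases H₂ with
    | cons A B =>
      obtain ⟨rfl, rfl, rfl⟩ := ih A
      obtain ⟨rfl, rfl, rfl⟩ := ih' B
      simp
  | arith _ _ ih ih' =>
    cases H₂ with
    | arith A B =>
      obtain ⟨rfl, rfl, rfl⟩ := ih A
      obtain ⟨rfl, rfl, rfl⟩ := ih' B
      simp
  | eqNum _ _ ih ih' =>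
    cases H₂ with
    | eqNum A B =>
      obtain ⟨rfl, rfl, rfl⟩ := ih A
      obtain ⟨rfl, rfl, rfl⟩ := ih' B
      simp
  | letIn _ _ ih ih' =>
    cases H₂ with
    | letIn A B =>
      obtain ⟨rfl, rfl, rfl⟩ := ih A
      obtain ⟨rfl, rfl, rfl⟩ := ih' B
      simp
  | hd _ ih =>
    cases H₂ with
    | hd A =>
      obtain ⟨rfl, rfl, rfl⟩ := ih A
      simp
  | tl _ ih =>
    cases H₂ with
    | tl A =>
      obtain ⟨rfl, rfl, rfl⟩ := ih A
      simp
  | isPair _ ih =>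
    cases H₂ with
    | isPair A =>
      obtain ⟨rfl, rfl, rfl⟩ := ih A
      simp
  | isNum _ ih =>
    cases H₂ with
    | isNum A =>
      obtain ⟨rfl, rfl, rfl⟩ := ih A
      simp
  | iteTrue _ hv _ ih ih' =>
    cases H₂ with
    | iteTrue A _ B =>
      obtain ⟨rfl, rfl, rfl⟩ := ih A
      obtain ⟨rfl, rfl, rfl⟩ := ih' B
      simp
    | iteFalse A B => exact absurd (ih A).1 hv
  | iteFalse _ _ ih ih' =>
    cases H₂ with
    | iteTrue A hv B => exact absurd (ih A).1.symm hv
    | iteFalse A B =>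
      obtain ⟨_, rfl, rfl⟩ := ih A
      obtain ⟨rfl, rfl, rfl⟩ := ih' B
      simp
  | call _ hb _ ih ih' =>
    cases H₂ with
    | call A hb' B =>
      obtain ⟨rfl, rfl, rfl⟩ := ih A
      obtain rfl := Option.some.inj (hb.symm.trans hb')
      obtain ⟨rfl, rfl, rfl⟩ := ih' B
      simp
  | smq s _ ih =>
    cases H₂ with
    | smq s' A =>
      obtain ⟨hs, rfl, rfl⟩ := ih A
      obtain rfl := SkelTree.toVal_injective _ _ hs
      simp
  | seqYes H _ _ hτ ih =>
    cases H₂ with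
    | seqYes H' A _ hτ' =>
      obtain ⟨hs, rfl, rfl⟩ := ih A
      obtain rfl := Code.toVal_injective hs
      simp
    | seqNo H' s' A _ hτ' =>
      obtain ⟨hs, rfl, rfl⟩ := ih A
      obtain rfl := Code.toVal_injective hs
      simp_all
  | seqNo H s _ _ hτ ih =>
    cases H₂ with
    | seqYes H' A _ hτ' =>
      obtain ⟨hs, rfl, rfl⟩ := ih A
      obtain rfl := Code.toVal_injective hs
      simp_all
    | seqNo H' s' A _ hτ' =>
      obtain ⟨hs, rfl, rfl⟩ := ih A
      obtain rfl := Code.toVal_injective hs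
      obtain rfl := Option.some.inj (hτ.symm.trans hτ')
      simp

end StructLearn

end

open StructLearn

noncomputable section

namespace StructLearn

/-! ### Derivations and their weights -/

section Derivations

variable {T N : Type}

-- By structural unambiguity, a skeleton that has a derivation has exactly one root symbol X and one
-- weight w. A context around a tree therefore acts on it as multiplication of w by a factor κ(X)
-- (`exists_hedge_linear`). Two trees with the same root and nonzero weights are thus proportional
-- in all contexts at once (`proportional_of_der`), so trees that are nonzero and pairwise not
-- proportional on some set of contexts number at most |V| (`Independent.length_le`). This is a
-- Myhill–Nerode argument up to scalar factors. The learner follows the pattern of Angluin's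
-- algorithm: its state consists of independent representatives `Ts` and of test contexts `C`.
--
-- The symbols of the hypothesis are the terminals and the classes. For each tuple of at most p
-- symbols, membership queries find the class of the tree built from their representatives, and this
-- gives at most one rule. Since the right-hand side determines the rule, the hypothesis is
-- structurally unambiguous. A tree with a nonzero value has root S, so at most one class has a
-- nonzero value (`Independent.eq_of_ne_zero`); it becomes the start symbol. Its weights are scaled
-- by the value of its representative, so that derivation weights are values and not merely ratios.
-- All rule weights are products and quotients of values of the series, hence nonnegative if the
-- weights of the target are.
--
-- A tree is examined at all its nodes: on `C`, the node must be proportional to a class, and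
-- replacing its children one after another by their representatives must change its values by the
-- predicted factors. A failed test exhibits a tree and a context which separates it from all
-- classes (`isNew_of_scanHedge`). If no test fails, an induction from the leaves shows that the
-- hypothesis is right on the tree (`Valid.series_hyp`). So every counterexample yields a new class.
--
-- Counting classes alone would allow |V| + 1 equivalence queries. One is saved at the start. If
-- some tree of height one has a nonzero value, membership queries find it, and it provides a class
-- before the first equivalence query. Otherwise a tree with a nonzero value cannot be explained by
-- a single class (`scanHedge_ne_none_of_length_le_one`), and the first counterexample yields two.
--
-- For the running time, let X be |V| + |Σ| + p + m + 1. There are at most X^p tuples,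
-- representatives are parts of examined trees, and each new class lengthens the contexts by a
-- polynomial amount. A round costs O(X^(p+8)), and there are at most 2|V| + 2 rounds.

theorem SkelTree.inductOn {motive : SkelTree T → Prop} (s : SkelTree T)
    (leaf : ∀ x, motive (.leaf x))
    (node : ∀ ts : List (SkelTree T), (∀ t ∈ ts, motive t) → motive (.node ts)) : motive s := by
  refine SkelTree.rec (motive_1 := motive) (motive_2 := fun ts => ∀ t ∈ ts, motive t)
    leaf node (by simp) ?_ s
  intro t ts ht hts u hu
  rcases List.mem_cons.1 hu with rfl | hu
  · exact ht
  · exact hts u hu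

theorem LabTree.inductOn {motive : LabTree T N → Prop} (s : LabTree T N)
    (leaf : ∀ x, motive (.leaf x))
    (node : ∀ A (ts : List (LabTree T N)), (∀ t ∈ ts, motive t) → motive (.node A ts)) :
    motive s := by
  refine LabTree.rec (motive_1 := motive) (motive_2 := fun ts => ∀ t ∈ ts, motive t)
    leaf node (by simp) ?_ s
  intro t ts ht hts u hu
  rcases List.mem_cons.1 hu with rfl | hu
  · exact ht
  · exact hts u hu

namespace WCFG

variable (W : WCFG T N)

/-- Some derivation tree with skeleton `s` has the root `X` and the weight `w`. -/
def Der (s : SkelTree T) (X : Symbol T N) (w : ℝ) : Prop :=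
  ∃ t : LabTree T N, W.IsDerivationTree t ∧ t.skeleton = s ∧ t.root = X ∧ W.treeWeight t = w

/-- Some list of derivation trees with skeletons `ss` has the roots `Xs` and total weight `w`. -/
def DerL (ss : List (SkelTree T)) (Xs : List (Symbol T N)) (w : ℝ) : Prop :=
  ∃ ts : List (LabTree T N), (∀ t ∈ ts, W.IsDerivationTree t) ∧ ts.map LabTree.skeleton = ss ∧
    ts.map LabTree.root = Xs ∧ (ts.map W.treeWeight).prod = w

theorem isDerivationTree_node {A : N} {ts : List (LabTree T N)} :
    W.IsDerivationTree (.node A ts) ↔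
      ⟨A, ts.map LabTree.root⟩ ∈ W.rules ∧ ∀ t ∈ ts, W.IsDerivationTree t := by
  simp only [IsDerivationTree, LabTree.productions, List.mem_cons, List.mem_flatMap,
    forall_eq_or_imp]
  constructor
  · rintro ⟨h1, h2⟩
    exact ⟨h1, fun t ht r hr => h2 r ⟨t, ht, hr⟩⟩
  · rintro ⟨h1, h2⟩
    exact ⟨h1, fun r ⟨t, ht, hr⟩ => h2 t ht r hr⟩

theorem treeWeight_node {A : N} {ts : List (LabTree T N)} :
    W.treeWeight (.node A ts) =
      W.weight ⟨A, ts.map LabTree.root⟩ * (ts.map W.treeWeight).prod := by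
  simp only [treeWeight, LabTree.productions, List.map_cons, List.prod_cons]
  congr 1
  induction ts with
  | nil => simp
  | cons t ts ih => simp [ih, treeWeight]

variable {W}

theorem der_leaf {x : T} {X : Symbol T N} {w : ℝ} :
    W.Der (.leaf x) X w ↔ X = .terminal x ∧ w = 1 := by
  constructor
  · rintro ⟨t, -, hs, rfl, rfl⟩
    cases t with
    | leaf y => simp_all [LabTree.skeleton, LabTree.root, treeWeight, LabTree.productions]
    | node A ts => simp [LabTree.skeleton] at hs
  · rintro ⟨rfl, rfl⟩
    exact ⟨.leaf x, by simp [IsDerivationTree, LabTree.productions], by simp [LabTree.skeleton],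
      by simp [LabTree.root], by simp [treeWeight, LabTree.productions]⟩

theorem der_node {ss : List (SkelTree T)} {X : Symbol T N} {w : ℝ} :
    W.Der (.node ss) X w ↔
      ∃ r ∈ W.rules, ∃ w', X = .nonterminal r.input ∧ W.DerL ss r.output w' ∧
        w = W.weight r * w' := by
  constructor
  · rintro ⟨t, ht, hs, rfl, rfl⟩
    cases t with
    | leaf y => simp [LabTree.skeleton] at hs
    | node A ts =>
      rw [isDerivationTree_node] at ht
      refine ⟨_, ht.1, _, rfl, ⟨ts, ht.2, ?_, rfl, rfl⟩, treeWeight_node W⟩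
      simpa [LabTree.skeleton] using hs
  · rintro ⟨⟨A, out⟩, hr, w', rfl, ⟨ts, hts, hsk, hrt, rfl⟩, rfl⟩
    simp only at hrt
    subst hrt
    exact ⟨.node A ts, (isDerivationTree_node W).2 ⟨hr, hts⟩, by simp [LabTree.skeleton, hsk],
      rfl, treeWeight_node W⟩

theorem derL_nil {Xs : List (Symbol T N)} {w : ℝ} : W.DerL [] Xs w ↔ Xs = [] ∧ w = 1 := by
  constructor
  · rintro ⟨ts, -, hs, rfl, rfl⟩
    obtain rfl : ts = [] := by simpa using hs
    simp
  · rintro ⟨rfl, rfl⟩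
    exact ⟨[], by simp, by simp, by simp, by simp⟩

theorem derL_cons {s : SkelTree T} {ss : List (SkelTree T)} {Xs : List (Symbol T N)} {w : ℝ} :
    W.DerL (s :: ss) Xs w ↔
      ∃ X Ys w₁ w₂, Xs = X :: Ys ∧ w = w₁ * w₂ ∧ W.Der s X w₁ ∧ W.DerL ss Ys w₂ := by
  constructor
  · rintro ⟨ts, ht, hs, rfl, rfl⟩
    cases ts with
    | nil => simp at hs
    | cons t ts =>
      simp only [List.map_cons, List.cons.injEq] at hs
      exact ⟨t.root, ts.map LabTree.root, W.treeWeight t, (ts.map W.treeWeight).prod, by simp,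
        by simp, ⟨t, ht t (by simp), hs.1, rfl, rfl⟩,
        ⟨ts, fun u hu => ht u (by simp [hu]), hs.2, rfl, rfl⟩⟩
  · rintro ⟨X, Ys, w₁, w₂, rfl, rfl, ⟨t, h1, rfl, rfl, rfl⟩, ⟨ts, h2, rfl, rfl, rfl⟩⟩
    exact ⟨t :: ts, by simpa using ⟨h1, h2⟩, by simp, by simp, by simp⟩

theorem DerL.length_eq {ss : List (SkelTree T)} {Xs : List (Symbol T N)} {w : ℝ}
    (h : W.DerL ss Xs w) : Xs.length = ss.length := by
  obtain ⟨ts, -, rfl, rfl, -⟩ := h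
  simp

theorem IsStructurallyUnambiguous.der_unique (hW : W.IsStructurallyUnambiguous) {s : SkelTree T}
    {X X' : Symbol T N} {w w' : ℝ} (h : W.Der s X w) (h' : W.Der s X' w') : X = X' ∧ w = w' := by
  obtain ⟨t, ht, hs, rfl, rfl⟩ := h
  obtain ⟨t', ht', hs', rfl, rfl⟩ := h'
  obtain rfl := hW t t' ht ht' (hs.trans hs'.symm)
  simp

theorem IsStructurallyUnambiguous.derL_unique (hW : W.IsStructurallyUnambiguous)
    {ss : List (SkelTree T)} {Xs Xs' : List (Symbol T N)} {w w' : ℝ}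
    (h : W.DerL ss Xs w) (h' : W.DerL ss Xs' w') : Xs = Xs' ∧ w = w' := by
  induction ss generalizing Xs Xs' w w' with
  | nil =>
    rw [derL_nil] at h h'
    simp [h, h']
  | cons s ss ih =>
    obtain ⟨X, Ys, w₁, w₂, rfl, rfl, h1, h2⟩ := derL_cons.1 h
    obtain ⟨X', Ys', w₁', w₂', rfl, rfl, h1', h2'⟩ := derL_cons.1 h'
    obtain ⟨rfl, rfl⟩ := hW.der_unique h1 h1'
    obtain ⟨rfl, rfl⟩ := ih h2 h2'
    simp

theorem IsStructurallyUnambiguous.series_eq (hW : W.IsStructurallyUnambiguous) {s : SkelTree T}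
    {w : ℝ} (h : W.Der s (.nonterminal W.initial) w) : W.series s = w := by
  obtain ⟨t, ht, hs, hr, rfl⟩ := h
  have : {t : LabTree T N | W.IsDerivationTree t ∧ t.root = .nonterminal W.initial ∧
      t.skeleton = s} = {t} := by
    ext t'
    simp only [Set.mem_ofPred_eq, Set.mem_singleton_iff]
    constructor
    · rintro ⟨h1, -, h3⟩
      exact hW _ _ h1 ht (h3.trans hs.symm)
    · rintro rfl
      exact ⟨ht, hr, hs⟩
  rw [series, this, finsum_mem_singleton]

theorem series_eq_zero {s : SkelTree T} (h : ∀ w, ¬ W.Der s (.nonterminal W.initial) w) :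
    W.series s = 0 := by
  have : {t : LabTree T N | W.IsDerivationTree t ∧ t.root = .nonterminal W.initial ∧
      t.skeleton = s} = ∅ := by
    ext t'
    simp only [Set.mem_ofPred_eq, Set.mem_empty_iff_false, iff_false]
    rintro ⟨h1, h2, h3⟩
    exact h _ ⟨t', h1, h3, h2, rfl⟩
  rw [series, this, finsum_mem_empty]

theorem series_leaf (x : T) : W.series (.leaf x) = 0 :=
  series_eq_zero fun w h => by simp [der_leaf] at h

theorem series_nonneg (hW : W.IsNonneg) (s : SkelTree T) : 0 ≤ W.series s := by
  refine finsum_nonneg fun t => finsum_nonneg fun ht => ?_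
  refine List.prod_nonneg fun x hx => ?_
  obtain ⟨r, hr, rfl⟩ := List.mem_map.1 hx
  exact hW r (ht.1 r hr)

/-- A grammar in which the right-hand side determines the left-hand side is structurally
unambiguous. -/
theorem isStructurallyUnambiguous_of_output
    (h : ∀ r ∈ W.rules, ∀ r' ∈ W.rules, r.output = r'.output → r.input = r'.input) :
    W.IsStructurallyUnambiguous := by
  intro t
  induction t using LabTree.inductOn with
  | leaf x =>
    intro t' _ _ hs
    cases t' <;> simp_all [LabTree.skeleton]
  | node A ts ih =>
    intro t' ht ht' hs
    cases t' with
    | leaf x => simp [LabTree.skeleton] at hs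
    | node A' ts' =>
      rw [isDerivationTree_node] at ht ht'
      simp only [LabTree.skeleton, SkelTree.node.injEq] at hs
      have key : ∀ l : List (LabTree T N), (∀ t ∈ l, t ∈ ts) → ∀ l' : List (LabTree T N),
          (∀ t ∈ l', t ∈ ts') →
          l.map LabTree.skeleton = l'.map LabTree.skeleton → l = l' := by
        intro l
        induction l with
        | nil => intro _ l' _ hl; cases l' <;> simp_all
        | cons t l ihl =>
          intro hmem l' hmem' hl
          cases l' with
          | nil => simp at hl
          | cons t' l' =>
            simp only [List.map_cons, List.cons.injEq] at hl
            rw [ih t (hmem t (by simp)) t' (ht.2 t (hmem t (by simp)))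
              (ht'.2 t' (hmem' t' (by simp))) hl.1,
              ihl (fun u hu => hmem u (by simp [hu])) l' (fun u hu => hmem' u (by simp [hu])) hl.2]
      obtain rfl := key ts (fun _ h => h) ts' (fun _ h => h) hs
      obtain rfl : A = A' := h _ ht.1 _ ht'.1 rfl
      rfl

theorem not_der_of_rankLE {p : ℕ} (hp : W.RankLE p) {ss : List (SkelTree T)} (hss : p < ss.length)
    {X : Symbol T N} {w : ℝ} : ¬ W.Der (.node ss) X w := by
  rw [der_node]
  rintro ⟨r, hr, w', -, hd, -⟩
  have := hp r hr
  rw [hd.length_eq] at this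
  omega

end WCFG

end Derivations

/-! ### Contexts -/

section Contexts

variable {T N : Type}

/-- One step of a context: the hole is a list of trees; `hd r` closes it to a tree and puts `r`
after it, `tl x` puts the tree `x` before it. -/
inductive Frame (T : Type) : Type
  | hd (r : List (SkelTree T))
  | tl (x : SkelTree T)

def Frame.apply : Frame T → List (SkelTree T) → List (SkelTree T)
  | .hd r, ts => .node ts :: r
  | .tl x, ts => x :: ts

/-- Fill the hole of a context, given by its frames from the inside to the outside. -/
def plug : List (Frame T) → List (SkelTree T) → List (SkelTree T)
  | [], ts => ts
  | d :: c, ts => plug c (d.apply ts)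

/-- The hole of the context stands for a single tree. -/
def IsTreeCtx : List (Frame T) → Prop
  | [] => True
  | .hd _ :: _ => True
  | .tl _ :: _ => False

/-- The value of a tree series on the tree with the children `ts`. -/
def nodeVal (f : SkelTree T → ℝ) (ts : List (SkelTree T)) : ℝ := f (.node ts)

/-- What a context does to a tree depends only on the root symbol and linearly on the weight. -/
def CtxLinear (W : WCFG T N) (c : List (Frame T)) : Prop :=
  ∃ κ : Symbol T N → ℝ, ∀ ts,
    (∀ X w, W.Der (.node ts) X w → nodeVal W.series (plug c ts) = w * κ X) ∧
    ((∀ X w, ¬ W.Der (.node ts) X w) → nodeVal W.series (plug c ts) = 0)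

-- Induction from the outermost frame inwards. A frame adds a fixed sibling or a fixed list of
-- siblings; these have at most one derivation, which contributes fixed symbols and a constant
-- factor. Lists have to be treated together with trees because the intermediate holes stand for
-- lists of siblings.
open Classical in
theorem exists_hedge_linear {W : WCFG T N} (hW : W.IsStructurallyUnambiguous)
    (c : List (Frame T)) :
    (∃ κ : List (Symbol T N) → ℝ, ∀ ts,
      (∀ Xs w, W.DerL ts Xs w → nodeVal W.series (plug c ts) = w * κ Xs) ∧
      ((∀ Xs w, ¬ W.DerL ts Xs w) → nodeVal W.series (plug c ts) = 0)) ∧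
    (IsTreeCtx c → CtxLinear W c) := by
  have of_tree : ∀ c, CtxLinear W c → ∃ κ : List (Symbol T N) → ℝ, ∀ ts,
      (∀ Xs w, W.DerL ts Xs w → nodeVal W.series (plug c ts) = w * κ Xs) ∧
      ((∀ Xs w, ¬ W.DerL ts Xs w) → nodeVal W.series (plug c ts) = 0) := by
    rintro c ⟨κ, hκ⟩
    -- Any rule with this right-hand side will do: as soon as some list of trees derives `Xs`,
    -- unambiguity leaves only one.
    refine ⟨fun Xs => if h : ∃ r ∈ W.rules, r.output = Xs then
      W.weight h.choose * κ (.nonterminal h.choose.input) else 0, fun ts => ⟨fun Xs w hd => ?_,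
        fun hn => (hκ ts).2 fun X w hd => ?_⟩⟩
    · beta_reduce
      split_ifs with h
      · obtain ⟨hr, ho⟩ := h.choose_spec
        rw [(hκ ts).1 (.nonterminal h.choose.input) (W.weight h.choose * w)
          (WCFG.der_node.2 ⟨_, hr, w, rfl, by rwa [ho], rfl⟩)]
        ring
      · rw [mul_zero]
        refine (hκ ts).2 fun X w' hd' => ?_
        obtain ⟨r, hr, w'', -, hd'', -⟩ := WCFG.der_node.1 hd'
        exact h ⟨r, hr, (hW.derL_unique hd'' hd).1⟩
    · obtain ⟨r, hr, w'', -, hd'', -⟩ := WCFG.der_node.1 hd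
      exact hn _ _ hd''
  induction c with
  | nil =>
    have : CtxLinear W [] := by
      refine ⟨fun X => if X = .nonterminal W.initial then 1 else 0, fun ts => ⟨fun X w hd => ?_,
        fun hn => WCFG.series_eq_zero fun w hd => hn _ _ hd⟩⟩
      beta_reduce
      split_ifs with h
      · subst h
        rw [mul_one]
        exact hW.series_eq hd
      · rw [mul_zero]
        exact WCFG.series_eq_zero fun w' hd' => h (hW.der_unique hd hd').1
    exact ⟨of_tree _ this, fun _ => this⟩
  | cons d c ih =>
    obtain ⟨κ, hκ⟩ := ih.1
    cases d with
    | hd r =>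
      have : CtxLinear W (.hd r :: c) := by
        refine ⟨fun X => if h : ∃ q : List (Symbol T N) × ℝ, W.DerL r q.1 q.2 then
          h.choose.2 * κ (X :: h.choose.1) else 0, fun ts => ⟨fun X w hd => ?_,
            fun hn => (hκ (.node ts :: r)).2 fun Xs w hd => ?_⟩⟩
        · beta_reduce
          split_ifs with h
          · have := (hκ (.node ts :: r)).1 (X :: h.choose.1) (w * h.choose.2)
              (WCFG.derL_cons.2 ⟨_, _, _, _, rfl, rfl, hd, h.choose_spec⟩)
            simp only [plug, Frame.apply, this]
            ring
          · rw [mul_zero]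
            refine (hκ (.node ts :: r)).2 fun Xs w' hd' => ?_
            obtain ⟨Y, Ys, w₁, w₂, -, -, -, h2⟩ := WCFG.derL_cons.1 hd'
            exact h ⟨(Ys, w₂), h2⟩
        · obtain ⟨Y, Ys, w₁, w₂, -, -, h1, -⟩ := WCFG.derL_cons.1 hd
          exact hn _ _ h1
      exact ⟨of_tree _ this, fun _ => this⟩
    | tl x =>
      refine ⟨⟨fun Xs => if h : ∃ q : Symbol T N × ℝ, W.Der x q.1 q.2 then
          h.choose.2 * κ (h.choose.1 :: Xs) else 0, fun ts => ⟨fun Xs w hd => ?_,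
            fun hn => (hκ (x :: ts)).2 fun Ys w hd => ?_⟩⟩, fun h => h.elim⟩
      · beta_reduce
        split_ifs with h
        · have := (hκ (x :: ts)).1 (h.choose.1 :: Xs) (h.choose.2 * w)
            (WCFG.derL_cons.2 ⟨_, _, _, _, rfl, rfl, h.choose_spec, hd⟩)
          simp only [plug, Frame.apply, this]
          ring
        · rw [mul_zero]
          refine (hκ (x :: ts)).2 fun Ys w' hd' => ?_
          obtain ⟨Y, Ys, w₁, w₂, -, -, h1, -⟩ := WCFG.derL_cons.1 hd'
          exact h ⟨(Y, w₁), h1⟩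
      · obtain ⟨Y, Ys, w₁, w₂, -, -, -, h2⟩ := WCFG.derL_cons.1 hd
        exact hn _ _ h2

theorem ctxLinear_of_isTreeCtx {W : WCFG T N} (hW : W.IsStructurallyUnambiguous)
    {c : List (Frame T)} (hc : IsTreeCtx c) : CtxLinear W c :=
  (exists_hedge_linear hW c).2 hc

/-- The form in which the rank bound enters the analysis of the hypothesis. -/
theorem nodeVal_plug_eq_zero_of_rankLE {W : WCFG T N} (hW : W.IsStructurallyUnambiguous) {p : ℕ}
    (hp : W.RankLE p) {c : List (Frame T)} (hc : IsTreeCtx c) {ts : List (SkelTree T)}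
    (hts : p < ts.length) : nodeVal W.series (plug c ts) = 0 := by
  obtain ⟨κ, hκ⟩ := ctxLinear_of_isTreeCtx hW hc
  exact (hκ ts).2 fun X w => WCFG.not_der_of_rankLE hp hts

end Contexts

/-! ### Classification of trees by their values in finitely many contexts -/

section Classification

open Classical

variable {T : Type}

/-- A class of trees: a representative (given by its children), the number of its nonterminal, and
the factor by which its weights are scaled. -/
structure Cls (T : Type) where
  hedge : List (SkelTree T)
  label : ℕ
  scale : ℝ

variable (F : List (SkelTree T) → ℝ)

/-- On the contexts `C`, the tree `v` behaves as `ρ` times the tree `t`. -/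
def Proportional (C : List (List (Frame T))) (v t : List (SkelTree T)) (ρ : ℝ) : Prop :=
  ∀ c ∈ C, F (plug c v) = ρ * F (plug c t)

def NonzeroOn (C : List (List (Frame T))) (v : List (SkelTree T)) : Prop :=
  ∃ c ∈ C, F (plug c v) ≠ 0

/-- The only candidate for the factor between `v` and `t`. -/
def ratio (v t : List (SkelTree T)) : List (List (Frame T)) → ℝ
  | [] => 0
  | c :: C => if F (plug c t) = 0 then ratio v t C else F (plug c v) / F (plug c t)

/-- The first class to which `v` is proportional, with the factor. -/
def findCls (C : List (List (Frame T))) (v : List (SkelTree T)) : List (Cls T) → Option (Cls T × ℝ)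
  | [] => none
  | t :: Ts => if Proportional F C v t.hedge (ratio F v t.hedge C) then
      some (t, ratio F v t.hedge C) else findCls C v Ts

/-- Without a class, the defaults are the empty list and the factor 0. They are right exactly for
trees that vanish on all contexts, and they agree with what `hd` and `toReal` make of `nil`. -/
def rep : Option (Cls T × ℝ) → List (SkelTree T)
  | none => []
  | some r => r.1.hedge

def coef : Option (Cls T × ℝ) → ℝ
  | none => 0
  | some r => r.2

variable (Ts : List (Cls T)) (C : List (List (Frame T)))

def repTree : SkelTree T → SkelTree T
  | .leaf x => .leaf x
  | .node us => .node (rep (findCls F C us Ts))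

def coefTree : SkelTree T → ℝ
  | .leaf _ => 1
  | .node us => coef (findCls F C us Ts)

/-- Replace, from left to right, the trees of a list by their classes; report the first tree which
thereby is found not to behave as its class, with the context that shows this. -/
def splitAt (D : List (Frame T)) :
    List (SkelTree T) → Option (List (SkelTree T) × List (Frame T))
  | [] => none
  | .leaf x :: r => splitAt (.tl (.leaf x) :: D) r
  | .node us :: r =>
    if F (plug (.hd r :: D) us) =
        coef (findCls F C us Ts) * F (plug (.hd r :: D) (rep (findCls F C us Ts))) then
      splitAt (.tl (.node (rep (findCls F C us Ts))) :: D) r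
    else some (us, .hd r :: D)

/-- `C` serves for classification and stays fixed, while the recursion runs through the contexts in
which the replacement is tested. -/
def splitAny (v : List (SkelTree T)) :
    List (List (Frame T)) → Option (List (SkelTree T) × List (Frame T))
  | [] => none
  | c :: Cs => (splitAt F Ts C c v).or (splitAny v Cs)

/-- A new class found at the root of the tree with the children `v`. -/
def testHedge (v : List (SkelTree T)) : Option (List (SkelTree T) × List (Frame T)) :=
  if Proportional F C v (rep (findCls F C v Ts)) (coef (findCls F C v Ts)) then
    splitAny F Ts C v C
  -- The empty context is in `C` already; it is added again so that every class comes with one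
  -- context.
  else some (v, [])

-- The recursion also tests the tails of each list of children as if they were complete. This is
-- harmless, since each failed test gives a genuine new class, and it lets one program function
-- serve for trees and for lists: a node and the list of its children are the same value.
mutual
def scanTree : SkelTree T → Option (List (SkelTree T) × List (Frame T))
  | .leaf _ => none
  | .node ts => scanHedge ts
def scanHedge : List (SkelTree T) → Option (List (SkelTree T) × List (Frame T))
  | [] => testHedge F Ts C []
  | t :: ts => (testHedge F Ts C (t :: ts)).or ((scanTree t).or (scanHedge ts))
end

/-- The classes are nonzero and pairwise not proportional. -/
def Independent : Prop :=
  Ts.Pairwise (fun t t' => (∀ ρ, ¬ Proportional F C t.hedge t'.hedge ρ) ∧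
    (∀ ρ, ¬ Proportional F C t'.hedge t.hedge ρ)) ∧
  ∀ t ∈ Ts, NonzeroOn F C t.hedge

/-- With the additional context `c`, the tree `v` belongs to none of the classes. -/
def IsNew (v : List (SkelTree T)) (c : List (Frame T)) : Prop :=
  IsTreeCtx c ∧ NonzeroOn F (c :: C) v ∧ ∀ t ∈ Ts, ∀ ρ, ¬ Proportional F (c :: C) v t.hedge ρ

-- Independence, and why a failed test gives a new class

variable {F Ts C}

/-- The first context in which `t` does not vanish already forces the factor, so that testing this
one candidate decides proportionality. -/
theorem ratio_eq {v t : List (SkelTree T)} {ρ : ℝ} (h : Proportional F C v t ρ)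
    (ht : NonzeroOn F C t) : ratio F v t C = ρ := by
  induction C with
  | nil => simp [NonzeroOn] at ht
  | cons c C ih =>
    rw [ratio]
    split_ifs with hc
    · refine ih (fun c hc => h c (by simp [hc])) ?_
      obtain ⟨c', hc', hne⟩ := ht
      rcases List.mem_cons.1 hc' with rfl | hc'
      · exact absurd hc hne
      · exact ⟨c', hc', hne⟩
    · rw [h c (by simp)]
      field_simp

theorem ratio_nonneg (hF : ∀ v, 0 ≤ F v) (v t : List (SkelTree T)) : 0 ≤ ratio F v t C := by
  induction C with
  | nil => simp [ratio]
  | cons c C ih =>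
    rw [ratio]
    split_ifs with hc
    · exact ih
    · exact div_nonneg (hF _) (hF _)

theorem findCls_some {v : List (SkelTree T)} {r : Cls T × ℝ} (h : findCls F C v Ts = some r) :
    r.1 ∈ Ts ∧ Proportional F C v r.1.hedge r.2 ∧ r.2 = ratio F v r.1.hedge C := by
  induction Ts with
  | nil => simp [findCls] at h
  | cons t Ts ih =>
    rw [findCls] at h
    split_ifs at h with hp
    · cases h
      exact ⟨by simp, hp, rfl⟩
    · exact ⟨by simp [(ih h).1], (ih h).2⟩

theorem findCls_none {v : List (SkelTree T)} (hT : ∀ t ∈ Ts, NonzeroOn F C t.hedge)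
    (h : findCls F C v Ts = none) : ∀ t ∈ Ts, ∀ ρ, ¬ Proportional F C v t.hedge ρ := by
  induction Ts with
  | nil => simp
  | cons t Ts ih =>
    rw [findCls] at h
    split_ifs at h with hp
    intro t' ht' ρ hρ
    rcases List.mem_cons.1 ht' with rfl | ht'
    · rw [ratio_eq hρ (hT _ (by simp))] at hp
      exact hp hρ
    · exact ih (fun t ht => hT t (by simp [ht])) h t' ht' ρ hρ

theorem Proportional.coef_ne_zero {v t : List (SkelTree T)} {ρ : ℝ} (h : Proportional F C v t ρ)
    (hv : NonzeroOn F C v) : ρ ≠ 0 := by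
  rintro rfl
  obtain ⟨c, hc, hne⟩ := hv
  exact hne (by rw [h c hc, zero_mul])

theorem Proportional.coef_eq_zero {v t : List (SkelTree T)} {ρ : ℝ} (h : Proportional F C v t ρ)
    (ht : NonzeroOn F C t) (hv : ¬ NonzeroOn F C v) : ρ = 0 := by
  obtain ⟨c, hc, hne⟩ := ht
  by_contra hρ
  exact hv ⟨c, hc, by rw [h c hc]; exact mul_ne_zero hρ hne⟩

theorem Proportional.symm {v t : List (SkelTree T)} {ρ : ℝ} (h : Proportional F C v t ρ)
    (hρ : ρ ≠ 0) : Proportional F C t v ρ⁻¹ := by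
  intro c hc
  rw [h c hc]
  field_simp

theorem Proportional.trans {u v t : List (SkelTree T)} {ρ σ : ℝ} (h : Proportional F C u v ρ)
    (h' : Proportional F C v t σ) : Proportional F C u t (ρ * σ) := by
  intro c hc
  rw [h c hc, h' c hc]
  ring

theorem Independent.eq_of_proportional (hI : Independent F Ts C) {t t' : Cls T} (ht : t ∈ Ts)
    (ht' : t' ∈ Ts) {ρ : ℝ} (h : Proportional F C t.hedge t'.hedge ρ) : t = t' := by
  by_contra hne
  let R : Cls T → Cls T → Prop := fun t t' => (∀ ρ, ¬ Proportional F C t.hedge t'.hedge ρ) ∧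
    (∀ ρ, ¬ Proportional F C t'.hedge t.hedge ρ)
  have : Std.Symm R := ⟨fun _ _ h => ⟨h.2, h.1⟩⟩
  exact (List.Pairwise.forall (R := R) hI.1 ht ht' hne).1 ρ h

/-- The factor of a nonzero tree is nonzero and can be inverted, so two classes of `v` would be
proportional to each other. -/
theorem Independent.unique (hI : Independent F Ts C) {v : List (SkelTree T)}
    (hv : NonzeroOn F C v) {t t' : Cls T} (ht : t ∈ Ts) (ht' : t' ∈ Ts) {ρ ρ' : ℝ}
    (h : Proportional F C v t.hedge ρ) (h' : Proportional F C v t'.hedge ρ') :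
    t = t' ∧ ρ = ρ' := by
  obtain rfl := hI.eq_of_proportional ht ht' ((h.symm (h.coef_ne_zero hv)).trans h')
  refine ⟨rfl, ?_⟩
  obtain ⟨c, hc, hne⟩ := hI.2 t ht
  exact mul_right_cancel₀ hne ((h c hc).symm.trans (h' c hc))

/-- A further context can only destroy proportionalities. That no old class is a multiple of the new
one follows by inverting the factor, which is nonzero because the old class is. -/
theorem Independent.cons (hI : Independent F Ts C) {v : List (SkelTree T)} {c : List (Frame T)}
    (h : IsNew F Ts C v c) {t : Cls T} (ht : t.hedge = v) :
    Independent F (t :: Ts) (c :: C) := by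
  obtain ⟨-, hv, hn⟩ := h
  subst ht
  have mono : ∀ {u u' : List (SkelTree T)} {ρ}, Proportional F (c :: C) u u' ρ →
      Proportional F C u u' ρ := fun h c hc => h c (by simp [hc])
  have nz : ∀ t ∈ Ts, NonzeroOn F (c :: C) t.hedge := fun t ht => by
    obtain ⟨c, hc, hne⟩ := hI.2 t ht
    exact ⟨c, by simp [hc], hne⟩
  refine ⟨List.pairwise_cons.2 ⟨fun t' ht' => ⟨hn t' ht', fun ρ hρ => ?_⟩,
    hI.1.imp fun h => ⟨fun ρ hρ => h.1 ρ (mono hρ), fun ρ hρ => h.2 ρ (mono hρ)⟩⟩, ?_⟩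
  · exact hn t' ht' _ (hρ.symm (hρ.coef_ne_zero (nz t' ht')))
  · intro t' ht'
    rcases List.mem_cons.1 ht' with rfl | ht'
    · exact hv
    · exact nz t' ht'

theorem findCls_proportional_of_ne_none {v : List (SkelTree T)} (h : findCls F C v Ts ≠ none) :
    Proportional F C v (rep (findCls F C v Ts)) (coef (findCls F C v Ts)) := by
  obtain ⟨r, hr⟩ := Option.ne_none_iff_exists'.1 h
  rw [hr]
  exact (findCls_some hr).2.1

theorem isNew_of_not_proportional (hI : Independent F Ts C) {v : List (SkelTree T)}
    (h : ¬ Proportional F C v (rep (findCls F C v Ts)) (coef (findCls F C v Ts))) :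
    IsNew F Ts C v [] := by
  have hn : findCls F C v Ts = none := by
    by_contra hn
    exact h (findCls_proportional_of_ne_none hn)
  refine ⟨trivial, ?_, fun t ht ρ hρ => findCls_none hI.2 hn t ht ρ
    fun c hc => hρ c (by simp [hc])⟩
  rw [hn] at h
  simp only [Proportional, coef, zero_mul, not_forall] at h
  obtain ⟨c, hc, hne⟩ := h
  exact ⟨c, by simp [hc], hne⟩

/-- If `v` does not vanish on `C`, its class and factor are determined by `C`, and `d` refutes them.
If `v` vanishes on `C`, it could only be 0 times a class, and `d` shows that it is not zero. -/
theorem isNew_of_split (hI : Independent F Ts C) {v : List (SkelTree T)} {d : List (Frame T)}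
    (hd : IsTreeCtx d)
    (h : F (plug d v) ≠ coef (findCls F C v Ts) * F (plug d (rep (findCls F C v Ts)))) :
    IsNew F Ts C v d := by
  have mono : ∀ {u u' : List (SkelTree T)} {ρ}, Proportional F (d :: C) u u' ρ →
      Proportional F C u u' ρ := fun h c hc => h c (by simp [hc])
  cases hf : findCls F C v Ts with
  | none =>
    simp only [hf, coef, zero_mul] at h
    exact ⟨hd, ⟨d, by simp, h⟩, fun t ht ρ hρ => findCls_none hI.2 hf t ht ρ (mono hρ)⟩
  | some r =>
    obtain ⟨hr, hp, -⟩ := findCls_some hf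
    simp only [hf, coef, rep] at h
    by_cases hv : NonzeroOn F C v
    · refine ⟨hd, ?_, fun t ht ρ hρ => ?_⟩
      · obtain ⟨c, hc, hne⟩ := hv
        exact ⟨c, by simp [hc], hne⟩
      · obtain ⟨rfl, rfl⟩ := hI.unique hv ht hr (mono hρ) hp
        exact h (hρ d (by simp))
    · have h0 := hp.coef_eq_zero (hI.2 _ hr) hv
      rw [h0, zero_mul] at h
      refine ⟨hd, ⟨d, by simp, h⟩, fun t ht ρ hρ => ?_⟩
      have := (mono hρ).coef_eq_zero (hI.2 t ht) hv
      subst this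
      exact h (by rw [hρ d (by simp), zero_mul])

theorem isNew_of_splitAt (hI : Independent F Ts C) {D : List (Frame T)} {l : List (SkelTree T)}
    {e : List (SkelTree T) × List (Frame T)} (h : splitAt F Ts C D l = some e) :
    IsNew F Ts C e.1 e.2 := by
  induction l generalizing D with
  | nil => simp [splitAt] at h
  | cons t l ih =>
    cases t with
    | leaf x => rw [splitAt] at h; exact ih h
    | node us =>
      rw [splitAt] at h
      split_ifs at h with hc
      · exact ih h
      · cases h
        exact isNew_of_split hI trivial hc

theorem isNew_of_splitAny (hI : Independent F Ts C) {v : List (SkelTree T)}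
    {Cs : List (List (Frame T))} {e : List (SkelTree T) × List (Frame T)}
    (h : splitAny F Ts C v Cs = some e) : IsNew F Ts C e.1 e.2 := by
  induction Cs with
  | nil => simp [splitAny] at h
  | cons c Cs ih =>
    rw [splitAny, Option.or_eq_some_iff] at h
    rcases h with h | ⟨-, h⟩
    · exact isNew_of_splitAt hI h
    · exact ih h

theorem isNew_of_testHedge (hI : Independent F Ts C) {v : List (SkelTree T)}
    {e : List (SkelTree T) × List (Frame T)} (h : testHedge F Ts C v = some e) :
    IsNew F Ts C e.1 e.2 := by
  rw [testHedge] at h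
  split_ifs at h with hp
  · exact isNew_of_splitAny hI h
  · cases h
    exact isNew_of_not_proportional hI hp

theorem SkelTree.hedge_induction {P : SkelTree T → Prop} {Q : List (SkelTree T) → Prop}
    (leaf : ∀ x, P (.leaf x)) (node : ∀ ts, Q ts → P (.node ts)) (nil : Q [])
    (cons : ∀ t ts, P t → Q ts → Q (t :: ts)) (ts : List (SkelTree T)) : Q ts := by
  induction ts with
  | nil => exact nil
  | cons t ts ih =>
    exact cons t ts (SkelTree.rec (motive_1 := P) (motive_2 := Q) leaf node nil cons t) ih

theorem isNew_of_scanHedge (hI : Independent F Ts C) {s : List (SkelTree T)}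
    {e : List (SkelTree T) × List (Frame T)} :
    scanHedge F Ts C s = some e → IsNew F Ts C e.1 e.2 := by
  refine SkelTree.hedge_induction (P := fun t => scanTree F Ts C t = some e →
    IsNew F Ts C e.1 e.2) (Q := fun s => scanHedge F Ts C s = some e → IsNew F Ts C e.1 e.2)
    ?_ ?_ ?_ ?_ s
  · intro x h
    simp [scanTree] at h
  · intro ts ih h
    rw [scanTree] at h
    exact ih h
  · intro h
    rw [scanHedge] at h
    exact isNew_of_testHedge hI h
  · intro t ts ih1 ih2 h
    rw [scanHedge, Option.or_eq_some_iff, Option.or_eq_some_iff] at h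
    rcases h with h | ⟨-, h | ⟨-, h⟩⟩
    · exact isNew_of_testHedge hI h
    · exact ih1 h
    · exact ih2 h

/-- Telescoping: each successful test exchanges one child at the price of one factor. -/
theorem splitAt_eq_none {D : List (Frame T)} {l : List (SkelTree T)}
    (h : splitAt F Ts C D l = none) :
    F (plug D l) = (l.map (coefTree F Ts C)).prod * F (plug D (l.map (repTree F Ts C))) := by
  induction l generalizing D with
  | nil => simp
  | cons t l ih =>
    cases t with
    | leaf x =>
      rw [splitAt] at h
      simpa [plug, Frame.apply, coefTree, repTree] using ih h
    | node us =>
      rw [splitAt] at h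
      split_ifs at h with hc
      have := ih h
      simp only [plug, Frame.apply] at this hc
      simp only [List.map_cons, coefTree, repTree, List.prod_cons, hc, this]
      ring

theorem proportional_of_splitAny {v : List (SkelTree T)} {Cs : List (List (Frame T))}
    (h : splitAny F Ts C v Cs = none) :
    Proportional F Cs v (v.map (repTree F Ts C)) (v.map (coefTree F Ts C)).prod := by
  induction Cs with
  | nil => simp [Proportional]
  | cons c Cs ih =>
    rw [splitAny, Option.or_eq_none_iff] at h
    intro c' hc'
    rcases List.mem_cons.1 hc' with rfl | hc'
    · exact splitAt_eq_none h.1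
    · exact ih h.2 c' hc'

theorem testHedge_eq_none {v : List (SkelTree T)} (h : testHedge F Ts C v = none) :
    Proportional F C v (rep (findCls F C v Ts)) (coef (findCls F C v Ts)) ∧
    Proportional F C v (v.map (repTree F Ts C)) (v.map (coefTree F Ts C)).prod := by
  rw [testHedge] at h
  split_ifs at h with hp
  exact ⟨hp, proportional_of_splitAny h⟩

/-- In a tree without new classes, a property of the nodes follows from that of the children. -/
theorem scanHedge_none_induction {Q : SkelTree T → Prop} (leaf : ∀ x, Q (.leaf x))
    (node : ∀ ts, testHedge F Ts C ts = none → (∀ t ∈ ts, Q t) → Q (.node ts))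
    {s : List (SkelTree T)} (h : scanHedge F Ts C s = none) : Q (.node s) := by
  have key : ∀ s, scanHedge F Ts C s = none → testHedge F Ts C s = none ∧ ∀ t ∈ s, Q t := by
    refine SkelTree.hedge_induction (P := fun t => scanTree F Ts C t = none → Q t) ?_ ?_ ?_ ?_
    · exact fun x _ => leaf x
    · intro ts ih h
      rw [scanTree] at h
      exact node ts (ih h).1 (ih h).2
    · intro h
      rw [scanHedge] at h
      exact ⟨h, by simp⟩
    · intro t ts ih1 ih2 h
      rw [scanHedge, Option.or_eq_none_iff, Option.or_eq_none_iff] at h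
      refine ⟨h.1, fun u hu => ?_⟩
      rcases List.mem_cons.1 hu with rfl | hu
      · exact ih1 h.2.1
      · exact (ih2 h.2.2).2 u hu
  exact node s (key s h).1 (key s h).2

end Classification

/-! ### The number of classes -/

section Bound

variable {T N : Type} {W : WCFG T N} {Ts : List (Cls T)} {C : List (List (Frame T))}

/-- Without a derivation, or with one of weight 0, linearity would make the value vanish in every
context. -/
theorem exists_der_of_nonzeroOn (hW : W.IsStructurallyUnambiguous) (hC : ∀ c ∈ C, IsTreeCtx c)
    {v : List (SkelTree T)} (hv : NonzeroOn (nodeVal W.series) C v) :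
    ∃ A w, w ≠ 0 ∧ W.Der (.node v) (.nonterminal A) w := by
  obtain ⟨c, hc, hne⟩ := hv
  obtain ⟨κ, hκ⟩ := ctxLinear_of_isTreeCtx hW (hC c hc)
  by_contra hn
  refine hne ?_
  by_cases hX : ∃ X w, W.Der (.node v) X w
  · obtain ⟨X, w, hd⟩ := hX
    have hd' := hd
    obtain ⟨r, -, -, rfl, -⟩ := WCFG.der_node.1 hd
    have : w = 0 := by
      by_contra hw
      exact hn ⟨_, w, hw, hd'⟩
    rw [(hκ v).1 _ _ hd', this, zero_mul]
  · push Not at hX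
    exact (hκ v).2 hX

theorem proportional_of_der (hW : W.IsStructurallyUnambiguous) (hC : ∀ c ∈ C, IsTreeCtx c)
    {v v' : List (SkelTree T)} {X : Symbol T N} {w w' : ℝ} (h : W.Der (.node v) X w)
    (h' : W.Der (.node v') X w') (hw : w' ≠ 0) :
    Proportional (nodeVal W.series) C v v' (w / w') := by
  intro c hc
  obtain ⟨κ, hκ⟩ := ctxLinear_of_isTreeCtx hW (hC c hc)
  rw [(hκ v).1 _ _ h, (hκ v').1 _ _ h']
  field_simp

/-- The representatives have pairwise distinct root symbols, since trees with a common root and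
nonzero weights are proportional. -/
theorem Independent.length_le [Fintype N] (hW : W.IsStructurallyUnambiguous)
    (hC : ∀ c ∈ C, IsTreeCtx c) (hI : Independent (nodeVal W.series) Ts C) :
    Ts.length ≤ Fintype.card N := by
  classical
  have h : ∀ t : Cls T, ∃ A : N, t ∈ Ts → ∃ w, w ≠ 0 ∧
      W.Der (.node t.hedge) (.nonterminal A) w := by
    intro t
    by_cases ht : t ∈ Ts
    · obtain ⟨A, w, hw⟩ := exists_der_of_nonzeroOn hW hC (hI.2 t ht)
      exact ⟨A, fun _ => ⟨w, hw⟩⟩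
    · exact ⟨W.initial, fun h => absurd h ht⟩
  choose A hA using h
  have hnd : (Ts.map A).Nodup := by
    rw [List.Nodup, List.pairwise_map]
    refine hI.1.imp_of_mem fun {t t'} ht ht' hn heq => ?_
    obtain ⟨w, hw, hd⟩ := hA t ht
    obtain ⟨w', hw', hd'⟩ := hA t' ht'
    rw [heq] at hd
    exact hn.1 _ (proportional_of_der hW hC hd hd' hw')
  simpa using hnd.length_le_card

/-- At most one class has a nonzero value in the empty context. -/
theorem Independent.eq_of_ne_zero (hW : W.IsStructurallyUnambiguous)
    (hC : ∀ c ∈ C, IsTreeCtx c) (hI : Independent (nodeVal W.series) Ts C) {t t' : Cls T}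
    (ht : t ∈ Ts) (ht' : t' ∈ Ts) (h : nodeVal W.series t.hedge ≠ 0)
    (h' : nodeVal W.series t'.hedge ≠ 0) : t = t' := by
  have key : ∀ v : List (SkelTree T), nodeVal W.series v ≠ 0 →
      ∃ w, w ≠ 0 ∧ W.Der (.node v) (.nonterminal W.initial) w := by
    intro v hv
    by_contra hn
    refine hv ?_
    by_cases hX : ∃ w, W.Der (.node v) (.nonterminal W.initial) w
    · obtain ⟨w, hd⟩ := hX
      rw [nodeVal, hW.series_eq hd]
      by_contra hw
      exact hn ⟨w, hw, hd⟩
    · push Not at hX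
      exact WCFG.series_eq_zero hX
  obtain ⟨w, hw, hd⟩ := key _ h
  obtain ⟨w', hw', hd'⟩ := key _ h'
  exact hI.eq_of_proportional ht ht' (proportional_of_der hW hC hd hd' hw')

end Bound

/-! ### Tuples of bounded length -/

section Tuples

variable {α β : Type}

def extendAll (xs : List α) (ys : List (List α)) : List (List α) :=
  xs.flatMap (fun x => ys.map (x :: ·)) ++ [[]]

/-- All lists over `xs` of length at most `n`. -/
def tuples (xs : List α) : ℕ → List (List α)
  | 0 => [[]]
  | n + 1 => extendAll xs (tuples xs n)

theorem mem_tuples {xs : List α} {n : ℕ} {y : List α} :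
    y ∈ tuples xs n ↔ y.length ≤ n ∧ ∀ x ∈ y, x ∈ xs := by
  induction n generalizing y with
  | zero => cases y <;> simp [tuples]
  | succ n ih =>
    cases y with
    | nil => simp [tuples, extendAll]
    | cons x y => simp [tuples, extendAll, ih]; tauto

theorem map_tuples (φ : α → β) (xs : List α) (n : ℕ) :
    (tuples xs n).map (List.map φ) = tuples (xs.map φ) n := by
  induction n with
  | zero => simp [tuples]
  | succ n ih =>
    simp only [tuples, extendAll, ← ih]
    simp [List.flatMap_map, List.map_flatMap, Function.comp_def]

theorem nodup_tuples {xs : List α} (h : xs.Nodup) (n : ℕ) : (tuples xs n).Nodup := by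
  induction n with
  | zero => simp [tuples]
  | succ n ih =>
    simp only [tuples, extendAll]
    refine List.Nodup.append (List.nodup_flatMap.2 ⟨fun x _ => ?_, ?_⟩) (by simp) ?_
    · exact ih.map fun _ _ h => by simpa using h
    · refine h.imp fun {x x'} hne => ?_
      intro y hy hy'
      simp only [List.mem_map] at hy hy'
      obtain ⟨z, -, rfl⟩ := hy
      obtain ⟨z', -, h⟩ := hy'
      simp only [List.cons.injEq] at h
      exact hne h.1.symm
    · intro y hy hy'
      simp only [List.mem_singleton] at hy'
      subst hy'
      simp at hy

theorem length_tuples_le (xs : List α) (n : ℕ) : (tuples xs n).length ≤ (xs.length + 1) ^ n := by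
  induction n with
  | zero => simp [tuples]
  | succ n ih =>
    have : (tuples xs (n + 1)).length = xs.length * (tuples xs n).length + 1 := by
      simp [tuples, extendAll, List.length_flatMap]
    rw [this, pow_succ]
    have h1 : 1 ≤ (xs.length + 1) ^ n := Nat.one_le_pow _ _ (by omega)
    nlinarith [Nat.mul_le_mul_left xs.length ih]

end Tuples

/-! ### The hypothesis grammar -/

section Hypothesis

open Classical

variable {a : ℕ}

/-- A symbol of the hypothesis grammar, with the tree for which it stands. -/
structure Item (a : ℕ) where
  tree : SkelTree (Fin a)
  sym : Symbol (Fin a) ℕ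
  scale : ℝ

def Cls.toItem (t : Cls (Fin a)) : Item a := ⟨.node t.hedge, .nonterminal t.label, t.scale⟩

def leafItem (i : Fin a) : Item a := ⟨.leaf i, .terminal i, 1⟩

/-- The terminals below `i`. -/
def leafItems (a : ℕ) : ℕ → List (Item a)
  | 0 => []
  | i + 1 => if h : i < a then leafItem ⟨i, h⟩ :: leafItems a i else leafItems a i

def items (a : ℕ) (Ts : List (Cls (Fin a))) : List (Item a) :=
  leafItems a a ++ Ts.map Cls.toItem

/-- Labels are natural numbers because the number of classes grows during the run. `Fin.ofNat`
reduces modulo `k + 1`, which changes nothing for labels satisfying `Valid.label_le`. -/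
def finSym (k : ℕ) : Symbol (Fin a) ℕ → Symbol (Fin a) (Fin (k + 1))
  | .terminal i => .terminal i
  | .nonterminal j => .nonterminal (Fin.ofNat (k + 1) j)

variable (F : List (SkelTree (Fin a)) → ℝ) (p : ℕ) (Ts : List (Cls (Fin a)))
  (C : List (List (Frame (Fin a))))

/-- The weighted production with the right-hand side `y`, if there is one. -/
def hypEntry (y : List (Item a)) :
    Option (ContextFreeRule (Fin a) (Fin (Ts.length + 1)) × ℝ) :=
  (findCls F C (y.map Item.tree) Ts).map fun r =>
    (⟨Fin.ofNat (Ts.length + 1) r.1.label, y.map fun x => finSym Ts.length x.sym⟩,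
      -- The scales of the children cancel in a derivation, so a tree gets the weight "factor times
      -- scale of its class", as recorded in `Modelled`.
      r.2 * r.1.scale / (y.map Item.scale).prod)

def hypEntries : List (ContextFreeRule (Fin a) (Fin (Ts.length + 1)) × ℝ) :=
  (tuples (items a Ts) p).filterMap (hypEntry F Ts C)

/-- The hypothesis as the learner writes it. -/
def hyp : Code a where
  n := Ts.length + 1
  start := 0
  entries := hypEntries F p Ts C

/-- The hypothesis as a grammar. -/
def hypGrammar : WCFG (Fin a) (Fin (Ts.length + 1)) := (hyp F p Ts C).toWCFG

/-- The conditions on the classes and contexts which the learner maintains. -/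
structure Valid : Prop where
  ctx : ∀ c ∈ C, IsTreeCtx c
  nil_mem : [] ∈ C
  indep : Independent F Ts C
  scale : ∀ t ∈ Ts, t.scale = if F t.hedge = 0 then 1 else F t.hedge
  label_zero : ∀ t ∈ Ts, t.label = 0 ↔ F t.hedge ≠ 0
  label_le : ∀ t ∈ Ts, t.label ≤ Ts.length
  label_nodup : (Ts.map Cls.label).Nodup

/-- The class of a new tree. -/
def newCls (k : ℕ) (v : List (SkelTree (Fin a))) : Cls (Fin a) :=
  if F v = 0 then ⟨v, k, 1⟩ else ⟨v, 0, F v⟩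

variable {F p Ts C}

theorem newCls_hedge (k : ℕ) (v : List (SkelTree (Fin a))) : (newCls F k v).hedge = v := by
  rw [newCls]; split_ifs <;> rfl

theorem valid_nil : Valid F ([] : List (Cls (Fin a))) [[]] where
  ctx := by simp [IsTreeCtx]
  nil_mem := by simp
  indep := ⟨by simp, by simp⟩
  scale := by simp
  label_zero := by simp
  label_le := by simp
  label_nodup := by simp

/-- The label of the new class is fresh: it is either `Ts.length + 1`, above all labels in use, or
0. In the second case the value is nonzero, and `Independent.eq_of_ne_zero` excludes a second class
with label 0. -/
theorem Valid.cons {N : Type} {W : WCFG (Fin a) N} (hW : W.IsStructurallyUnambiguous)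
    (hV : Valid (nodeVal W.series) Ts C) {v : List (SkelTree (Fin a))}
    {c : List (Frame (Fin a))} (h : IsNew (nodeVal W.series) Ts C v c) :
    Valid (nodeVal W.series) (newCls (nodeVal W.series) (Ts.length + 1) v :: Ts) (c :: C) := by
  have hI := hV.indep.cons h (newCls_hedge (F := nodeVal W.series) (Ts.length + 1) v)
  have hctx : ∀ d ∈ c :: C, IsTreeCtx d := by
    intro d hd
    rcases List.mem_cons.1 hd with rfl | hd
    · exact h.1
    · exact hV.ctx d hd
  refine ⟨hctx, by simp [hV.nil_mem], hI, ?_, ?_, ?_, ?_⟩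
  · intro t ht
    rcases List.mem_cons.1 ht with rfl | ht
    · by_cases h0 : nodeVal W.series v = 0 <;> simp [newCls, h0]
    · exact hV.scale t ht
  · intro t ht
    rcases List.mem_cons.1 ht with rfl | ht
    · by_cases h0 : nodeVal W.series v = 0 <;> simp [newCls, h0]
    · exact hV.label_zero t ht
  · intro t ht
    rcases List.mem_cons.1 ht with rfl | ht
    · by_cases h0 : nodeVal W.series v = 0 <;> simp [newCls, h0]
    · exact (hV.label_le t ht).trans (by simp)
  · rw [List.map_cons, List.nodup_cons]
    refine ⟨fun hm => ?_, hV.label_nodup⟩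
    obtain ⟨t, ht, hl⟩ := List.mem_map.1 hm
    by_cases h0 : nodeVal W.series v = 0
    · have := hV.label_le t ht
      simp only [newCls, h0, if_true] at hl
      omega
    · have hl' : t.label = 0 := by simpa [newCls, h0] using hl
      have := hI.eq_of_ne_zero hW hctx (List.mem_cons_self) (List.mem_cons_of_mem _ ht)
        (by rwa [newCls_hedge]) ((hV.label_zero t ht).1 hl')
      refine h.2.2 t ht 1 ?_
      rw [← this, newCls_hedge]
      intro d _
      rw [one_mul]

-- Symbols of the hypothesis, and uniqueness of its rules

theorem mem_leafItems {x : Item a} {i : ℕ} :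
    x ∈ leafItems a i ↔ ∃ j : Fin a, j.1 < i ∧ x = leafItem j := by
  induction i with
  | zero => simp [leafItems]
  | succ i ih =>
    rw [leafItems]
    split_ifs with h
    · rw [List.mem_cons, ih]
      constructor
      · rintro (rfl | ⟨j, hj, rfl⟩)
        · exact ⟨⟨i, h⟩, by simp, rfl⟩
        · exact ⟨j, by omega, rfl⟩
      · rintro ⟨j, hj, rfl⟩
        rcases Nat.lt_succ_iff_lt_or_eq.1 hj with hj | hj
        · exact Or.inr ⟨j, hj, rfl⟩
        · left; congr; exact Fin.ext hj
    · rw [ih]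
      constructor
      · rintro ⟨j, hj, rfl⟩
        exact ⟨j, by omega, rfl⟩
      · rintro ⟨j, hj, rfl⟩
        exact ⟨j, by omega, rfl⟩

theorem leafItem_mem_items (j : Fin a) : leafItem j ∈ items a Ts :=
  List.mem_append_left _ (mem_leafItems.2 ⟨j, j.2, rfl⟩)

theorem length_leafItems (a i : ℕ) : (leafItems a i).length ≤ i := by
  induction i with
  | zero => simp [leafItems]
  | succ i ih =>
    rw [leafItems]
    split_ifs
    · simp [ih]
    · omega

theorem length_items_le : (items a Ts).length ≤ a + Ts.length := by
  simpa [items] using length_leafItems a a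

theorem nodup_leafItems_sym (i : ℕ) (k : ℕ) :
    ((leafItems a i).map fun x => finSym k x.sym).Nodup := by
  induction i with
  | zero => simp [leafItems]
  | succ i ih =>
    rw [leafItems]
    split_ifs with h
    · rw [List.map_cons, List.nodup_cons]
      refine ⟨fun hm => ?_, ih⟩
      obtain ⟨x, hx, he⟩ := List.mem_map.1 hm
      obtain ⟨j, hj, rfl⟩ := mem_leafItems.1 hx
      simp only [leafItem, finSym, Symbol.terminal.injEq] at he
      subst he
      simp at hj
    · exact ih

theorem Valid.nodup_items (hV : Valid F Ts C) :
    ((items a Ts).map fun x => finSym Ts.length x.sym).Nodup := by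
  rw [items, List.map_append]
  refine List.Nodup.append (nodup_leafItems_sym a _) ?_ ?_
  · rw [List.map_map]
    have := hV.label_nodup
    rw [List.Nodup, List.pairwise_map] at this ⊢
    refine this.imp_of_mem fun {t t'} ht ht' hne heq => hne ?_
    simp only [Function.comp, Cls.toItem, finSym, Symbol.nonterminal.injEq, Fin.ext_iff,
      Fin.val_ofNat] at heq
    rwa [Nat.mod_eq_of_lt (Nat.lt_succ_of_le (hV.label_le t ht)),
      Nat.mod_eq_of_lt (Nat.lt_succ_of_le (hV.label_le t' ht'))] at heq
  · intro x hx hx'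
    simp only [List.mem_map] at hx hx'
    obtain ⟨y, hy, rfl⟩ := hx
    obtain ⟨z, ⟨t, -, rfl⟩, he⟩ := hx'
    obtain ⟨j, -, rfl⟩ := mem_leafItems.1 hy
    simp [leafItem, Cls.toItem, finSym] at he

theorem Valid.tuple_unique (hV : Valid F Ts C) {y y' : List (Item a)}
    (hy : y ∈ tuples (items a Ts) p) (hy' : y' ∈ tuples (items a Ts) p)
    (h : (y.map fun x => finSym Ts.length x.sym) = y'.map fun x => finSym Ts.length x.sym) :
    y = y' := by
  have := nodup_tuples hV.nodup_items p
  rw [← map_tuples] at this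
  exact List.inj_on_of_nodup_map this hy hy' h

theorem Valid.hyp_nodup (hV : Valid F Ts C) :
    (hypEntries F p Ts C).Pairwise fun e e' => e.1.output ≠ e'.1.output := by
  have := nodup_tuples hV.nodup_items p
  rw [← map_tuples, List.Nodup, List.pairwise_map] at this
  refine List.Pairwise.filterMap _ ?_ this
  intro y y' hne e he e' he'
  rw [hypEntry, Option.map_eq_some_iff] at he he'
  obtain ⟨r, -, rfl⟩ := he
  obtain ⟨r', -, rfl⟩ := he'
  exact hne

theorem mem_hyp_entries {e : ContextFreeRule (Fin a) (Fin (Ts.length + 1)) × ℝ} :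
    e ∈ (hypEntries F p Ts C) ↔ ∃ y ∈ tuples (items a Ts) p, hypEntry F Ts C y = some e := by
  simp [hypEntries]

theorem mem_hyp_rules {r : ContextFreeRule (Fin a) (Fin (Ts.length + 1))} :
    r ∈ (hypGrammar F p Ts C).rules ↔ ∃ w, (r, w) ∈ (hypEntries F p Ts C) := by
  change r ∈ ((hypEntries F p Ts C).map Prod.fst).toFinset ↔ _
  simp

/-- `Code.toWCFG` adds up the weights of repeated productions; as right-hand sides are pairwise
distinct, the sum has one term. -/
theorem Valid.hyp_weight (hV : Valid F Ts C)
    {e : ContextFreeRule (Fin a) (Fin (Ts.length + 1)) × ℝ} (he : e ∈ (hypEntries F p Ts C)) :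
    (hypGrammar F p Ts C).weight e.1 = e.2 := by
  have key : ∀ l : List (ContextFreeRule (Fin a) (Fin (Ts.length + 1)) × ℝ),
      l.Pairwise (fun e e' => e.1.output ≠ e'.1.output) → e ∈ l →
      ((l.filter (fun e' => e'.1 = e.1)).map Prod.snd).sum = e.2 := by
    intro l
    induction l with
    | nil => simp
    | cons d l ih =>
      intro hp hm
      rw [List.pairwise_cons] at hp
      rcases List.mem_cons.1 hm with rfl | hm
      · have : l.filter (fun e' => e'.1 = e.1) = [] := by
          rw [List.filter_eq_nil_iff]
          intro d hd heq
          exact hp.1 d hd (by rw [of_decide_eq_true heq])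
        rw [List.filter_cons_of_pos (by simp), this]
        simp
      · rw [List.filter_cons_of_neg, ih hp.2 hm]
        simp only [decide_eq_true_eq]
        intro heq
        exact hp.1 e hm (by rw [heq])
  exact key _ hV.hyp_nodup he

theorem Valid.hyp_isStructurallyUnambiguous (hV : Valid F Ts C) :
    (hypGrammar F p Ts C).IsStructurallyUnambiguous := by
  refine WCFG.isStructurallyUnambiguous_of_output ?_
  intro r hr r' hr' heq
  obtain ⟨w, hw⟩ := mem_hyp_rules.1 hr
  obtain ⟨w', hw'⟩ := mem_hyp_rules.1 hr'
  by_contra hne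
  let R : ContextFreeRule (Fin a) (Fin (Ts.length + 1)) × ℝ →
    ContextFreeRule (Fin a) (Fin (Ts.length + 1)) × ℝ → Prop :=
      fun e e' => e.1.output ≠ e'.1.output
  have : Std.Symm R := ⟨fun _ _ h => Ne.symm h⟩
  refine List.Pairwise.forall (R := R) hV.hyp_nodup hw hw' ?_ heq
  intro h
  rw [Prod.mk.injEq] at h
  exact hne (by rw [h.1])

theorem Valid.scale_ne_zero (hV : Valid F Ts C) {x : Item a} (hx : x ∈ items a Ts) :
    x.scale ≠ 0 := by
  rcases List.mem_append.1 hx with hx | hx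
  · obtain ⟨j, -, rfl⟩ := mem_leafItems.1 hx
    simp [leafItem]
  · obtain ⟨t, ht, rfl⟩ := List.mem_map.1 hx
    simp only [Cls.toItem, hV.scale t ht]
    split_ifs with h
    · exact one_ne_zero
    · exact h

theorem Valid.scale_nonneg (hV : Valid F Ts C) (hF : ∀ v, 0 ≤ F v) {x : Item a}
    (hx : x ∈ items a Ts) : 0 ≤ x.scale := by
  rcases List.mem_append.1 hx with hx | hx
  · obtain ⟨j, -, rfl⟩ := mem_leafItems.1 hx
    simp [leafItem]
  · obtain ⟨t, ht, rfl⟩ := List.mem_map.1 hx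
    simp only [Cls.toItem, hV.scale t ht]
    split_ifs with h
    · exact zero_le_one
    · exact hF _

theorem Valid.hyp_isNonneg (hV : Valid F Ts C) (hF : ∀ v, 0 ≤ F v) :
    (hypGrammar F p Ts C).IsNonneg := by
  intro r hr
  obtain ⟨w, hw⟩ := mem_hyp_rules.1 hr
  rw [hV.hyp_weight hw]
  obtain ⟨y, hy, he⟩ := mem_hyp_entries.1 hw
  simp only [hypEntry, Option.map_eq_some_iff] at he
  obtain ⟨q, hq, he⟩ := he
  rw [Prod.mk.injEq] at he
  rw [← he.2]
  obtain ⟨hm, -, hr⟩ := findCls_some hq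
  refine div_nonneg (mul_nonneg (hr ▸ ratio_nonneg hF _ _) ?_) (List.prod_nonneg ?_)
  · exact hV.scale_nonneg hF (x := q.1.toItem) (List.mem_append_right _ (List.mem_map_of_mem hm))
  · intro x hx
    obtain ⟨z, hz, rfl⟩ := List.mem_map.1 hx
    exact hV.scale_nonneg hF ((mem_tuples.1 hy).2 z hz)

/-- The hypothesis grammar treats the tree `s` as its class. -/
def Modelled (F : List (SkelTree (Fin a)) → ℝ) (p : ℕ) (Ts : List (Cls (Fin a)))
    (C : List (List (Frame (Fin a)))) (s : SkelTree (Fin a)) : Prop :=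
  (coefTree F Ts C s ≠ 0 ∧ ∃ x ∈ items a Ts, x.tree = repTree F Ts C s ∧
    (hypGrammar F p Ts C).Der s (finSym Ts.length x.sym) (coefTree F Ts C s * x.scale)) ∨
  (coefTree F Ts C s = 0 ∧ ∀ X w, (hypGrammar F p Ts C).Der s X w → w = 0)

theorem modelled_list {l : List (SkelTree (Fin a))} (h : ∀ s ∈ l, Modelled F p Ts C s) :
    ((l.map (coefTree F Ts C)).prod ≠ 0 ∧ ∃ y : List (Item a), (∀ x ∈ y, x ∈ items a Ts) ∧
      y.map Item.tree = l.map (repTree F Ts C) ∧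
      (hypGrammar F p Ts C).DerL l (y.map fun x => finSym Ts.length x.sym)
        ((l.map (coefTree F Ts C)).prod * (y.map Item.scale).prod)) ∨
    ((l.map (coefTree F Ts C)).prod = 0 ∧ ∀ Xs w, (hypGrammar F p Ts C).DerL l Xs w → w = 0) := by
  induction l with
  | nil =>
    exact Or.inl ⟨by simp, [], by simp, by simp, WCFG.derL_nil.2 ⟨by simp, by simp⟩⟩
  | cons s l ih =>
    rcases h s (by simp) with ⟨h1, x, hx, ht, hd⟩ | ⟨h1, h2⟩
    · rcases ih fun s hs => h s (by simp [hs]) with ⟨h1', y, hy, ht', hd'⟩ | ⟨h1', h2'⟩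
      · refine Or.inl ⟨by simpa using ⟨h1, by simpa using h1'⟩, x :: y, ?_, ?_, ?_⟩
        · intro z hz
          rcases List.mem_cons.1 hz with rfl | hz
          · exact hx
          · exact hy z hz
        · simp [ht, ht']
        · refine WCFG.derL_cons.2 ⟨_, _, _, _, rfl, ?_, hd, hd'⟩
          simp only [List.map_cons, List.prod_cons]
          ring
      · refine Or.inr ⟨by rw [List.map_cons, List.prod_cons, h1', mul_zero], fun Xs w hdl => ?_⟩
        obtain ⟨X, Ys, w₁, w₂, -, rfl, -, hd'⟩ := WCFG.derL_cons.1 hdl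
        rw [h2' _ _ hd', mul_zero]
    · refine Or.inr ⟨by rw [List.map_cons, List.prod_cons, h1, zero_mul], fun Xs w hdl => ?_⟩
      obtain ⟨X, Ys, w₁, w₂, -, rfl, hd', -⟩ := WCFG.derL_cons.1 hdl
      rw [h2 _ _ hd', zero_mul]

/-- Since no test fails, `l` is a multiple of its class and also a multiple of the list of
representatives of its children. If both factors are nonzero, that list is in the same class as `l`,
and the entry for it carries the quotient of the two factors, which is just what the weight
requires. -/
theorem Valid.modelled_node (hV : Valid F Ts C)
    (hrank : ∀ c, IsTreeCtx c → ∀ v, p < v.length → F (plug c v) = 0)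
    {l : List (SkelTree (Fin a))} (h : testHedge F Ts C l = none)
    (hl : ∀ s ∈ l, Modelled F p Ts C s) : Modelled F p Ts C (.node l) := by
  obtain ⟨hp, hp'⟩ := testHedge_eq_none h
  have hI := hV.indep
  have hSU := hV.hyp_isStructurallyUnambiguous (p := p)
  have zero : ¬ NonzeroOn F C l → coefTree F Ts C (.node l) = 0 := by
    intro hn
    rw [coefTree]
    cases hf : findCls F C l Ts with
    | none => rfl
    | some r =>
      obtain ⟨hr, hpr, -⟩ := findCls_some hf
      exact hpr.coef_eq_zero (hI.2 _ hr) hn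
  rcases modelled_list hl with ⟨h1, y, hy, ht, hd⟩ | ⟨h1, h2⟩
  · rw [← ht] at hp'
    by_cases hn : NonzeroOn F C l
    · left
      -- A longer list of representatives would vanish in every context of `C`, and so would `l`.
      have hlen : y.length ≤ p := by
        by_contra hlt
        obtain ⟨c, hc, hne⟩ := hn
        refine hne ?_
        rw [hp' c hc, hrank c (hV.ctx c hc) _ (by simpa using hlt), mul_zero]
      have hρ := hp.coef_ne_zero hn
      refine ⟨hρ, ?_⟩
      cases hf : findCls F C l Ts with
      | none => simp [hf, coef] at hρ
      | some r =>
        obtain ⟨hr, hpr, -⟩ := findCls_some hf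
        have hyl := (hp'.symm h1).trans hpr
        have hny : NonzeroOn F C (y.map Item.tree) := by
          obtain ⟨c, hc, hne⟩ := hn
          refine ⟨c, hc, fun h0 => hne ?_⟩
          rw [hp' c hc, h0, mul_zero]
        cases hfy : findCls F C (y.map Item.tree) Ts with
        | none => exact absurd hyl (findCls_none hI.2 hfy _ hr _)
        | some q =>
          obtain ⟨hq, hpq, -⟩ := findCls_some hfy
          obtain ⟨heq, hqe⟩ := hI.unique hny hq hr hpq hyl
          refine ⟨r.1.toItem, List.mem_append_right _ (List.mem_map_of_mem hr), ?_, ?_⟩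
          · simp [Cls.toItem, repTree, hf, rep]
          · have hent : hypEntry F Ts C y = some
                (⟨Fin.ofNat (Ts.length + 1) q.1.label, y.map fun x => finSym Ts.length x.sym⟩,
                  q.2 * q.1.scale / (y.map Item.scale).prod) := by
              rw [hypEntry, hfy]; rfl
            have hmem := mem_hyp_entries.2 ⟨y, mem_tuples.2 ⟨hlen, hy⟩, hent⟩
            refine WCFG.der_node.2 ⟨_, mem_hyp_rules.2 ⟨_, hmem⟩, _, ?_, hd, ?_⟩
            · simp [Cls.toItem, finSym, heq]
            · rw [hV.hyp_weight hmem]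
              have hs : (y.map Item.scale).prod ≠ 0 := by
                refine List.prod_ne_zero fun hm => ?_
                obtain ⟨z, hz, h0⟩ := List.mem_map.1 hm
                exact hV.scale_ne_zero (hy z hz) h0
              simp only [coefTree, hf, coef, Cls.toItem, heq, hqe]
              field_simp
    -- Here `l` vanishes on `C` although the factors of its children do not. The hypothesis may
    -- still derive it, but only by the entry for `y`, and `y` vanishes on `C` as well, so that the
    -- entry has weight 0.
    · refine Or.inr ⟨zero hn, fun X w hdn => ?_⟩
      obtain ⟨r, hr, w', -, hdl, rfl⟩ := WCFG.der_node.1 hdn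
      obtain ⟨wr, hmem⟩ := mem_hyp_rules.1 hr
      obtain ⟨z, hz, hent⟩ := mem_hyp_entries.1 hmem
      obtain ⟨hout, -⟩ := hSU.derL_unique hdl hd
      have hw := hV.hyp_weight hmem
      simp only [hypEntry, Option.map_eq_some_iff] at hent
      obtain ⟨q, hq, he⟩ := hent
      rw [Prod.mk.injEq] at he
      have hout' : (z.map fun x => finSym Ts.length x.sym) =
          y.map fun x => finSym Ts.length x.sym := by
        rw [← hout, ← he.1]
      have hylen : y.length ≤ p := by
        have := congrArg List.length hout'
        simp only [List.length_map] at this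
        rw [← this]
        exact (mem_tuples.1 hz).1
      obtain rfl := hV.tuple_unique hz (mem_tuples.2 ⟨hylen, hy⟩) hout'
      obtain ⟨hq1, hq2, -⟩ := findCls_some hq
      have : q.2 = 0 := by
        refine hq2.coef_eq_zero (hI.2 _ hq1) ?_
        rintro ⟨c, hc, hne⟩
        exact hn ⟨c, hc, by rw [hp' c hc]; exact mul_ne_zero h1 hne⟩
      rw [hw, ← he.2, this]
      simp
  -- Here the factors of the children have product 0, and every derivation of the children has total
  -- weight 0.
  · refine Or.inr ⟨zero ?_, fun X w hdn => ?_⟩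
    · rintro ⟨c, hc, hne⟩
      exact hne (by rw [hp' c hc, h1, zero_mul])
    · obtain ⟨r, hr, w', -, hdl, rfl⟩ := WCFG.der_node.1 hdn
      rw [h2 _ _ hdl, mul_zero]

/-- The hypothesis grammar is right on every tree in which no new class is found. -/
theorem Valid.series_hyp (hV : Valid F Ts C)
    (hrank : ∀ c, IsTreeCtx c → ∀ v, p < v.length → F (plug c v) = 0)
    {s : List (SkelTree (Fin a))} (h : scanHedge F Ts C s = none) :
    (hypGrammar F p Ts C).series (.node s) = F s := by
  have hSU := hV.hyp_isStructurallyUnambiguous (p := p)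
  have hm : Modelled F p Ts C (.node s) ∧ (F s = coefTree F Ts C (.node s) *
      F (rep (findCls F C s Ts))) := by
    have key := scanHedge_none_induction (F := F) (Ts := Ts) (C := C)
      (Q := fun t => Modelled F p Ts C t ∧ ∀ l, t = .node l → F l = coefTree F Ts C (.node l) *
        F (rep (findCls F C l Ts))) ?_ ?_ h
    · exact ⟨key.1, key.2 s rfl⟩
    · intro x
      refine ⟨Or.inl ⟨by simp [coefTree], leafItem x, leafItem_mem_items x, by
        simp [leafItem, repTree], WCFG.der_leaf.2 ⟨by simp [leafItem, finSym], by
          simp [leafItem, coefTree]⟩⟩, by simp⟩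
    · intro l hl ih
      refine ⟨hV.modelled_node hrank hl fun s hs => (ih s hs).1, ?_⟩
      intro l' hl'
      cases hl'
      exact (testHedge_eq_none hl).1 [] hV.nil_mem
  obtain ⟨hm, hF⟩ := hm
  rcases hm with ⟨h1, x, hx, ht, hd⟩ | ⟨h1, h2⟩
  · cases hf : findCls F C s Ts with
    | none => simp [coefTree, hf, coef] at h1
    | some r =>
      obtain ⟨hr, -, -⟩ := findCls_some hf
      rw [hf, rep] at hF
      rcases List.mem_append.1 hx with hx | hx
      · obtain ⟨j, -, rfl⟩ := mem_leafItems.1 hx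
        simp [leafItem, repTree] at ht
      · obtain ⟨t, htT, rfl⟩ := List.mem_map.1 hx
        simp only [Cls.toItem, repTree, hf, rep, SkelTree.node.injEq] at ht
        have htr : t = r.1 := hV.indep.eq_of_proportional htT hr (ρ := 1)
          (fun c _ => by rw [ht, one_mul])
        subst htr
        simp only [Cls.toItem, finSym] at hd
        -- The class is the start symbol exactly if its value is nonzero; then its scale is this
        -- value, and factor times scale is `F s`.
        by_cases h0 : F r.1.hedge = 0
        · rw [hF, h0, mul_zero]
          refine WCFG.series_eq_zero fun w hd' => ?_
          have := (hSU.der_unique hd hd').1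
          simp only [Symbol.nonterminal.injEq] at this
          have h3 : (Fin.ofNat (Ts.length + 1) r.1.label).val = (0 : Fin (Ts.length + 1)).val :=
            congrArg Fin.val this
          rw [Fin.val_ofNat, Nat.mod_eq_of_lt (Nat.lt_succ_of_le (hV.label_le _ hr))] at h3
          exact (hV.label_zero _ hr).1 h3 h0
        · rw [(hV.label_zero _ hr).2 h0] at hd
          rw [hF, hSU.series_eq (w := coefTree F Ts C (.node s) * r.1.scale) hd,
            hV.scale _ hr, if_neg h0]
  · rw [hF, h1, zero_mul]
    by_cases hX : ∃ w, (hypGrammar F p Ts C).Der (.node s)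
        (.nonterminal (hypGrammar F p Ts C).initial) w
    · obtain ⟨w, hd⟩ := hX
      rw [hSU.series_eq hd]
      exact h2 _ _ hd
    · push Not at hX
      exact WCFG.series_eq_zero hX

/-- Consequently a counterexample to the hypothesis without classes has a nonzero value. -/
theorem series_hyp_nil (s : List (SkelTree (Fin a))) :
    (hypGrammar F p [] C).series (.node s) = 0 := by
  refine WCFG.series_eq_zero fun w hd => ?_
  obtain ⟨r, hr, -⟩ := WCFG.der_node.1 hd
  obtain ⟨w, hw⟩ := mem_hyp_rules.1 hr
  obtain ⟨y, -, he⟩ := mem_hyp_entries.1 hw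
  simp [hypEntry, findCls] at he

/-- If all trees of height one have the value zero, then one class does not suffice to explain a
tree with a nonzero value. -/
theorem scanHedge_ne_none_of_length_le_one (hV : Valid F Ts C) (hT : Ts.length ≤ 1)
    (hz : ∀ v : List (SkelTree (Fin a)), (∀ t ∈ v, ∃ x, t = .leaf x) → F v = 0)
    {s : List (SkelTree (Fin a))} (hs : F s ≠ 0) : scanHedge F Ts C s ≠ none := by
  intro h
  -- The class is unique and has a nonzero value in the empty context, so a tree of value 0 can only
  -- have the factor 0.
  have zero : ∀ t ∈ Ts, F t.hedge ≠ 0 → ∀ v, F v = 0 →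
      Proportional F C v (rep (findCls F C v Ts)) (coef (findCls F C v Ts)) →
      coef (findCls F C v Ts) = 0 := by
    intro t ht hne v hv hp
    cases hf : findCls F C v Ts with
    | none => rfl
    | some r =>
      have hr := (findCls_some hf).1
      obtain rfl : r.1 = t := by
        match Ts, hT, ht, hr with
        | [u], _, ht, hr => rw [List.mem_singleton.1 ht, List.mem_singleton.1 hr]
      have := hp [] hV.nil_mem
      simp only [plug, hf, rep, coef, hv] at this
      simpa [coef, hne] using this.symm
  have hT' : ∃ t ∈ Ts, F t.hedge ≠ 0 := by
    have : testHedge F Ts C s = none := by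
      cases s with
      | nil => simpa [scanHedge] using h
      | cons t s =>
        rw [scanHedge, Option.or_eq_none_iff] at h
        exact h.1
    have := (testHedge_eq_none this).1 [] hV.nil_mem
    simp only [plug] at this
    cases hf : findCls F C s Ts with
    | none => simp [hf, coef, hs] at this
    | some r =>
      refine ⟨r.1, (findCls_some hf).1, fun h0 => hs ?_⟩
      rw [this, hf, rep, h0, mul_zero]
  obtain ⟨t, ht, hne⟩ := hT'
  -- Zeros propagate upwards: a tree of height one has value 0 by assumption, and any other node has
  -- an inner child whose factor 0 annihilates the product. This reaches the root, whose value is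
  -- nonzero.
  have key := scanHedge_none_induction (F := F) (Ts := Ts) (C := C)
    (Q := fun u => ∀ l, u = .node l → F l = 0 ∧ coefTree F Ts C u = 0) (by simp) ?_ h
  · exact hs (key s rfl).1
  · rintro l hl ih _ ⟨⟩
    obtain ⟨hp, hp'⟩ := testHedge_eq_none hl
    have h0 : F l = 0 := by
      by_cases hleaf : ∀ u ∈ l, ∃ x, u = .leaf x
      · exact hz l hleaf
      · push Not at hleaf
        obtain ⟨u, hu, hux⟩ := hleaf
        cases u with
        | leaf x => exact absurd rfl (hux x)
        | node us =>
          have hc := (ih _ hu us rfl).2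
          have := hp' [] hV.nil_mem
          simp only [plug] at this
          rw [this, List.prod_eq_zero (List.mem_map.2 ⟨_, hu, hc⟩), zero_mul]
    exact ⟨h0, zero t ht hne l h0 hp⟩

end Hypothesis

/-! ### Rules for runs without equivalence queries -/

section Rules

variable {a : ℕ} {f : SkelTree (Fin a) → ℝ} {τ : Teacher a} {P : Program}

/-- The expression `e` has the value `v`, and its evaluation asks no equivalence query and takes at
most `t` steps. -/
def Runs (f : SkelTree (Fin a) → ℝ) (τ : Teacher a) (P : Program) (env : List Val) (e : Expr)
    (v : Val) (t : ℕ) : Prop :=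
  ∀ h, ∃ t' ≤ t, Eval f τ P h env e v h t'

namespace Runs

variable {env : List Val} {e e₁ e₂ e₃ : Expr} {v v₁ v₂ w x y : Val} {t t₁ t₂ t₃ : ℕ}

theorem mono (H : Runs f τ P env e v t₁) (ht : t₁ ≤ t) : Runs f τ P env e v t := fun h => by
  obtain ⟨t', ht', H'⟩ := H h
  exact ⟨t', ht'.trans ht, H'⟩

theorem var {i : ℕ} (hi : env[i]? = some v) : Runs f τ P env (.var i) v 1 :=
  fun _ => ⟨1, le_rfl, .var hi⟩

theorem nil : Runs f τ P env .nil .nil 1 := fun _ => ⟨1, le_rfl, .nil⟩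

theorem const {k : ℕ} : Runs f τ P env (.const k) (.num (k : ℝ)) 1 := fun _ => ⟨1, le_rfl, .const⟩

theorem const_zero : Runs f τ P env (.const 0) (.num 0) 1 := by
  simpa using const (f := f) (τ := τ) (P := P) (env := env) (k := 0)

theorem const_one : Runs f τ P env (.const 1) (.num 1) 1 := by
  simpa using const (f := f) (τ := τ) (P := P) (env := env) (k := 1)

theorem cons (H₁ : Runs f τ P env e₁ v₁ t₁) (H₂ : Runs f τ P env e₂ v₂ t₂) :
    Runs f τ P env (.cons e₁ e₂) (.pair v₁ v₂) (t₁ + t₂ + 1) := fun h => by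
  obtain ⟨t₁', h₁, H₁⟩ := H₁ h
  obtain ⟨t₂', h₂, H₂⟩ := H₂ h
  exact ⟨_, by omega, .cons H₁ H₂⟩

theorem hd' (H : Runs f τ P env e v t) : Runs f τ P env (.hd e) v.hd (t + 1) := fun h => by
  obtain ⟨t', h', H⟩ := H h
  exact ⟨_, by omega, .hd H⟩

theorem tl' (H : Runs f τ P env e v t) : Runs f τ P env (.tl e) v.tl (t + 1) := fun h => by
  obtain ⟨t', h', H⟩ := H h
  exact ⟨_, by omega, .tl H⟩

theorem hd (H : Runs f τ P env e (.pair x y) t) : Runs f τ P env (.hd e) x (t + 1) := hd' H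

theorem tl (H : Runs f τ P env e (.pair x y) t) : Runs f τ P env (.tl e) y (t + 1) := tl' H

theorem arith' {o : ArithOp} (H₁ : Runs f τ P env e₁ v₁ t₁) (H₂ : Runs f τ P env e₂ v₂ t₂) :
    Runs f τ P env (.arith o e₁ e₂) (.num (o.apply v₁.toReal v₂.toReal)) (t₁ + t₂ + 1) :=
  fun h => by
    obtain ⟨t₁', h₁, H₁⟩ := H₁ h
    obtain ⟨t₂', h₂, H₂⟩ := H₂ h
    exact ⟨_, by omega, .arith H₁ H₂⟩

theorem add {r s : ℝ} (H₁ : Runs f τ P env e₁ (.num r) t₁) (H₂ : Runs f τ P env e₂ (.num s) t₂) :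
    Runs f τ P env (.arith .add e₁ e₂) (.num (r + s)) (t₁ + t₂ + 1) := arith' H₁ H₂

theorem sub {r s : ℝ} (H₁ : Runs f τ P env e₁ (.num r) t₁) (H₂ : Runs f τ P env e₂ (.num s) t₂) :
    Runs f τ P env (.arith .sub e₁ e₂) (.num (r - s)) (t₁ + t₂ + 1) := arith' H₁ H₂

theorem mul {r s : ℝ} (H₁ : Runs f τ P env e₁ (.num r) t₁) (H₂ : Runs f τ P env e₂ (.num s) t₂) :
    Runs f τ P env (.arith .mul e₁ e₂) (.num (r * s)) (t₁ + t₂ + 1) := arith' H₁ H₂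

theorem div {r s : ℝ} (H₁ : Runs f τ P env e₁ (.num r) t₁) (H₂ : Runs f τ P env e₂ (.num s) t₂) :
    Runs f τ P env (.arith .div e₁ e₂) (.num (r / s)) (t₁ + t₂ + 1) := arith' H₁ H₂

theorem iteTrue (H : Runs f τ P env e v t) (hv : v ≠ .nil) (H₁ : Runs f τ P env e₁ w t₁) :
    Runs f τ P env (.ite e e₁ e₂) w (t + t₁ + 1) := fun h => by
  obtain ⟨t', h', H⟩ := H h
  obtain ⟨t₁', h₁, H₁⟩ := H₁ h
  exact ⟨_, by omega, .iteTrue H hv H₁⟩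

theorem iteFalse (H : Runs f τ P env e .nil t) (H₂ : Runs f τ P env e₂ w t₂) :
    Runs f τ P env (.ite e e₁ e₂) w (t + t₂ + 1) := fun h => by
  obtain ⟨t', h', H⟩ := H h
  obtain ⟨t₁', h₁, H₁⟩ := H₂ h
  exact ⟨_, by omega, .iteFalse H H₁⟩

open Classical in
theorem isPair (H : Runs f τ P env e v t) :
    Runs f τ P env (.isPair e) (Val.ofProp v.IsPair) (t + 1) := fun h => by
  obtain ⟨t', h', H⟩ := H h
  exact ⟨_, by omega, .isPair H⟩

open Classical in
theorem isNum (H : Runs f τ P env e v t) :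
    Runs f τ P env (.isNum e) (Val.ofProp v.IsNum) (t + 1) := fun h => by
  obtain ⟨t', h', H⟩ := H h
  exact ⟨_, by omega, .isNum H⟩

open Classical in
theorem eqNum (H₁ : Runs f τ P env e₁ v₁ t₁) (H₂ : Runs f τ P env e₂ v₂ t₂) :
    Runs f τ P env (.eqNum e₁ e₂) (Val.ofProp (v₁.toReal = v₂.toReal)) (t₁ + t₂ + 1) :=
  fun h => by
    obtain ⟨t₁', h₁, H₁⟩ := H₁ h
    obtain ⟨t₂', h₂, H₂⟩ := H₂ h
    exact ⟨_, by omega, .eqNum H₁ H₂⟩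

theorem ifPair (H : Runs f τ P env e (.pair x y) t) (H₁ : Runs f τ P env e₁ w t₁) :
    Runs f τ P env (.ite (.isPair e) e₁ e₂) w (t + t₁ + 2) :=
  (iteTrue H.isPair (by simp [Val.ofProp, Val.IsPair]) H₁).mono (by omega)

theorem ifPairNil (H : Runs f τ P env e .nil t) (H₂ : Runs f τ P env e₂ w t₂) :
    Runs f τ P env (.ite (.isPair e) e₁ e₂) w (t + t₂ + 2) := by
  have := H.isPair
  rw [Val.ofProp, if_neg (by simp [Val.IsPair])] at this
  exact (iteFalse this H₂).mono (by omega)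

theorem ifNum {r : ℝ} (H : Runs f τ P env e (.num r) t) (H₁ : Runs f τ P env e₁ w t₁) :
    Runs f τ P env (.ite (.isNum e) e₁ e₂) w (t + t₁ + 2) :=
  (iteTrue H.isNum (by simp [Val.ofProp, Val.IsNum]) H₁).mono (by omega)

theorem ifNotNum (H : Runs f τ P env e v t) (hv : ¬ v.IsNum) (H₂ : Runs f τ P env e₂ w t₂) :
    Runs f τ P env (.ite (.isNum e) e₁ e₂) w (t + t₂ + 2) := by
  have := H.isNum
  rw [Val.ofProp, if_neg hv] at this
  exact (iteFalse this H₂).mono (by omega)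

theorem ifEq {r s : ℝ} (H₁ : Runs f τ P env e₁ (.num r) t₁) (H₂ : Runs f τ P env e₂ (.num s) t₂)
    (h : r = s) {e' e'' : Expr} (H : Runs f τ P env e' w t) :
    Runs f τ P env (.ite (.eqNum e₁ e₂) e' e'') w (t₁ + t₂ + t + 2) :=
  (iteTrue (H₁.eqNum H₂) (by simp [Val.ofProp, Val.toReal, h]) H).mono (by omega)

theorem ifNe {r s : ℝ} (H₁ : Runs f τ P env e₁ (.num r) t₁) (H₂ : Runs f τ P env e₂ (.num s) t₂)
    (h : r ≠ s) {e' e'' : Expr} (H : Runs f τ P env e'' w t) :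
    Runs f τ P env (.ite (.eqNum e₁ e₂) e' e'') w (t₁ + t₂ + t + 2) := by
  have := H₁.eqNum H₂
  rw [Val.ofProp, if_neg (by simpa [Val.toReal] using h)] at this
  exact (iteFalse this H).mono (by omega)

theorem letIn (H₁ : Runs f τ P env e₁ v t₁) (H₂ : Runs f τ P (v :: env) e₂ w t₂) :
    Runs f τ P env (.letIn e₁ e₂) w (t₁ + t₂ + 1) := fun h => by
  obtain ⟨t₁', h₁, H₁⟩ := H₁ h
  obtain ⟨t₂', h₂, H₂⟩ := H₂ h
  exact ⟨_, by omega, .letIn H₁ H₂⟩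

theorem call {g : ℕ} {body : Expr} (hg : P[g]? = some body) (H₂ : Runs f τ P [v] body w t₂)
    (H₁ : Runs f τ P env e v t₁) : Runs f τ P env (.call g e) w (t₁ + t₂ + 1) := fun h => by
  obtain ⟨t₁', h₁, H₁⟩ := H₁ h
  obtain ⟨t₂', h₂, H₂⟩ := H₂ h
  exact ⟨_, by omega, .call H₁ hg H₂⟩

theorem smq {s : SkelTree (Fin a)} (H : Runs f τ P env e s.toVal t) :
    Runs f τ P env (.smq e) (.num (f s)) (t + s.toVal.size + 1) := fun h => by
  obtain ⟨t', h', H⟩ := H h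
  exact ⟨_, by omega, .smq s H⟩

end Runs

end Rules

/-! ### The program -/

section Program

/-- The `i`-th entry of a list. -/
def Expr.nth (e : Expr) : ℕ → Expr
  | 0 => .hd e
  | i + 1 => (Expr.tl e).nth i

/-- The `i`-th argument of a function. -/
abbrev arg (i : ℕ) : Expr := (Expr.var 0).nth i
/-- The `i`-th argument of a function, below one binder. -/
abbrev arg₁ (i : ℕ) : Expr := (Expr.var 1).nth i
/-- The `i`-th argument of a function, below two binders. -/
abbrev arg₂ (i : ℕ) : Expr := (Expr.var 2).nth i

abbrev args₁ (e₁ : Expr) : Expr := .cons e₁ .nil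
abbrev args₂ (e₁ e₂ : Expr) : Expr := .cons e₁ (args₁ e₂)
abbrev args₃ (e₁ e₂ e₃ : Expr) : Expr := .cons e₁ (args₂ e₂ e₃)
abbrev args₄ (e₁ e₂ e₃ e₄ : Expr) : Expr := .cons e₁ (args₃ e₂ e₃ e₄)
abbrev args₆ (e₁ e₂ e₃ e₄ e₅ e₆ : Expr) : Expr := .cons e₁ (.cons e₂ (args₄ e₃ e₄ e₅ e₆))

/-- Arguments: context, tree. -/
def plugBody : Expr :=
  .ite (.isPair (arg 0))
    (.call 1 (args₂ (.tl (arg 0))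
      -- The tag of a frame is `nil` for `Frame.hd` and 1 for `Frame.tl`.
      (.ite (.hd (.hd (arg 0))) (.cons (.tl (.hd (arg 0))) (arg 1))
        (.cons (arg 1) (.tl (.hd (arg 0)))))))
    (arg 1)

/-- The membership query for a tree in a context. -/
def query (c t : Expr) : Expr := .smq (.call 1 (args₂ c t))

/-- Arguments: contexts, tree, tree. -/
def ratioBody : Expr :=
  .ite (.isPair (arg 0))
    (.ite (.eqNum (query (.hd (arg 0)) (arg 2)) (.const 0))
      (.call 2 (args₃ (.tl (arg 0)) (arg 1) (arg 2)))
      (.arith .div (query (.hd (arg 0)) (arg 1)) (query (.hd (arg 0)) (arg 2))))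
    (.const 0)

/-- Arguments: contexts, tree, tree, factor. -/
def checkBody : Expr :=
  .ite (.isPair (arg 0))
    (.ite (.eqNum (query (.hd (arg 0)) (arg 1))
        (.arith .mul (arg 3) (query (.hd (arg 0)) (arg 2))))
      (.call 3 (args₄ (.tl (arg 0)) (arg 1) (arg 2) (arg 3)))
      .nil)
    (.const 1)

/-- Arguments: classes, contexts, tree. -/
def findBody : Expr :=
  .ite (.isPair (arg 0))
    (.letIn (.call 2 (args₃ (arg 1) (arg 2) (.hd (.hd (arg 0)))))
      (.ite (.call 3 (args₄ (arg₁ 1) (arg₁ 2) (.hd (.hd (arg₁ 0))) (.var 0)))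
        (.cons (.hd (arg₁ 0)) (.var 0))
        (.call 4 (args₃ (.tl (arg₁ 0)) (arg₁ 1) (arg₁ 2)))))
    .nil

/-- Arguments: classes, contexts, context, list of trees. -/
def splitAtBody : Expr :=
  .ite (.isPair (arg 3))
    (.ite (.isNum (.hd (arg 3)))
      (.call 5 (args₄ (arg 0) (arg 1) (.cons (.cons (.const 1) (.hd (arg 3))) (arg 2))
        (.tl (arg 3))))
      (.letIn (.call 4 (args₃ (arg 0) (arg 1) (.hd (arg 3))))
        (.letIn (.cons (.cons .nil (.tl (arg₁ 3))) (arg₁ 2))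
          (.ite (.eqNum (query (.var 0) (.hd (arg₂ 3)))
              (.arith .mul (.tl (.var 1)) (query (.var 0) (.hd (.hd (.var 1))))))
            (.call 5 (args₄ (arg₂ 0) (arg₂ 1)
              (.cons (.cons (.const 1) (.hd (.hd (.var 1)))) (arg₂ 2)) (.tl (arg₂ 3))))
            (.cons (.hd (arg₂ 3)) (.var 0))))))
    .nil

/-- Arguments: classes, contexts, contexts, tree. -/
def splitAnyBody : Expr :=
  .ite (.isPair (arg 2))
    (.letIn (.call 5 (args₄ (arg 0) (arg 1) (.hd (arg 2)) (arg 3)))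
      (.ite (.var 0) (.var 0)
        (.call 6 (args₄ (arg₁ 0) (arg₁ 1) (.tl (arg₁ 2)) (arg₁ 3)))))
    .nil

/-- Arguments: classes, contexts, tree. -/
def scanBody : Expr :=
  .ite (.isNum (arg 2)) .nil
    (.letIn (.call 4 (args₃ (arg 0) (arg 1) (arg 2)))
      (.ite (.call 3 (args₄ (arg₁ 1) (arg₁ 2) (.hd (.hd (.var 0))) (.tl (.var 0))))
        (.letIn (.call 6 (args₄ (arg₁ 0) (arg₁ 1) (arg₁ 1) (arg₁ 2)))
          (.ite (.var 0) (.var 0)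
            (.ite (.isPair (arg₂ 2))
              (.letIn (.call 7 (args₃ (arg₂ 0) (arg₂ 1) (.hd (arg₂ 2))))
                (.ite (.var 0) (.var 0)
                  (.call 7 (args₃ ((Expr.var 3).nth 0) ((Expr.var 3).nth 1)
                    (.tl ((Expr.var 3).nth 2))))))
              .nil)))
        (.cons (arg₁ 2) .nil)))

/-- Arguments: number, classes. -/
def leavesBody : Expr :=
  .ite (.eqNum (arg 0) (.const 0)) (arg 1)
    (.letIn (.arith .sub (arg 0) (.const 1))
      -- The tree and the symbol of a terminal are written as the same number.
      (.cons (.cons (.var 0) (.cons (.var 0) (.const 1))) (.call 8 (args₂ (.var 0) (arg₁ 1)))))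

/-- Arguments: item, tuples, tuples. -/
def extBody : Expr :=
  .ite (.isPair (arg 1))
    (.cons
      (.cons (.cons (.hd (arg 0)) (.hd (.hd (arg 1))))
        (.cons (.cons (.hd (.tl (arg 0))) (.hd (.tl (.hd (arg 1)))))
          -- The product of the scales is accumulated along with the tuple, so that a rule weight
          -- later takes a single division by it.
          (.arith .mul (.tl (.tl (arg 0))) (.tl (.tl (.hd (arg 1)))))))
      (.call 9 (args₃ (arg 0) (.tl (arg 1)) (arg 2))))
    (arg 2)

def emptyTuple : Expr := .cons .nil (.cons .nil (.const 1))

/-- Arguments: items, tuples. -/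
def extAllBody : Expr :=
  .ite (.isPair (arg 0))
    (.call 9 (args₃ (.hd (arg 0)) (arg 1) (.call 10 (args₂ (.tl (arg 0)) (arg 1)))))
    (.cons emptyTuple .nil)

/-- Arguments: number, items. -/
def tuplesBody : Expr :=
  .ite (.eqNum (arg 0) (.const 0)) (.cons emptyTuple .nil)
    (.call 10 (args₂ (arg 1) (.call 11 (args₂ (.arith .sub (arg 0) (.const 1)) (arg 1)))))

/-- Arguments: classes, contexts, tuples. -/
def entriesBody : Expr :=
  .ite (.isPair (arg 2))
    (.letIn (.call 4 (args₃ (arg 0) (arg 1) (.hd (.hd (arg 2)))))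
      (.ite (.var 0)
        (.cons
          (.cons (.hd (.hd (.tl (.hd (.var 0)))))
            (.cons (.hd (.tl (.hd (arg₁ 2))))
              (.arith .div (.arith .mul (.tl (.var 0)) (.tl (.tl (.hd (.var 0)))))
                (.tl (.tl (.hd (arg₁ 2)))))))
          (.call 12 (args₃ (arg₁ 0) (arg₁ 1) (.tl (arg₁ 2)))))
        (.call 12 (args₃ (arg₁ 0) (arg₁ 1) (.tl (arg₁ 2))))))
    .nil

/-- Argument: tuples. -/
def firstNonzeroBody : Expr :=
  .ite (.isPair (arg 0))
    (.ite (.eqNum (.smq (.hd (.hd (arg 0)))) (.const 0))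
      (.call 13 (args₁ (.tl (arg 0))))
      (.hd (.hd (arg 0))))
    .nil

/-- The class of the tree in variable `0`; the arguments of the loop are in variable `1`. -/
def newClsExpr : Expr :=
  .ite (.eqNum (.smq (.hd (.var 0))) (.const 0))
    -- Argument 4, the number of nonterminals of the current hypothesis, is also the first unused
    -- label.
    (.cons (.hd (.var 0)) (.cons (.cons (arg₁ 4) .nil) (.const 1)))
    (.cons (.hd (.var 0)) (.cons (.cons (.const 0) .nil) (.smq (.hd (.var 0)))))

/-- The code of the hypothesis; the arguments of the loop are in variable `1`. -/
def hypExpr : Expr :=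
  .cons (arg₁ 4) (.cons (.const 0)
    (.call 12 (args₃ (arg₁ 2) (arg₁ 3)
      (.call 11 (args₂ (arg₁ 1) (.call 8 (args₂ (arg₁ 0) (arg₁ 2))))))))

/-- Arguments: number of terminals, rank, classes, contexts, number of nonterminals, tree. -/
def loopBody : Expr :=
  .letIn (.call 7 (args₃ (arg 2) (arg 3) (arg 5)))
    (.ite (.var 0)
      (.call 14 (args₆ (arg₁ 0) (arg₁ 1) (.cons newClsExpr (arg₁ 2))
        (.cons (.tl (.var 0)) (arg₁ 3)) (.arith .add (arg₁ 4) (.const 1)) (arg₁ 5)))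
      (.letIn hypExpr
        (.letIn (.seq (.var 0))
          (.ite (.var 0)
            (.call 14 (args₆ ((Expr.var 3).nth 0) ((Expr.var 3).nth 1) ((Expr.var 3).nth 2)
              ((Expr.var 3).nth 3) ((Expr.var 3).nth 4) (.hd (.var 0))))
            (.var 1)))))

/-- Argument: pair of the number of terminals and the rank. -/
def mainBody : Expr :=
  .call 14 (args₆ (.hd (.var 0)) (.tl (.var 0)) .nil (.cons .nil .nil) (.const 1)
    -- The first tree to be examined is a tree of height one with a nonzero value if there is one;
    -- it costs no equivalence query.
    (.call 13 (args₁ (.call 11 (args₂ (.tl (.var 0)) (.call 8 (args₂ (.hd (.var 0)) .nil)))))))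

/-- The learner. -/
def learner : Program :=
  [mainBody, plugBody, ratioBody, checkBody, findBody, splitAtBody, splitAnyBody, scanBody,
    leavesBody, extBody, extAllBody, tuplesBody, entriesBody, firstNonzeroBody, loopBody]

end Program

/-! ### Data as values -/

section Data

variable {a : ℕ}

def hval (ts : List (SkelTree (Fin a))) : Val := Val.ofList (ts.map SkelTree.toVal)

def hsize (ts : List (SkelTree (Fin a))) : ℕ := (hval ts).size

theorem toVal_node (ts : List (SkelTree (Fin a))) : (SkelTree.node ts).toVal = hval ts := by
  rw [SkelTree.toVal, hval]

theorem toVal_leaf (i : Fin a) : (SkelTree.leaf i).toVal = .num (i : ℕ) := by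
  rw [SkelTree.toVal]

theorem hval_not_isNum (ts : List (SkelTree (Fin a))) : ¬ (hval ts).IsNum := by
  rintro ⟨r, hr⟩
  cases ts <;> simp [hval, Val.ofList] at hr

theorem hsize_nil : hsize ([] : List (SkelTree (Fin a))) = 1 := rfl

theorem hsize_cons (t : SkelTree (Fin a)) (ts : List (SkelTree (Fin a))) :
    hsize (t :: ts) = t.toVal.size + hsize ts + 1 := rfl

theorem length_le_hsize (ts : List (SkelTree (Fin a))) : ts.length + 1 ≤ hsize ts := by
  induction ts with
  | nil => simp [hsize_nil]
  | cons t ts ih => rw [hsize_cons, List.length_cons]; omega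

def frameVal : Frame (Fin a) → Val
  | .hd r => .pair .nil (hval r)
  | .tl x => .pair (.num 1) x.toVal

def cval (c : List (Frame (Fin a))) : Val := Val.ofList (c.map frameVal)

/-- The size which a context adds to a tree. -/
def csize : List (Frame (Fin a)) → ℕ
  | [] => 0
  | .hd r :: c => hsize r + 1 + csize c
  | .tl x :: c => x.toVal.size + 1 + csize c

theorem hsize_plug (c : List (Frame (Fin a))) (v : List (SkelTree (Fin a))) :
    hsize (plug c v) = hsize v + csize c := by
  induction c generalizing v with
  | nil => rfl
  | cons d c ih =>
    cases d with
    | hd r =>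
      simp only [plug, Frame.apply, ih, hsize_cons, csize, toVal_node]
      rw [show (hval v).size = hsize v from rfl]
      omega
    | tl x =>
      simp only [plug, Frame.apply, ih, hsize_cons, csize]
      omega

theorem length_le_csize (c : List (Frame (Fin a))) : c.length ≤ csize c := by
  induction c with
  | nil => simp
  | cons d c ih => cases d <;> simp only [List.length_cons, csize] <;> omega

def ctxsVal (C : List (List (Frame (Fin a)))) : Val := Val.ofList (C.map cval)

def clsVal (t : Cls (Fin a)) : Val :=
  .pair (hval t.hedge) (.pair (.pair (.num t.label) .nil) (.num t.scale))

def clssVal (Ts : List (Cls (Fin a))) : Val := Val.ofList (Ts.map clsVal)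

def foundVal : Option (Cls (Fin a) × ℝ) → Val
  | none => .nil
  | some r => .pair (clsVal r.1) (.num r.2)

def eventVal : Option (List (SkelTree (Fin a)) × List (Frame (Fin a))) → Val
  | none => .nil
  | some e => .pair (hval e.1) (cval e.2)

def symVal : Symbol (Fin a) ℕ → Val
  | .terminal i => .num (i : ℕ)
  | .nonterminal j => .pair (.num j) .nil

def itemVal (x : Item a) : Val := .pair x.tree.toVal (.pair (symVal x.sym) (.num x.scale))

def itemsVal (xs : List (Item a)) : Val := Val.ofList (xs.map itemVal)

def tupleVal (y : List (Item a)) : Val :=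
  .pair (hval (y.map Item.tree)) (.pair (Val.ofList (y.map fun x => symVal x.sym))
    (.num (y.map Item.scale).prod))

def tuplesVal (ys : List (List (Item a))) : Val := Val.ofList (ys.map tupleVal)

end Data

/-! ### Running the functions of the program -/

section Functions

open Classical

variable {a : ℕ} {f : SkelTree (Fin a) → ℝ} {τ : Teacher a}

theorem Runs.nth {P : Program} {env : List Val} {e : Expr} {l : List Val} {i t : ℕ} {v : Val}
    (H : Runs f τ P env e (Val.ofList l) t) (hi : l[i]? = some v) :
    Runs f τ P env (e.nth i) v (t + i + 1) := by
  induction i generalizing l e t with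
  | zero =>
    cases l with
    | nil => simp at hi
    | cons x l =>
      simp only [List.getElem?_cons_zero, Option.some.injEq] at hi
      subst hi
      exact H.hd
  | succ i ih =>
    cases l with
    | nil => simp at hi
    | cons x l => exact (ih (l := l) H.tl (by simpa using hi)).mono (by omega)

theorem Runs.arg {P : Program} {env l : List Val} {i j : ℕ} {v : Val}
    (hj : env[j]? = some (Val.ofList l)) (hi : l[i]? = some v) :
    Runs f τ P env ((Expr.var j).nth i) v (i + 2) :=
  ((Runs.var hj).nth hi).mono (by omega)

theorem Runs.node {P : Program} {env : List Val} {e : Expr} {ts : List (SkelTree (Fin a))} {t : ℕ}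
    (H : Runs f τ P env e (hval ts) t) : Runs f τ P env e (SkelTree.node ts).toVal t := by
  rwa [toVal_node]

theorem Runs.hedge {P : Program} {env : List Val} {e : Expr} {ts : List (SkelTree (Fin a))} {t : ℕ}
    (H : Runs f τ P env e (SkelTree.node ts).toVal t) : Runs f τ P env e (hval ts) t := by
  rwa [← toVal_node]

theorem runs_plug (c : List (Frame (Fin a))) (v : List (SkelTree (Fin a))) :
    Runs f τ learner [Val.ofList [cval c, hval v]] plugBody (hval (plug c v))
      (40 * (c.length + 1)) := by
  induction c generalizing v with
  | nil => exact (Runs.ifPairNil (.arg rfl rfl) (.arg rfl rfl)).mono (by simp)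
  | cons d c ih =>
    cases d with
    | hd r =>
      refine (Runs.ifPair (.arg rfl rfl) (.call rfl (ih (.node v :: r))
        (.cons (.tl (.arg rfl rfl)) (.cons (.iteFalse (.hd (.hd (.arg rfl rfl)))
          (.cons (.node (.arg rfl rfl)) (.tl (.hd (.arg rfl rfl))))) .nil)))).mono ?_
      simp only [List.length_cons]; omega
    | tl x =>
      refine (Runs.ifPair (.arg rfl rfl) (.call rfl (ih (x :: v))
        (.cons (.tl (.arg rfl rfl)) (.cons (.iteTrue (.hd (.hd (.arg rfl rfl))) (by simp)
          (.cons (.tl (.hd (.arg rfl rfl))) (.arg rfl rfl))) .nil)))).mono ?_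
      simp only [List.length_cons]; omega

/-- A context has at most `csize` frames, so assembling the tree and writing out the query are both
linear in `B`. -/
theorem runs_query {env : List Val} {c t : Expr} {d : List (Frame (Fin a))}
    {v : List (SkelTree (Fin a))} {t₁ t₂ B : ℕ} (Hc : Runs f τ learner env c (cval d) t₁)
    (Ht : Runs f τ learner env t (hval v) t₂) (hB : hsize v + csize d + 1 ≤ B) :
    Runs f τ learner env (query c t) (.num (nodeVal f (plug d v))) (t₁ + t₂ + 50 * B) := by
  have H := Runs.smq (s := .node (plug d v)) (by
    rw [toVal_node]
    exact Runs.call (g := 1) rfl (runs_plug d v) (.cons Hc (.cons Ht .nil)))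
  refine H.mono ?_
  rw [toVal_node, show (hval (plug d v)).size = hsize (plug d v) from rfl, hsize_plug]
  have := length_le_csize d
  omega

theorem runs_ratio {v t : List (SkelTree (Fin a))} {C : List (List (Frame (Fin a)))} {B : ℕ}
    (hv : ∀ c ∈ C, hsize v + csize c + 1 ≤ B) (ht : ∀ c ∈ C, hsize t + csize c + 1 ≤ B) :
    Runs f τ learner [Val.ofList [ctxsVal C, hval v, hval t]] ratioBody
      (.num (ratio (nodeVal f) v t C)) ((200 * B + 100) * (C.length + 1)) := by
  induction C with
  | nil => exact (Runs.ifPairNil (.arg rfl rfl) .const_zero).mono (by simp)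
  | cons c C ih =>
    have h1 := hv c (by simp)
    have h2 := ht c (by simp)
    have ih := ih (fun c hc => hv c (by simp [hc])) (fun c hc => ht c (by simp [hc]))
    have e : (200 * B + 100) * ((c :: C).length + 1) =
        (200 * B + 100) * (C.length + 1) + (200 * B + 100) := by
      rw [List.length_cons]; ring
    have hq := runs_query (f := f) (τ := τ) (env := [Val.ofList [ctxsVal (c :: C), hval v, hval t]])
      (.hd (.arg (j := 0) (i := 0) rfl rfl)) (.arg (j := 0) (i := 2) rfl rfl) h2
    rw [e, ratio]
    split_ifs with h0
    · exact (Runs.ifPair (.arg rfl rfl) (.ifEq hq .const_zero h0 (.call rfl ih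
        (.cons (.tl (.arg rfl rfl)) (.cons (.arg rfl rfl) (.cons (.arg rfl rfl) .nil)))))).mono
          (by omega)
    · exact (Runs.ifPair (.arg rfl rfl) (.ifNe hq .const_zero h0 (.div
        (runs_query (.hd (.arg rfl rfl)) (.arg rfl rfl) h1) hq))).mono (by omega)

/-- The factor is an arbitrary value because it is `nil` for a tree without a class, which
`Val.toReal` reads as 0. -/
theorem runs_check {v t : List (SkelTree (Fin a))} {C : List (List (Frame (Fin a)))} {B : ℕ}
    {ρ : Val} {r : ℝ} (hr : ρ.toReal = r)
    (hv : ∀ c ∈ C, hsize v + csize c + 1 ≤ B) (ht : ∀ c ∈ C, hsize t + csize c + 1 ≤ B) :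
    Runs f τ learner [Val.ofList [ctxsVal C, hval v, hval t, ρ]] checkBody
      (Val.ofProp (Proportional (nodeVal f) C v t r)) ((200 * B + 100) * (C.length + 1)) := by
  subst hr
  induction C with
  | nil =>
    rw [Val.ofProp, if_pos (by simp [Proportional])]
    exact (Runs.ifPairNil (.arg rfl rfl) .const_one).mono (by simp)
  | cons c C ih =>
    have h1 := hv c (by simp)
    have h2 := ht c (by simp)
    have ih := ih (fun c hc => hv c (by simp [hc])) (fun c hc => ht c (by simp [hc]))
    have e : (200 * B + 100) * ((c :: C).length + 1) =
        (200 * B + 100) * (C.length + 1) + (200 * B + 100) := by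
      rw [List.length_cons]; ring
    have hq := runs_query (f := f) (τ := τ) (env := [Val.ofList [ctxsVal (c :: C), hval v, hval t, ρ]])
      (.hd (.arg (j := 0) (i := 0) rfl rfl)) (.arg (j := 0) (i := 1) rfl rfl) h1
    have hq' := runs_query (f := f) (τ := τ) (env := [Val.ofList [ctxsVal (c :: C), hval v, hval t, ρ]])
      (.hd (.arg (j := 0) (i := 0) rfl rfl)) (.arg (j := 0) (i := 2) rfl rfl) h2
    have hm := Runs.arith' (o := .mul) (.arg (j := 0) (i := 3) rfl rfl) hq'
    rw [e]
    by_cases h0 : nodeVal f (plug c v) = ρ.toReal * nodeVal f (plug c t)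
    · have : Proportional (nodeVal f) (c :: C) v t ρ.toReal ↔
          Proportional (nodeVal f) C v t ρ.toReal := by
        simp [Proportional, h0]
      rw [show Val.ofProp (Proportional (nodeVal f) (c :: C) v t ρ.toReal) =
        Val.ofProp (Proportional (nodeVal f) C v t ρ.toReal) by simp only [Val.ofProp, this]]
      exact (Runs.ifPair (.arg rfl rfl) (.ifEq hq hm h0 (.call rfl ih
        (.cons (.tl (.arg rfl rfl)) (.cons (.arg rfl rfl) (.cons (.arg rfl rfl)
          (.cons (.arg rfl rfl) .nil))))))).mono (by omega)
    · rw [Val.ofProp, if_neg (fun h => h0 (h c (by simp)))]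
      exact (Runs.ifPair (.arg rfl rfl) (.ifNe hq hm h0 .nil)).mono (by omega)

theorem runs_find {v : List (SkelTree (Fin a))} {Ts : List (Cls (Fin a))}
    {C : List (List (Frame (Fin a)))} {B : ℕ} (hv : ∀ c ∈ C, hsize v + csize c + 1 ≤ B)
    (hT : ∀ t ∈ Ts, ∀ c ∈ C, hsize t.hedge + csize c + 1 ≤ B) :
    Runs f τ learner [Val.ofList [clssVal Ts, ctxsVal C, hval v]] findBody
      (foundVal (findCls (nodeVal f) C v Ts))
      ((400 * B + 300) * (C.length + 1) * (Ts.length + 1)) := by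
  induction Ts with
  | nil => exact (Runs.ifPairNil (.arg rfl rfl) .nil).mono (by simp; nlinarith)
  | cons t Ts ih =>
    have ih := ih fun t ht => hT t (by simp [ht])
    have h1 := runs_ratio (f := f) (τ := τ) hv (hT t (by simp))
    have h2 := runs_check (f := f) (τ := τ) (ρ := .num (ratio (nodeVal f) v t.hedge C))
      (r := ratio (nodeVal f) v t.hedge C) rfl hv
      (hT t (by simp))
    have e : (400 * B + 300) * (C.length + 1) * ((t :: Ts).length + 1) =
        (400 * B + 300) * (C.length + 1) * (Ts.length + 1) +
          (2 * ((200 * B + 100) * (C.length + 1)) + 100 * C.length + 100) := by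
      rw [List.length_cons]; ring
    rw [e, findCls]
    split_ifs with h0
    · rw [Val.ofProp, if_pos h0] at h2
      exact (Runs.ifPair (.arg rfl rfl) (.letIn (.call rfl h1 (.cons (.arg rfl rfl)
        (.cons (.arg rfl rfl) (.cons (.hd (.hd (.arg rfl rfl))) .nil))))
          (.iteTrue (.call rfl h2 (.cons (.arg rfl rfl) (.cons (.arg rfl rfl)
            (.cons (.hd (.hd (.arg rfl rfl))) (.cons (.var rfl) .nil))))) (by simp)
              (.cons (.hd (.arg rfl rfl)) (.var rfl))))).mono (by omega)
    · rw [Val.ofProp, if_neg h0] at h2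
      exact (Runs.ifPair (.arg rfl rfl) (.letIn (.call rfl h1 (.cons (.arg rfl rfl)
        (.cons (.arg rfl rfl) (.cons (.hd (.hd (.arg rfl rfl))) .nil))))
          (.iteFalse (.call rfl h2 (.cons (.arg rfl rfl) (.cons (.arg rfl rfl)
            (.cons (.hd (.hd (.arg rfl rfl))) (.cons (.var rfl) .nil)))))
              (.call rfl ih (.cons (.tl (.arg rfl rfl)) (.cons (.arg rfl rfl)
                (.cons (.arg rfl rfl) .nil))))))).mono (by omega)

/-- The cost of classifying a tree. -/
def findCost (B : ℕ) (Ts : List (Cls (Fin a))) (C : List (List (Frame (Fin a)))) : ℕ :=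
  (400 * B + 300) * (C.length + 1) * (Ts.length + 1)

theorem le_findCost (B : ℕ) (Ts : List (Cls (Fin a))) (C : List (List (Frame (Fin a)))) :
    400 * B + 300 ≤ findCost B Ts C := by
  rw [findCost, mul_assoc]
  exact Nat.le_mul_of_pos_right _ (by positivity)

theorem check_le_findCost (B : ℕ) (Ts : List (Cls (Fin a))) (C : List (List (Frame (Fin a)))) :
    (200 * B + 100) * (C.length + 1) ≤ findCost B Ts C := by
  rw [findCost]
  refine le_trans ?_ (Nat.le_mul_of_pos_right _ (by positivity))
  exact Nat.mul_le_mul_right _ (by omega)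

theorem hsize_rep_le {Ts : List (Cls (Fin a))} {C : List (List (Frame (Fin a)))} {Y : ℕ}
    (hY : 1 ≤ Y) (hT : ∀ t ∈ Ts, hsize t.hedge ≤ Y) (F : List (SkelTree (Fin a)) → ℝ)
    (v : List (SkelTree (Fin a))) : hsize (rep (findCls F C v Ts)) ≤ Y := by
  cases hf : findCls F C v Ts with
  | none => simpa [rep, hsize_nil] using hY
  | some r => exact hT _ (findCls_some hf).1

theorem runs_rep {env : List Val} {e : Expr} {r : Option (Cls (Fin a) × ℝ)} {t : ℕ}
    (H : Runs f τ learner env e (foundVal r) t) :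
    Runs f τ learner env (.hd (.hd e)) (hval (rep r)) (t + 2) := by
  cases r with
  | none => exact H.hd'.hd'
  | some r => exact H.hd.hd

theorem runs_coef_mul {env : List Val} {e e' : Expr} {r : Option (Cls (Fin a) × ℝ)} {t t' : ℕ}
    {x : ℝ} (H : Runs f τ learner env e (foundVal r) t) (H' : Runs f τ learner env e' (.num x) t') :
    Runs f τ learner env (.arith .mul (.tl e) e') (.num (coef r * x)) (t + t' + 2) := by
  cases r with
  | none => exact (Runs.arith' H.tl' H').mono (by omega)
  | some r => exact (Runs.arith' H.tl' H').mono (by omega)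

/-- `Y` bounds the trees and `B` the queries. Every child that is passed lengthens the context by at
most `Y + 1`, whence the summand `l.length * (Y + 1)`. -/
theorem runs_splitAt {Ts : List (Cls (Fin a))} {C : List (List (Frame (Fin a)))} {B Y : ℕ}
    (hY : 1 ≤ Y) (hT : ∀ t ∈ Ts, hsize t.hedge ≤ Y) (hC : ∀ c ∈ C, csize c + Y + 1 ≤ B)
    {D : List (Frame (Fin a))} {l : List (SkelTree (Fin a))} (hl : hsize l ≤ Y)
    (hD : csize D + l.length * (Y + 1) + Y + 1 ≤ B) :
    Runs f τ learner [Val.ofList [clssVal Ts, ctxsVal C, cval D, hval l]] splitAtBody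
      (eventVal (splitAt (nodeVal f) Ts C D l)) (2 * findCost B Ts C * (l.length + 1)) := by
  have hB := le_findCost B Ts C
  induction l generalizing D with
  | nil => exact (Runs.ifPairNil (.arg rfl rfl) .nil).mono (by simp; omega)
  | cons s l ih =>
    rw [hsize_cons] at hl
    have e : 2 * findCost B Ts C * ((s :: l).length + 1) =
        2 * findCost B Ts C * (l.length + 1) + 2 * findCost B Ts C := by
      rw [List.length_cons]; ring
    rw [List.length_cons, Nat.add_mul] at hD
    rw [e]
    cases s with
    | leaf x =>
      rw [toVal_leaf] at hl
      have ih := ih (D := .tl (.leaf x) :: D) (by omega) (by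
        simp only [csize, toVal_leaf, Val.size]; omega)
      have h1 : ∀ {env : List Val} {e : Expr} {t : ℕ},
          Runs f τ learner env e (SkelTree.leaf x).toVal t →
          Runs f τ learner env e (.num (x : ℕ)) t := fun H => by rwa [← toVal_leaf]
      rw [splitAt]
      exact (Runs.ifPair (.arg rfl rfl) (.ifNum (h1 (.hd (.arg rfl rfl))) (.call rfl ih
        (.cons (.arg rfl rfl) (.cons (.arg rfl rfl) (.cons (.cons (.cons .const_one
          (.hd (.arg rfl rfl))) (.arg rfl rfl)) (.cons (.tl (.arg rfl rfl)) .nil))))))).mono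
            (by omega)
    | node us =>
      have hus : (SkelTree.node us).toVal.size = hsize us := by rw [toVal_node]; rfl
      rw [hus] at hl
      have hrep := hsize_rep_le hY hT (nodeVal f) us (C := C)
      have hfind := runs_find (f := f) (τ := τ) (v := us) (Ts := Ts) (C := C) (B := B)
        (fun c hc => by have := hC c hc; omega)
        (fun t ht c hc => by have := hC c hc; have := hT t ht; omega)
      rw [← findCost] at hfind
      have hnum : ¬ (SkelTree.node us).toVal.IsNum := by rw [toVal_node]; exact hval_not_isNum us
      have ih := ih (D := .tl (.node (rep (findCls (nodeVal f) C us Ts))) :: D) (by omega) (by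
        simp only [csize, toVal_node]
        have : (hval (rep (findCls (nodeVal f) C us Ts))).size =
          hsize (rep (findCls (nodeVal f) C us Ts)) := rfl
        omega)
      have hcs : csize (.hd l :: D) = hsize l + 1 + csize D := rfl
      let env : List Val := [cval (.hd l :: D), foundVal (findCls (nodeVal f) C us Ts),
        Val.ofList [clssVal Ts, ctxsVal C, cval D, hval (.node us :: l)]]
      have hq1 := runs_query (f := f) (τ := τ) (env := env) (c := .var 0)
        (t := .hd ((Expr.var 2).nth 3)) (d := .hd l :: D) (v := us) (B := B)
        (.var rfl) (.hedge (.hd (.arg rfl rfl))) (by omega)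
      have hq2 := runs_coef_mul (f := f) (τ := τ) (env := env) (e := .var 1)
        (r := findCls (nodeVal f) C us Ts) (.var rfl)
        (runs_query (f := f) (τ := τ) (env := env) (c := .var 0)
          (d := .hd l :: D) (v := rep (findCls (nodeVal f) C us Ts)) (B := B)
          (.var rfl) (runs_rep (.var (i := 1) rfl)) (by omega))
      rw [splitAt]
      split_ifs with h0
      · exact (Runs.ifPair (.arg rfl rfl) (.ifNotNum (.hd (.arg rfl rfl)) hnum
          (.letIn (.call rfl hfind (.cons (.arg rfl rfl) (.cons (.arg rfl rfl)
            (.cons (.hedge (.hd (.arg rfl rfl))) .nil))))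
          (.letIn (v := cval (.hd l :: D)) (.cons (.cons .nil (.tl (.arg rfl rfl))) (.arg rfl rfl))
          (.ifEq hq1 hq2 h0 (.call rfl ih (.cons (.arg rfl rfl) (.cons (.arg rfl rfl)
            (.cons (.cons (.cons .const_one (.node (runs_rep (.var rfl)))) (.arg rfl rfl))
              (.cons (.tl (.arg rfl rfl)) .nil)))))))))).mono (by omega)
      · exact (Runs.ifPair (.arg rfl rfl) (.ifNotNum (.hd (.arg rfl rfl)) hnum
          (.letIn (.call rfl hfind (.cons (.arg rfl rfl) (.cons (.arg rfl rfl)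
            (.cons (.hedge (.hd (.arg rfl rfl))) .nil))))
          (.letIn (v := cval (.hd l :: D)) (.cons (.cons .nil (.tl (.arg rfl rfl))) (.arg rfl rfl))
          (.ifNe hq1 hq2 h0 (.cons (.hedge (.hd (.arg rfl rfl))) (.var rfl))))))).mono (by omega)

end Functions

-- Scanning a tree and writing down the hypothesis

section Functions

open Classical

variable {a : ℕ} {f : SkelTree (Fin a) → ℝ} {τ : Teacher a}

/-- `e` if this is an event, and otherwise `e'`. -/
theorem runs_or {env : List Val} {e e' : Expr}
    {x y : Option (List (SkelTree (Fin a)) × List (Frame (Fin a)))} {t t' : ℕ}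
    (H : Runs f τ learner env e (eventVal x) t)
    (H' : x = none → Runs f τ learner (eventVal x :: env) e' (eventVal y) t') :
    Runs f τ learner env (.letIn e (.ite (.var 0) (.var 0) e')) (eventVal (x.or y))
      (t + t' + 4) := by
  cases x with
  | none => exact (Runs.letIn H (.iteFalse (.var rfl) (H' rfl))).mono (by omega)
  | some x =>
    exact (Runs.letIn H (.iteTrue (.var rfl) (by simp [eventVal]) (.var rfl))).mono (by omega)

theorem runs_splitAny {Ts : List (Cls (Fin a))} {C : List (List (Frame (Fin a)))} {B Y : ℕ}
    (hY : 1 ≤ Y) (hT : ∀ t ∈ Ts, hsize t.hedge ≤ Y)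
    (hC : ∀ c ∈ C, csize c + Y * (Y + 1) + Y + 1 ≤ B) {v : List (SkelTree (Fin a))}
    (hv : hsize v ≤ Y) {Cs : List (List (Frame (Fin a)))} (hCs : ∀ c ∈ Cs, c ∈ C) :
    Runs f τ learner [Val.ofList [clssVal Ts, ctxsVal C, ctxsVal Cs, hval v]] splitAnyBody
      (eventVal (splitAny (nodeVal f) Ts C v Cs))
      (3 * findCost B Ts C * Y * (Cs.length + 1)) := by
  have hB := le_findCost B Ts C
  have hlen := length_le_hsize v
  have hS : 2 * findCost B Ts C * (v.length + 1) + findCost B Ts C ≤ 3 * findCost B Ts C * Y := by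
    nlinarith [Nat.mul_le_mul_left (findCost B Ts C) (hlen.trans hv),
      Nat.mul_le_mul_left (findCost B Ts C) hY]
  induction Cs with
  | nil => exact (Runs.ifPairNil (.arg rfl rfl) .nil).mono (by simp; omega)
  | cons c Cs ih =>
    have ih := ih fun c hc => hCs c (by simp [hc])
    have hc := hC c (hCs c (by simp))
    have hle : v.length * (Y + 1) ≤ Y * (Y + 1) := Nat.mul_le_mul_right _ (by omega)
    have hs := runs_splitAt (f := f) (τ := τ) (Ts := Ts) (C := C) (B := B) hY hT
      (fun c hc => by have := hC c hc; omega) (D := c) hv (by omega)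
    have e : 3 * findCost B Ts C * Y * ((c :: Cs).length + 1) =
        3 * findCost B Ts C * Y * (Cs.length + 1) + 3 * findCost B Ts C * Y := by
      rw [List.length_cons]; ring
    rw [e, splitAny]
    exact (Runs.ifPair (.arg rfl rfl) (runs_or (.call rfl hs (.cons (.arg rfl rfl)
      (.cons (.arg rfl rfl) (.cons (.hd (.arg rfl rfl)) (.cons (.arg rfl rfl) .nil)))))
        fun _ => .call rfl ih (.cons (.arg rfl rfl) (.cons (.arg rfl rfl)
          (.cons (.tl (.arg rfl rfl)) (.cons (.arg rfl rfl) .nil)))))).mono (by omega)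

/-- The cost of looking for a new class, for each node. -/
def scanCost (B Y : ℕ) (Ts : List (Cls (Fin a))) (C : List (List (Frame (Fin a)))) : ℕ :=
  4 * findCost B Ts C + 3 * findCost B Ts C * Y * (C.length + 1)

/-- The part of a scan common to empty and nonempty lists. The continuation is run under two more
bound values, the result of the replacement tests and the class found, neither of which it reads. -/
theorem runs_scan_step {Ts : List (Cls (Fin a))} {C : List (List (Frame (Fin a)))} {B Y : ℕ}
    (hY : 1 ≤ Y) (hT : ∀ t ∈ Ts, hsize t.hedge ≤ Y)
    (hC : ∀ c ∈ C, csize c + Y * (Y + 1) + Y + 1 ≤ B) {v : List (SkelTree (Fin a))}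
    (hv : hsize v ≤ Y) {w : Option (List (SkelTree (Fin a)) × List (Frame (Fin a)))} {t : ℕ}
    (H : ∀ x y, Runs f τ learner [x, y, Val.ofList [clssVal Ts, ctxsVal C, hval v]]
      (.ite (.isPair (arg₂ 2))
        (.letIn (.call 7 (args₃ (arg₂ 0) (arg₂ 1) (.hd (arg₂ 2))))
          (.ite (.var 0) (.var 0)
            (.call 7 (args₃ ((Expr.var 3).nth 0) ((Expr.var 3).nth 1)
              (.tl ((Expr.var 3).nth 2))))))
        .nil) (eventVal w) t) :
    Runs f τ learner [Val.ofList [clssVal Ts, ctxsVal C, hval v]] scanBody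
      (eventVal ((testHedge (nodeVal f) Ts C v).or w)) (scanCost B Y Ts C + t) := by
  have hB := le_findCost B Ts C
  have hB' := check_le_findCost B Ts C
  have hrep := hsize_rep_le hY hT (nodeVal f) v (C := C)
  have hfind := runs_find (f := f) (τ := τ) (v := v) (Ts := Ts) (C := C) (B := B)
    (fun c hc => by have := hC c hc; omega)
    (fun t ht c hc => by have := hC c hc; have := hT t ht; omega)
  rw [← findCost] at hfind
  have hsp := runs_splitAny (f := f) (τ := τ) hY hT hC hv (Cs := C) fun _ h => h
  have hcoef : (foundVal (findCls (nodeVal f) C v Ts)).tl.toReal =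
      coef (findCls (nodeVal f) C v Ts) := by
    cases findCls (nodeVal f) C v Ts <;> rfl
  have hch := runs_check (f := f) (τ := τ) (C := C) (B := B) (v := v)
    (t := rep (findCls (nodeVal f) C v Ts)) hcoef
    (fun c hc => by have := hC c hc; omega) (fun c hc => by have := hC c hc; omega)
  rw [scanCost, testHedge]
  split_ifs with h0
  · rw [Val.ofProp, if_pos h0] at hch
    exact (Runs.ifNotNum (.arg rfl rfl) (hval_not_isNum v) (.letIn (.call rfl hfind
      (.cons (.arg rfl rfl) (.cons (.arg rfl rfl) (.cons (.arg rfl rfl) .nil))))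
      (.iteTrue (.call rfl hch (.cons (.arg rfl rfl) (.cons (.arg rfl rfl)
        (.cons (runs_rep (.var rfl)) (.cons (.tl' (.var rfl)) .nil))))) (by simp)
        (runs_or (.call rfl hsp (.cons (.arg rfl rfl) (.cons (.arg rfl rfl)
          (.cons (.arg rfl rfl) (.cons (.arg rfl rfl) .nil))))) fun _ => H _ _)))).mono (by omega)
  · rw [Val.ofProp, if_neg h0] at hch
    exact (Runs.ifNotNum (.arg rfl rfl) (hval_not_isNum v) (.letIn (.call rfl hfind
      (.cons (.arg rfl rfl) (.cons (.arg rfl rfl) (.cons (.arg rfl rfl) .nil))))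
      (.iteFalse (.call rfl hch (.cons (.arg rfl rfl) (.cons (.arg rfl rfl)
        (.cons (runs_rep (.var rfl)) (.cons (.tl' (.var rfl)) .nil)))))
        (.cons (.arg rfl rfl) .nil)))).mono (by omega)

theorem runs_scan {Ts : List (Cls (Fin a))} {C : List (List (Frame (Fin a)))} {B Y : ℕ}
    (hY : 1 ≤ Y) (hT : ∀ t ∈ Ts, hsize t.hedge ≤ Y)
    (hC : ∀ c ∈ C, csize c + Y * (Y + 1) + Y + 1 ≤ B) (v : List (SkelTree (Fin a)))
    (hv : hsize v ≤ Y) :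
    Runs f τ learner [Val.ofList [clssVal Ts, ctxsVal C, hval v]] scanBody
      (eventVal (scanHedge (nodeVal f) Ts C v)) ((scanCost B Y Ts C + 100) * hsize v) := by
  revert hv
  refine SkelTree.hedge_induction (P := fun t => t.toVal.size ≤ Y →
    Runs f τ learner [Val.ofList [clssVal Ts, ctxsVal C, t.toVal]] scanBody
      (eventVal (scanTree (nodeVal f) Ts C t)) ((scanCost B Y Ts C + 100) * t.toVal.size))
    (Q := fun v => hsize v ≤ Y →
      Runs f τ learner [Val.ofList [clssVal Ts, ctxsVal C, hval v]] scanBody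
        (eventVal (scanHedge (nodeVal f) Ts C v)) ((scanCost B Y Ts C + 100) * hsize v))
    ?_ ?_ ?_ ?_ v
  · intro x _
    rw [toVal_leaf, scanTree]
    exact (Runs.ifNum (.arg rfl rfl) .nil).mono (by simp [Val.size])
  · intro ts ih
    rw [toVal_node, scanTree]
    exact ih
  · intro hv
    have := runs_scan_step (f := f) (τ := τ) hY hT hC hv (w := none) (t := 7)
      fun x y => (Runs.ifPairNil (.arg rfl rfl) .nil).mono (by omega)
    rw [Option.or_none] at this
    rw [scanHedge]
    exact this.mono (by rw [hsize_nil]; omega)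
  · intro t ts ih1 ih2 hv
    have hv' := hv
    rw [hsize_cons] at hv'
    have ih1 := ih1 (by omega)
    have ih2 := ih2 (by omega)
    have := runs_scan_step (f := f) (τ := τ) hY hT hC hv
      (w := (scanTree (nodeVal f) Ts C t).or (scanHedge (nodeVal f) Ts C ts)) fun x y =>
      (Runs.ifPair (.arg rfl rfl) (runs_or (.call rfl ih1 (.cons (.arg rfl rfl)
        (.cons (.arg rfl rfl) (.cons (.hd (.arg rfl rfl)) .nil))))
        fun _ => .call rfl ih2 (.cons (.arg rfl rfl) (.cons (.arg rfl rfl)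
          (.cons (.tl (.arg rfl rfl)) .nil)))))
    rw [scanHedge]
    refine this.mono ?_
    rw [hsize_cons, Nat.mul_add, Nat.mul_add, Nat.mul_one]
    omega

theorem Runs.pred {P : Program} {env : List Val} {e : Expr} {i t : ℕ}
    (H : Runs f τ P env e (.num ((i + 1 : ℕ) : ℝ)) t) :
    Runs f τ P env (.arith .sub e (.const 1)) (.num (i : ℝ)) (t + 2) := by
  have := H.sub .const_one
  rwa [show (((i + 1 : ℕ) : ℝ) - 1) = i by push_cast; ring] at this

theorem clssVal_eq (Ts : List (Cls (Fin a))) : clssVal Ts = itemsVal (Ts.map Cls.toItem) := by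
  rw [clssVal, itemsVal, List.map_map]
  refine congrArg _ (List.map_congr_left fun t _ => ?_)
  simp [itemVal, Cls.toItem, clsVal, toVal_node, symVal]

theorem runs_leaves (Ts : List (Cls (Fin a))) {i : ℕ} (hi : i ≤ a) :
    Runs f τ learner [Val.ofList [.num (i : ℝ), clssVal Ts]] leavesBody
      (itemsVal (leafItems a i ++ Ts.map Cls.toItem)) (60 * (i + 1)) := by
  induction i with
  | zero =>
    rw [clssVal_eq]
    exact (Runs.ifEq (.arg rfl rfl) .const_zero (by simp) (.arg rfl rfl)).mono (by simp)
  | succ i ih =>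
    have hia : i < a := by omega
    rw [leafItems, dif_pos hia]
    have h1 : Runs f τ learner [Val.num (i : ℝ), Val.ofList [.num ((i + 1 : ℕ) : ℝ), clssVal Ts]]
        (.var 0) (SkelTree.leaf (⟨i, hia⟩ : Fin a)).toVal 1 := by
      rw [toVal_leaf]
      exact .var rfl
    exact (Runs.ifNe (.arg rfl rfl) .const_zero (by positivity) (.letIn (.pred (.arg rfl rfl))
      (.cons (.cons h1 (.cons (.var rfl) .const_one)) (.call rfl (ih (by omega))
        (.cons (.var rfl) (.cons (.arg rfl rfl) .nil)))))).mono (by omega)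

theorem runs_ext (x : Item a) (ys acc : List (List (Item a))) :
    Runs f τ learner [Val.ofList [itemVal x, tuplesVal ys, tuplesVal acc]] extBody
      (tuplesVal (ys.map (x :: ·) ++ acc)) (80 * (ys.length + 1)) := by
  induction ys with
  | nil => exact (Runs.ifPairNil (.arg rfl rfl) (.arg rfl rfl)).mono (by simp)
  | cons y ys ih =>
    have hm : (x.scale * (y.map Item.scale).prod) = ((x :: y).map Item.scale).prod := by simp
    have h1 := Runs.mul (f := f) (τ := τ) (P := learner)
      (env := [Val.ofList [itemVal x, tuplesVal (y :: ys), tuplesVal acc]])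
      (.tl (.tl (.arg (j := 0) (i := 0) (v := itemVal x) rfl rfl)))
      (.tl (.tl (.hd (.arg (j := 0) (i := 1) (v := tuplesVal (y :: ys)) rfl rfl))))
    rw [hm] at h1
    exact (Runs.ifPair (.arg rfl rfl) (.cons (.cons (.cons (.hd (.arg rfl rfl))
      (.hd (.hd (.arg rfl rfl)))) (.cons (.cons (.hd (.tl (.arg rfl rfl)))
        (.hd (.tl (.hd (.arg rfl rfl))))) h1)) (.call rfl ih (.cons (.arg rfl rfl)
          (.cons (.tl (.arg rfl rfl)) (.cons (.arg rfl rfl) .nil)))))).mono (by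
            simp only [List.length_cons]; omega)

theorem runs_emptyTuple {env : List Val} :
    Runs f τ learner env (.cons emptyTuple .nil) (tuplesVal ([[]] : List (List (Item a)))) 7 := by
  have h : tuplesVal ([[]] : List (List (Item a))) =
      .pair (.pair .nil (.pair .nil (.num 1))) .nil := by
    simp [tuplesVal, tupleVal, hval, Val.ofList]
  rw [h]
  exact .cons (.cons .nil (.cons .nil .const_one)) .nil

theorem runs_extAll (xs : List (Item a)) (ys : List (List (Item a))) :
    Runs f τ learner [Val.ofList [itemsVal xs, tuplesVal ys]] extAllBody
      (tuplesVal (extendAll xs ys)) ((80 * (ys.length + 1) + 80) * (xs.length + 1)) := by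
  induction xs with
  | nil => exact (Runs.ifPairNil (.arg rfl rfl) runs_emptyTuple).mono (by simp)
  | cons x xs ih =>
    have e : extendAll (x :: xs) ys = ys.map (x :: ·) ++ extendAll xs ys := by simp [extendAll]
    rw [e, List.length_cons, Nat.mul_succ]
    exact (Runs.ifPair (.arg rfl rfl) (.call rfl (runs_ext x ys (extendAll xs ys))
      (.cons (.hd (.arg rfl rfl)) (.cons (.arg rfl rfl) (.cons (.call rfl ih
        (.cons (.tl (.arg rfl rfl)) (.cons (.arg rfl rfl) .nil))) .nil))))).mono (by omega)

theorem runs_tuples (xs : List (Item a)) {n E : ℕ} (hE : (xs.length + 1) ^ n ≤ E) :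
    Runs f τ learner [Val.ofList [.num (n : ℝ), itemsVal xs]] tuplesBody
      (tuplesVal (tuples xs n)) ((80 * (E + 1) + 200) * (xs.length + 1) * (n + 1)) := by
  induction n with
  | zero =>
    refine (Runs.ifEq (.arg rfl rfl) .const_zero (by simp) runs_emptyTuple).mono ?_
    nlinarith
  | succ n ih =>
    have hle : (xs.length + 1) ^ n ≤ E :=
      (Nat.pow_le_pow_right (by omega) (by omega)).trans hE
    have ih := ih hle
    have h1 : (80 * ((tuples xs n).length + 1) + 80) * (xs.length + 1) ≤
        (80 * (E + 1) + 80) * (xs.length + 1) :=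
      Nat.mul_le_mul_right _ (by have := length_tuples_le xs n; omega)
    have h2 : (80 * (E + 1) + 200) * (xs.length + 1) * (n + 1 + 1) =
        (80 * (E + 1) + 200) * (xs.length + 1) * (n + 1) +
          ((80 * (E + 1) + 80) * (xs.length + 1) + 120 * (xs.length + 1)) := by ring
    rw [h2]
    exact (Runs.ifNe (.arg rfl rfl) .const_zero (by positivity) (.call rfl
      (runs_extAll xs (tuples xs n)) (.cons (.arg rfl rfl) (.cons (.call rfl ih
        (.cons (.pred (.arg rfl rfl)) (.cons (.arg rfl rfl) .nil))) .nil)))).mono (by omega)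

theorem symVal_eq {k : ℕ} {X : Symbol (Fin a) ℕ} (h : ∀ j, X = .nonterminal j → j ≤ k) :
    symVal X = symbolToVal (finSym k X) := by
  cases X with
  | terminal i => rfl
  | nonterminal j =>
    simp only [symVal, finSym, symbolToVal, Fin.val_ofNat]
    rw [Nat.mod_eq_of_lt (Nat.lt_succ_of_le (h j rfl))]

theorem runs_entries {Ts : List (Cls (Fin a))} {C : List (List (Frame (Fin a)))} {B : ℕ}
    (hl : ∀ t ∈ Ts, t.label ≤ Ts.length)
    (hT : ∀ t ∈ Ts, ∀ c ∈ C, hsize t.hedge + csize c + 1 ≤ B) {ys : List (List (Item a))}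
    (hys : ∀ y ∈ ys, ∀ x ∈ y, x ∈ items a Ts)
    (hB : ∀ y ∈ ys, ∀ c ∈ C, hsize (y.map Item.tree) + csize c + 1 ≤ B) :
    Runs f τ learner [Val.ofList [clssVal Ts, ctxsVal C, tuplesVal ys]] entriesBody
      (Val.ofList ((ys.filterMap (hypEntry (nodeVal f) Ts C)).map entryToVal))
      (2 * findCost B Ts C * (ys.length + 1)) := by
  have hB' := le_findCost B Ts C
  induction ys with
  | nil => exact (Runs.ifPairNil (.arg rfl rfl) .nil).mono (by simp; omega)
  | cons y ys ih =>
    have ih := ih (fun y hy => hys y (by simp [hy])) (fun y hy => hB y (by simp [hy]))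
    have hfind := runs_find (f := f) (τ := τ) (v := y.map Item.tree) (Ts := Ts) (C := C) (B := B)
      (hB y (by simp)) hT
    rw [← findCost] at hfind
    rw [List.length_cons, Nat.mul_succ, List.filterMap_cons]
    cases hf : findCls (nodeVal f) C (y.map Item.tree) Ts with
    | none =>
      rw [hf] at hfind
      rw [show hypEntry (nodeVal f) Ts C y = none by rw [hypEntry, hf]; rfl]
      exact (Runs.ifPair (.arg rfl rfl) (.letIn (.call rfl hfind (.cons (.arg rfl rfl)
        (.cons (.arg rfl rfl) (.cons (.hd (.hd (.arg rfl rfl))) .nil)))) (.iteFalse (.var rfl)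
          (.call rfl ih (.cons (.arg rfl rfl) (.cons (.arg rfl rfl)
            (.cons (.tl (.arg rfl rfl)) .nil))))))).mono (by omega)
    | some r =>
      rw [hf] at hfind
      have hr := (findCls_some hf).1
      have hent : hypEntry (nodeVal f) Ts C y = some (⟨Fin.ofNat (Ts.length + 1) r.1.label,
          y.map fun x => finSym Ts.length x.sym⟩,
          r.2 * r.1.scale / (y.map Item.scale).prod) := by rw [hypEntry, hf]; rfl
      have hval' : entryToVal ((⟨Fin.ofNat (Ts.length + 1) r.1.label,
          y.map fun x => finSym Ts.length x.sym⟩,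
          r.2 * r.1.scale / (y.map Item.scale).prod) :
            ContextFreeRule (Fin a) (Fin (Ts.length + 1)) × ℝ) =
          .pair (.num r.1.label) (.pair (Val.ofList (y.map fun x => symVal x.sym))
            (.num (r.2 * r.1.scale / (y.map Item.scale).prod))) := by
        simp only [entryToVal, Fin.val_ofNat, Nat.mod_eq_of_lt (Nat.lt_succ_of_le (hl _ hr)),
          List.map_map]
        congr 3
        refine List.map_congr_left fun x hx => (symVal_eq fun j hj => ?_).symm
        rcases List.mem_append.1 (hys y (by simp) x hx) with hx | hx
        · obtain ⟨i, -, rfl⟩ := mem_leafItems.1 hx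
          simp [leafItem] at hj
        · obtain ⟨t, ht, rfl⟩ := List.mem_map.1 hx
          simp only [Cls.toItem, Symbol.nonterminal.injEq] at hj
          exact hj ▸ hl t ht
      rw [hent]
      simp only [List.map_cons, hval']
      exact (Runs.ifPair (.arg rfl rfl) (.letIn (.call rfl hfind (.cons (.arg rfl rfl)
        (.cons (.arg rfl rfl) (.cons (.hd (.hd (.arg rfl rfl))) .nil)))) (.iteTrue (.var rfl)
          (by simp [foundVal])
          (.cons (.cons (.hd (.hd (.tl (.hd (.var rfl))))) (.cons (.hd (.tl (.hd (.arg rfl rfl))))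
            (.div (.mul (.tl (.var rfl)) (.tl (.tl (.hd (.var rfl)))))
              (.tl (.tl (.hd (.arg rfl rfl)))))))
          (.call rfl ih (.cons (.arg rfl rfl) (.cons (.arg rfl rfl)
            (.cons (.tl (.arg rfl rfl)) .nil)))))))).mono (by omega)

/-- The first tuple which is a tree with a nonzero value. -/
def firstNonzero (F : List (SkelTree (Fin a)) → ℝ) :
    List (List (Item a)) → List (SkelTree (Fin a))
  | [] => []
  | y :: ys => if F (y.map Item.tree) = 0 then firstNonzero F ys else y.map Item.tree

theorem runs_firstNonzero {M : ℕ} {ys : List (List (Item a))}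
    (hM : ∀ y ∈ ys, hsize (y.map Item.tree) ≤ M) :
    Runs f τ learner [Val.ofList [tuplesVal ys]] firstNonzeroBody
      (hval (firstNonzero (nodeVal f) ys)) ((M + 60) * (ys.length + 1)) := by
  induction ys with
  | nil => exact (Runs.ifPairNil (.arg rfl rfl) .nil).mono (by simp)
  | cons y ys ih =>
    have ih := ih fun y hy => hM y (by simp [hy])
    have hy := hM y (by simp)
    have hq := Runs.smq (f := f) (τ := τ) (P := learner) (s := .node (y.map Item.tree))
      (env := [Val.ofList [tuplesVal (y :: ys)]])
      (.node (.hd (.hd (.arg (j := 0) (i := 0) rfl rfl))))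
    have hs : (SkelTree.node (y.map Item.tree)).toVal.size = hsize (y.map Item.tree) := by
      rw [toVal_node]; rfl
    rw [hs] at hq
    rw [List.length_cons, Nat.mul_succ, firstNonzero]
    split_ifs with h0
    · exact (Runs.ifPair (.arg rfl rfl) (.ifEq hq .const_zero h0 (.call rfl ih
        (.cons (.tl (.arg rfl rfl)) .nil)))).mono (by omega)
    · exact (Runs.ifPair (.arg rfl rfl) (.ifNe hq .const_zero h0
        (.hd (.hd (.arg rfl rfl))))).mono (by omega)

end Functions

/-! ### Sizes -/

section Sizes

variable {a : ℕ} {F : List (SkelTree (Fin a)) → ℝ} {Ts : List (Cls (Fin a))}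
  {C : List (List (Frame (Fin a)))} {Y Z : ℕ}

/-- The new tree is a child of the given one, and each sibling passed adds at most one
representative to the context. Contexts thus grow by a bounded summand with each class instead of
multiplying. -/
theorem splitAt_size (hY : 1 ≤ Y) (hT : ∀ t ∈ Ts, hsize t.hedge ≤ Y) {D : List (Frame (Fin a))}
    {l : List (SkelTree (Fin a))} (hl : hsize l ≤ Y)
    {e : List (SkelTree (Fin a)) × List (Frame (Fin a))} (h : splitAt F Ts C D l = some e) :
    hsize e.1 ≤ Y ∧ csize e.2 ≤ csize D + l.length * (Y + 1) := by
  induction l generalizing D with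
  | nil => simp [splitAt] at h
  | cons t l ih =>
    rw [hsize_cons] at hl
    rw [List.length_cons, Nat.succ_mul]
    cases t with
    | leaf x =>
      rw [splitAt] at h
      have := ih (by omega) h
      simp only [csize, toVal_leaf, Val.size] at this
      exact ⟨this.1, by omega⟩
    | node us =>
      have hus : (SkelTree.node us).toVal.size = hsize us := by rw [toVal_node]; rfl
      rw [hus] at hl
      rw [splitAt] at h
      split_ifs at h with h0
      · have := ih (by omega) h
        have hr := hsize_rep_le hY hT F us (C := C)
        have hr' : (SkelTree.node (rep (findCls F C us Ts))).toVal.size =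
          hsize (rep (findCls F C us Ts)) := by rw [toVal_node]; rfl
        simp only [csize, hr'] at this
        exact ⟨this.1, by omega⟩
      · cases h
        simp only [csize]
        exact ⟨by omega, by omega⟩

theorem splitAny_size (hY : 1 ≤ Y) (hT : ∀ t ∈ Ts, hsize t.hedge ≤ Y)
    {v : List (SkelTree (Fin a))} (hv : hsize v ≤ Y) {Cs : List (List (Frame (Fin a)))}
    (hC : ∀ c ∈ Cs, csize c ≤ Z) {e : List (SkelTree (Fin a)) × List (Frame (Fin a))}
    (h : splitAny F Ts C v Cs = some e) : hsize e.1 ≤ Y ∧ csize e.2 ≤ Z + Y * (Y + 1) := by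
  induction Cs with
  | nil => simp [splitAny] at h
  | cons c Cs ih =>
    rw [splitAny, Option.or_eq_some_iff] at h
    rcases h with h | ⟨-, h⟩
    · have := splitAt_size hY hT hv h
      have hc := hC c (by simp)
      have hlen := length_le_hsize v
      have hle : v.length * (Y + 1) ≤ Y * (Y + 1) := Nat.mul_le_mul_right _ (by omega)
      exact ⟨this.1, by omega⟩
    · exact ih (fun c hc => hC c (by simp [hc])) h

theorem testHedge_size (hY : 1 ≤ Y) (hT : ∀ t ∈ Ts, hsize t.hedge ≤ Y)
    (hC : ∀ c ∈ C, csize c ≤ Z) {v : List (SkelTree (Fin a))} (hv : hsize v ≤ Y)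
    {e : List (SkelTree (Fin a)) × List (Frame (Fin a))} (h : testHedge F Ts C v = some e) :
    hsize e.1 ≤ Y ∧ csize e.2 ≤ Z + Y * (Y + 1) := by
  rw [testHedge] at h
  split_ifs at h
  · exact splitAny_size hY hT hv hC h
  · cases h
    exact ⟨hv, by simp [csize]⟩

theorem scanHedge_size (hY : 1 ≤ Y) (hT : ∀ t ∈ Ts, hsize t.hedge ≤ Y)
    (hC : ∀ c ∈ C, csize c ≤ Z) {s : List (SkelTree (Fin a))} (hs : hsize s ≤ Y)
    {e : List (SkelTree (Fin a)) × List (Frame (Fin a))} (h : scanHedge F Ts C s = some e) :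
    hsize e.1 ≤ Y ∧ csize e.2 ≤ Z + Y * (Y + 1) := by
  revert hs h
  refine SkelTree.hedge_induction (P := fun t => t.toVal.size ≤ Y → scanTree F Ts C t = some e →
      hsize e.1 ≤ Y ∧ csize e.2 ≤ Z + Y * (Y + 1))
    (Q := fun s => hsize s ≤ Y → scanHedge F Ts C s = some e →
      hsize e.1 ≤ Y ∧ csize e.2 ≤ Z + Y * (Y + 1)) ?_ ?_ ?_ ?_ s
  · intro x _ h
    simp [scanTree] at h
  · intro ts ih hs h
    rw [scanTree] at h
    rw [toVal_node] at hs
    exact ih hs h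
  · intro hs h
    rw [scanHedge] at h
    exact testHedge_size hY hT hC hs h
  · intro t ts ih1 ih2 hs h
    have hs' := hs
    rw [hsize_cons] at hs'
    rw [scanHedge, Option.or_eq_some_iff, Option.or_eq_some_iff] at h
    rcases h with h | ⟨-, h | ⟨-, h⟩⟩
    · exact testHedge_size hY hT hC hs h
    · exact ih1 (by omega) h
    · exact ih2 (by omega) h

/-- The value has one atom for each node of the tree and one `pair` for each node except the root.
-/
theorem toVal_size_le (s : SkelTree (Fin a)) : s.toVal.size + 1 ≤ 2 * s.size := by
  induction s using SkelTree.inductOn with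
  | leaf x => simp [toVal_leaf, Val.size, SkelTree.size]
  | node ts ih =>
    rw [toVal_node, SkelTree.size]
    have key : hsize ts ≤ 1 + 2 * (ts.map SkelTree.size).sum := by
      induction ts with
      | nil => simp [hsize_nil]
      | cons t ts ih' =>
        have h1 := ih t (by simp)
        have h2 := ih' fun u hu => ih u (by simp [hu])
        rw [hsize_cons, List.map_cons, List.sum_cons]
        omega
    change hsize ts + 1 ≤ _
    omega

theorem hsize_le_of_forall {ts : List (SkelTree (Fin a))} (h : ∀ t ∈ ts, t.toVal.size ≤ Y) :
    hsize ts ≤ 1 + ts.length * (Y + 1) := by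
  induction ts with
  | nil => simp [hsize_nil]
  | cons t ts ih =>
    have h1 := h t (by simp)
    have h2 := ih fun u hu => h u (by simp [hu])
    rw [hsize_cons, List.length_cons, Nat.succ_mul]
    omega

theorem ofList_size_le {l : List Val} {M : ℕ} (h : ∀ v ∈ l, v.size ≤ M) :
    (Val.ofList l).size ≤ 1 + l.length * (M + 1) := by
  induction l with
  | nil => simp [Val.ofList, Val.size]
  | cons v l ih =>
    have h1 := h v (by simp)
    have h2 := ih fun u hu => h u (by simp [hu])
    rw [Val.ofList, Val.size, List.length_cons, Nat.succ_mul]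
    omega

theorem hyp_toVal_size_le {p : ℕ} :
    (hyp F p Ts C).toVal.size ≤ 5 + (tuples (items a Ts) p).length * (4 * p + 6) := by
  have h : ∀ e ∈ hypEntries F p Ts C, (entryToVal e).size ≤ 4 * p + 5 := by
    intro e he
    obtain ⟨y, hy, he⟩ := mem_hyp_entries.1 he
    rw [hypEntry, Option.map_eq_some_iff] at he
    obtain ⟨r, -, rfl⟩ := he
    simp only [entryToVal, Val.size]
    have := ofList_size_le (M := 3)
      (l := (y.map fun x => finSym Ts.length x.sym).map symbolToVal) (by
        intro v hv
        obtain ⟨X, -, rfl⟩ := List.mem_map.1 hv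
        cases X <;> simp [symbolToVal, Val.size])
    rw [List.length_map, List.length_map] at this
    have := (mem_tuples.1 hy).1
    omega
  have h1 := ofList_size_le (M := 4 * p + 5) (l := (hypEntries F p Ts C).map entryToVal) (by
    intro v hv
    obtain ⟨e, he, rfl⟩ := List.mem_map.1 hv
    exact h e he)
  have h2 : (hypEntries F p Ts C).length ≤ (tuples (items a Ts) p).length :=
    List.length_filterMap_le _ _
  rw [List.length_map] at h1
  have h3 : (hypEntries F p Ts C).length * (4 * p + 5 + 1) ≤
      (tuples (items a Ts) p).length * (4 * p + 6) := Nat.mul_le_mul_right (4 * p + 5 + 1) h2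
  change 1 + (1 + (Val.ofList ((hypEntries F p Ts C).map entryToVal)).size + 1) + 1 ≤ _
  omega

end Sizes

-- The size parameter and its growth along the history

section History

variable {a : ℕ}

theorem maxCex_append (h h' : History a) :
    History.maxCex (h ++ h') = max (History.maxCex h) (History.maxCex h') := by
  have key : ∀ l l' : List ℕ, (l ++ l').foldr max 0 = max (l.foldr max 0) (l'.foldr max 0) := by
    intro l l'
    induction l with
    | nil => simp
    | cons x l ih => simp [ih, max_assoc]
  simp [History.maxCex, key]

/-- The parameter in which the running time is measured. -/
def bigSize (n a p : ℕ) (h : History a) : ℕ := n + a + p + h.maxCex + 1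

theorem bigSize_append_le (n p : ℕ) (h h' : History a) :
    bigSize n a p h ≤ bigSize n a p (h ++ h') := by
  have := maxCex_append h h'
  simp only [bigSize, this]
  omega

theorem size_le_bigSize (n p : ℕ) (h : History a) (H : Code a) (s : SkelTree (Fin a)) :
    s.size ≤ bigSize n a p (h ++ [(H, some s)]) := by
  have h1 := maxCex_append h [(H, some s)]
  have h2 : History.maxCex [(H, some s)] = s.size := by simp [History.maxCex]
  simp only [bigSize, h1, h2]
  omega

end History

-- The initial tree

section Start

variable {a : ℕ}

theorem eq_zero_of_firstNonzero {F : List (SkelTree (Fin a)) → ℝ} {ys : List (List (Item a))}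
    (h : F (firstNonzero F ys) = 0) : ∀ y ∈ ys, F (y.map Item.tree) = 0 := by
  induction ys with
  | nil => simp
  | cons y ys ih =>
    rw [firstNonzero] at h
    have h0 : F (y.map Item.tree) = 0 := by
      by_contra h0
      rw [if_neg h0] at h
      exact h0 h
    rw [if_pos h0] at h
    intro z hz
    rcases List.mem_cons.1 hz with rfl | hz
    · exact h0
    · exact ih h z hz

theorem hsize_firstNonzero_le {F : List (SkelTree (Fin a)) → ℝ} {ys : List (List (Item a))} {M : ℕ}
    (hM : 1 ≤ M) (h : ∀ y ∈ ys, hsize (y.map Item.tree) ≤ M) :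
    hsize (firstNonzero F ys) ≤ M := by
  induction ys with
  | nil => simpa [firstNonzero, hsize_nil] using hM
  | cons y ys ih =>
    rw [firstNonzero]
    split_ifs with h0
    · exact ih fun y hy => h y (by simp [hy])
    · exact h y (by simp)

theorem hsize_leaf_tuple_le {p : ℕ} : ∀ y ∈ tuples (items a []) p,
    hsize (y.map Item.tree) ≤ 1 + 2 * p := by
  intro y hy
  obtain ⟨hlen, hm⟩ := mem_tuples.1 hy
  have := hsize_le_of_forall (Y := 1) (ts := y.map Item.tree) (by
    intro t ht
    obtain ⟨x, hx, rfl⟩ := List.mem_map.1 ht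
    have hx := hm x hx
    simp only [items, List.map_nil, List.append_nil] at hx
    obtain ⟨j, -, rfl⟩ := mem_leafItems.1 hx
    simp [leafItem, toVal_leaf, Val.size])
  rw [List.length_map] at this
  omega

/-- All trees of height one have the value zero. -/
def FlatZero (F : List (SkelTree (Fin a)) → ℝ) : Prop :=
  ∀ v : List (SkelTree (Fin a)), (∀ t ∈ v, ∃ x, t = .leaf x) → F v = 0

/-- The tuples of terminals cover all trees of height one with at most p children; broader ones
vanish by the rank bound. -/
theorem flatZero_of_firstNonzero {F : List (SkelTree (Fin a)) → ℝ} {p : ℕ}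
    (hrank : ∀ c, IsTreeCtx c → ∀ v, p < v.length → F (plug c v) = 0)
    (h : F (firstNonzero F (tuples (items a []) p)) = 0) : FlatZero F := by
  intro v hv
  by_cases hlen : v.length ≤ p
  · have : ∃ y : List (Item a), y.map Item.tree = v ∧ ∀ x ∈ y, x ∈ items a [] := by
      clear hlen
      induction v with
      | nil => exact ⟨[], by simp, by simp⟩
      | cons t v ih =>
        obtain ⟨y, hy, hm⟩ := ih fun t ht => hv t (by simp [ht])
        obtain ⟨x, rfl⟩ := hv t (by simp)
        refine ⟨leafItem x :: y, by simp [leafItem, hy], fun z hz => ?_⟩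
        rcases List.mem_cons.1 hz with rfl | hz
        · exact leafItem_mem_items x
        · exact hm z hz
    obtain ⟨y, rfl, hm⟩ := this
    exact eq_zero_of_firstNonzero h y (mem_tuples.2 ⟨by simpa using hlen, hm⟩)
  · exact hrank [] trivial v (by omega)

theorem scanHedge_nil_ne_none {F : List (SkelTree (Fin a)) → ℝ} {s : List (SkelTree (Fin a))}
    (hs : F s ≠ 0) : scanHedge F [] [[]] s ≠ none := by
  have h : testHedge F [] [[]] s = some (s, []) := by
    rw [testHedge, if_neg]
    intro hp
    have := hp [] (by simp)
    simp only [plug, findCls, coef, zero_mul] at this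
    exact hs this
  cases s with
  | nil => simp [scanHedge, h]
  | cons t s => simp [scanHedge, h]

end Start

/-! ### The main loop -/

section Loop

variable {a : ℕ} {f : SkelTree (Fin a) → ℝ} {τ : Teacher a}

theorem Runs.succ {P : Program} {env : List Val} {e : Expr} {i t : ℕ}
    (H : Runs f τ P env e (.num (i : ℝ)) t) :
    Runs f τ P env (.arith .add e (.const 1)) (.num ((i + 1 : ℕ) : ℝ)) (t + 2) := by
  have := H.add .const_one
  rwa [show ((i : ℝ) + 1) = ((i + 1 : ℕ) : ℝ) by push_cast; ring] at this

/-- The arguments of the loop. -/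
def loopArg (p : ℕ) (Ts : List (Cls (Fin a))) (C : List (List (Frame (Fin a))))
    (s : List (SkelTree (Fin a))) : Val :=
  Val.ofList [.num (a : ℝ), .num (p : ℝ), clssVal Ts, ctxsVal C,
    .num ((Ts.length + 1 : ℕ) : ℝ), hval s]

theorem hyp_toVal (F : List (SkelTree (Fin a)) → ℝ) (p : ℕ) (Ts : List (Cls (Fin a)))
    (C : List (List (Frame (Fin a)))) :
    (hyp F p Ts C).toVal = .pair (.num ((Ts.length + 1 : ℕ) : ℝ)) (.pair (.num 0)
      (Val.ofList ((hypEntries F p Ts C).map entryToVal))) := by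
  have : (((0 : Fin (Ts.length + 1)) : ℕ) : ℝ) = 0 := by simp
  rw [← this]
  rfl

theorem runs_newCls {p : ℕ} {Ts : List (Cls (Fin a))} {C : List (List (Frame (Fin a)))}
    {s : List (SkelTree (Fin a))} {e : List (SkelTree (Fin a)) × List (Frame (Fin a))} :
    Runs f τ learner [eventVal (some e), loopArg p Ts C s] newClsExpr
      (clsVal (newCls (nodeVal f) (Ts.length + 1) e.1)) (2 * hsize e.1 + 40) := by
  have hq := Runs.smq (f := f) (τ := τ) (P := learner) (s := .node e.1)
    (env := [eventVal (some e), loopArg p Ts C s]) (.node (.hd (.var (i := 0) rfl)))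
  have hs : (SkelTree.node e.1).toVal.size = hsize e.1 := by rw [toVal_node]; rfl
  rw [hs] at hq
  rw [newCls]
  split_ifs with h0
  · exact (Runs.ifEq hq .const_zero h0 (.cons (.hd (.var rfl)) (.cons (.cons (.arg rfl rfl) .nil)
      .const_one))).mono (by omega)
  · exact (Runs.ifNe hq .const_zero h0 (.cons (.hd (.var rfl)) (.cons (.cons .const .nil)
      hq))).mono (by omega)

/-! #### Numerical bounds -/

/-- A bound for the sizes of the trees in membership queries. -/
def queryBound (X : ℕ) : ℕ := X * (2 * X * (2 * X + 1)) + 2 * X * (2 * X + 1) + 2 * X + 1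

theorem findCost_le {X : ℕ} {Ts : List (Cls (Fin a))} {C : List (List (Frame (Fin a)))}
    (hT : Ts.length + 1 ≤ X) (hC : C.length ≤ X) :
    findCost (queryBound X) Ts C ≤ 12600 * X ^ 5 := by
  have h1 : 1 ≤ X := by omega
  have hp : ∀ i ≤ 3, X ^ i ≤ X ^ 3 := fun i hi => Nat.pow_le_pow_right h1 hi
  have hB : 400 * queryBound X + 300 ≤ 6300 * X ^ 3 := by
    have h2 := hp 2 (by omega)
    have h3 := hp 1 (by omega)
    have h4 : 1 ≤ X ^ 3 := Nat.one_le_pow _ _ h1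
    have : queryBound X = 4 * X ^ 3 + 6 * X ^ 2 + 4 * X ^ 1 + 1 := by rw [queryBound]; ring
    omega
  calc findCost (queryBound X) Ts C ≤ 6300 * X ^ 3 * (2 * X) * X := by
        rw [findCost]
        exact Nat.mul_le_mul (Nat.mul_le_mul hB (by omega)) hT
    _ = 12600 * X ^ 5 := by ring

/-- The scan alone is bounded by a multiple of `X ^ 8`; the exponent `p + 8` gives all costs of a
round a common form. -/
theorem scan_cost_le {X p Y : ℕ} {Ts : List (Cls (Fin a))} {C : List (List (Frame (Fin a)))}
    (hT : Ts.length + 1 ≤ X) (hC : C.length ≤ X) (hY : Y ≤ 2 * X) :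
    (scanCost (queryBound X) (2 * X) Ts C + 100) * Y ≤ 410000 * X ^ (p + 8) := by
  have h1 : 1 ≤ X := by omega
  have hf := findCost_le hT hC
  have h2 : scanCost (queryBound X) (2 * X) Ts C + 100 ≤ 201700 * X ^ 7 := by
    have h3 : X ^ 5 ≤ X ^ 7 := Nat.pow_le_pow_right h1 (by omega)
    have h4 : 1 ≤ X ^ 7 := Nat.one_le_pow _ _ h1
    have h5 : 3 * findCost (queryBound X) Ts C * (2 * X) * (C.length + 1) ≤
        3 * (12600 * X ^ 5) * (2 * X) * (2 * X) := by
      gcongr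
      omega
    have h6 : 3 * (12600 * X ^ 5) * (2 * X) * (2 * X) = 151200 * X ^ 7 := by ring
    rw [scanCost]
    omega
  calc (scanCost (queryBound X) (2 * X) Ts C + 100) * Y ≤ 201700 * X ^ 7 * (2 * X) := by gcongr
    _ = 403400 * X ^ 8 := by ring
    _ ≤ 410000 * X ^ (p + 8) := by
      gcongr
      · omega
      · omega

theorem one_le_pow_add {X : ℕ} (hX : 1 ≤ X) (p : ℕ) : X ≤ X ^ (p + 8) := by
  calc X = X ^ 1 := (pow_one X).symm
    _ ≤ X ^ (p + 8) := Nat.pow_le_pow_right hX (by omega)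

theorem tuples_cost_le {X p n : ℕ} (hn : n + 1 ≤ X) (hp : p + 1 ≤ X) :
    (80 * (X ^ p + 1) + 200) * (n + 1) * (p + 1) ≤ 360 * X ^ (p + 8) := by
  have hX : 1 ≤ X := by omega
  have h1 : 1 ≤ X ^ p := Nat.one_le_pow _ _ hX
  calc (80 * (X ^ p + 1) + 200) * (n + 1) * (p + 1) ≤ 360 * X ^ p * X * X := by
        gcongr
        omega
    _ = 360 * X ^ (p + 2) := by ring
    _ ≤ 360 * X ^ (p + 8) := by gcongr; omega

theorem entries_cost_le {X p n : ℕ} {Ts : List (Cls (Fin a))} {C : List (List (Frame (Fin a)))}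
    (hT : Ts.length + 1 ≤ X) (hC : C.length ≤ X) (hn : n ≤ X ^ p) :
    2 * findCost (queryBound X) Ts C * (n + 1) ≤ 50400 * X ^ (p + 8) := by
  have hX : 1 ≤ X := by omega
  have h1 : 1 ≤ X ^ p := Nat.one_le_pow _ _ hX
  have hf := findCost_le hT hC
  calc 2 * findCost (queryBound X) Ts C * (n + 1) ≤ 2 * (12600 * X ^ 5) * (2 * X ^ p) := by
        gcongr
        omega
    _ = 50400 * X ^ (p + 5) := by ring
    _ ≤ 50400 * X ^ (p + 8) := by gcongr; omega

theorem linear_cost_le {X p n i : ℕ} (hX : 1 ≤ X) (hn : n ≤ X ^ p) (hi : i ≤ 10 * X) :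
    n * i ≤ 10 * X ^ (p + 8) := by
  calc n * i ≤ X ^ p * (10 * X) := by gcongr
    _ = 10 * X ^ (p + 1) := by ring
    _ ≤ 10 * X ^ (p + 8) := by gcongr; omega

/-! #### The invariant -/

/-- The state of the learner after the equivalence queries `h`. -/
structure LoopInv {N : Type} [Fintype N] (W : WCFG (Fin a) N) (p : ℕ) (h : History a)
    (Ts : List (Cls (Fin a))) (C : List (List (Frame (Fin a)))) (s : List (SkelTree (Fin a))) :
    Prop where
  valid : Valid (nodeVal W.series) Ts C
  length_ctx : C.length = Ts.length + 1
  cls_size : ∀ t ∈ Ts, hsize t.hedge ≤ 2 * bigSize (Fintype.card N) a p h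
  ctx_size : ∀ c ∈ C, csize c ≤ Ts.length *
    (2 * bigSize (Fintype.card N) a p h * (2 * bigSize (Fintype.card N) a p h + 1))
  tree_size : hsize s ≤ 2 * bigSize (Fintype.card N) a p h
  -- The account behind the bound |N| on the queries: either one more query is already paid for by a
  -- class; or the current tree will still yield a class; or nothing has been asked and trees of
  -- height one vanish; or one query has been asked and its counterexample needs two classes.
  count : h.length + 1 ≤ Ts.length ∨
    (h.length ≤ Ts.length ∧ scanHedge (nodeVal W.series) Ts C s ≠ none) ∨
    (h.length = 0 ∧ FlatZero (nodeVal W.series)) ∨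
    (h.length = 1 ∧ Ts.length ≤ 1 ∧ nodeVal W.series s ≠ 0 ∧ FlatZero (nodeVal W.series))

variable {N : Type} [Fintype N] {W : WCFG (Fin a) N} {p : ℕ} {h : History a}
  {Ts : List (Cls (Fin a))} {C : List (List (Frame (Fin a)))} {s : List (SkelTree (Fin a))}

theorem LoopInv.length_add_le (hI : LoopInv W p h Ts C s) (hW : W.IsStructurallyUnambiguous) :
    Ts.length + a + p + 1 ≤ bigSize (Fintype.card N) a p h := by
  have := hI.valid.indep.length_le hW hI.valid.ctx
  rw [bigSize]
  omega

/-- In `queryBound`, the first summand is for a context of `C`, which has been lengthened at most X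
times; the second is for its growth during a replacement test, and the rest is for the tree. -/
theorem LoopInv.ctx_le (hI : LoopInv W p h Ts C s) (hW : W.IsStructurallyUnambiguous) :
    ∀ c ∈ C, csize c + 2 * bigSize (Fintype.card N) a p h *
      (2 * bigSize (Fintype.card N) a p h + 1) + 2 * bigSize (Fintype.card N) a p h + 1 ≤
        queryBound (bigSize (Fintype.card N) a p h) := by
  intro c hc
  have h1 := hI.ctx_size c hc
  have h2 := hI.length_add_le hW
  have h3 : Ts.length * (2 * bigSize (Fintype.card N) a p h *
      (2 * bigSize (Fintype.card N) a p h + 1)) ≤ bigSize (Fintype.card N) a p h *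
        (2 * bigSize (Fintype.card N) a p h * (2 * bigSize (Fintype.card N) a p h + 1)) :=
    Nat.mul_le_mul_right _ (by omega)
  rw [queryBound]
  omega

theorem LoopInv.runs_scan (hI : LoopInv W p h Ts C s) (hW : W.IsStructurallyUnambiguous) :
    Runs W.series τ learner [Val.ofList [clssVal Ts, ctxsVal C, hval s]] scanBody
      (eventVal (scanHedge (nodeVal W.series) Ts C s))
      (410000 * bigSize (Fintype.card N) a p h ^ (p + 8)) := by
  have h2 := hI.length_add_le hW
  have hl := hI.length_ctx
  exact (StructLearn.runs_scan (by omega) hI.cls_size (hI.ctx_le hW) s hI.tree_size).mono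
    (scan_cost_le (by omega) (by omega) hI.tree_size)

theorem LoopInv.length_tuples_le (hI : LoopInv W p h Ts C s) (hW : W.IsStructurallyUnambiguous) :
    (tuples (items a Ts) p).length ≤ bigSize (Fintype.card N) a p h ^ p := by
  have h2 := hI.length_add_le hW
  have h3 := length_items_le (a := a) (Ts := Ts)
  exact (StructLearn.length_tuples_le _ _).trans (Nat.pow_le_pow_left (by omega) _)

theorem LoopInv.runs_hyp (hI : LoopInv W p h Ts C s) (hW : W.IsStructurallyUnambiguous) {x : Val} :
    Runs W.series τ learner [x, loopArg p Ts C s] hypExpr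
      (hyp (nodeVal W.series) p Ts C).toVal
      (52000 * bigSize (Fintype.card N) a p h ^ (p + 8)) := by
  set X := bigSize (Fintype.card N) a p h with hX
  have h2 := hI.length_add_le hW
  rw [← hX] at h2
  have hl := hI.length_ctx
  have h3 := length_items_le (a := a) (Ts := Ts)
  have hctx := hI.ctx_le hW
  rw [← hX] at hctx
  have h4 := runs_leaves (f := W.series) (τ := τ) Ts (le_refl a)
  have h5 := runs_tuples (f := W.series) (τ := τ) (items a Ts) (n := p) (E := X ^ p)
    (Nat.pow_le_pow_left (by omega) _)
  have h6 := runs_entries (f := W.series) (τ := τ) (B := queryBound X) hI.valid.label_le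
    (fun t ht c hc => by
      have := hI.cls_size t ht
      have := hctx c hc
      omega) (ys := tuples (items a Ts) p) (fun y hy => (mem_tuples.1 hy).2) (by
      intro y hy c hc
      obtain ⟨hlen, hm⟩ := mem_tuples.1 hy
      have h7 := hsize_le_of_forall (Y := 2 * X) (ts := y.map Item.tree) (by
        intro t ht
        obtain ⟨x, hx, rfl⟩ := List.mem_map.1 ht
        rcases List.mem_append.1 (hm x hx) with hx | hx
        · obtain ⟨j, -, rfl⟩ := mem_leafItems.1 hx
          simp only [leafItem, toVal_leaf, Val.size]
          omega
        · obtain ⟨u, hu, rfl⟩ := List.mem_map.1 hx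
          simp only [Cls.toItem, toVal_node]
          exact hI.cls_size u hu)
      rw [List.length_map] at h7
      have h8 : y.length * (2 * X + 1) ≤ 2 * X * (2 * X + 1) :=
        Nat.mul_le_mul_right _ (by omega)
      have := hctx c hc
      omega)
  have c1 := tuples_cost_le (X := X) (p := p) (n := (items a Ts).length) (by omega) (by omega)
  have c2 := entries_cost_le (X := X) (p := p) (n := (tuples (items a Ts) p).length)
    (Ts := Ts) (C := C) (by omega) (by omega) (hI.length_tuples_le hW)
  have c3 := one_le_pow_add (X := X) (by omega) p
  rw [hyp_toVal]
  exact (Runs.cons (.arg rfl rfl) (.cons .const_zero (.call rfl h6 (.cons (.arg rfl rfl)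
    (.cons (.arg rfl rfl) (.cons (.call rfl h5 (.cons (.arg rfl rfl) (.cons (.call rfl h4
      (.cons (.arg rfl rfl) (.cons (.arg rfl rfl) .nil))) .nil))) .nil)))))).mono (by omega)

theorem LoopInv.event (hI : LoopInv W p h Ts C s) (hW : W.IsStructurallyUnambiguous)
    {e : List (SkelTree (Fin a)) × List (Frame (Fin a))}
    (he : scanHedge (nodeVal W.series) Ts C s = some e) :
    LoopInv W p h (newCls (nodeVal W.series) (Ts.length + 1) e.1 :: Ts) (e.2 :: C) s := by
  have hX := hI.length_add_le hW
  obtain ⟨h1, h2⟩ := scanHedge_size (by omega) hI.cls_size hI.ctx_size hI.tree_size he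
  refine ⟨hI.valid.cons hW (isNew_of_scanHedge hI.valid.indep he), by simp [hI.length_ctx], ?_, ?_,
    hI.tree_size, ?_⟩
  · intro t ht
    rcases List.mem_cons.1 ht with rfl | ht
    · rwa [newCls_hedge]
    · exact hI.cls_size t ht
  · intro c hc
    rw [List.length_cons, Nat.succ_mul]
    rcases List.mem_cons.1 hc with rfl | hc
    · exact h2
    · exact (hI.ctx_size c hc).trans (by omega)
  · rw [List.length_cons]
    rcases hI.count with hc | ⟨hc, -⟩ | ⟨hc, -⟩ | ⟨hc, hc', hs, hz⟩
    · left; omega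
    · left; omega
    · left; omega
    -- After the first class the tree still owes a second one; with two classes the next query is
    -- paid for.
    · by_cases h0 : Ts.length = 0
      · right; right; right
        exact ⟨hc, by omega, hs, hz⟩
      · left; omega

/-- The hypothesis is queried only after a scan without result. This excludes the second and the
fourth alternative of `count`; in the third, the start symbol gives |N| ≥ 1. -/
theorem LoopInv.length_le (hI : LoopInv W p h Ts C s) (hW : W.IsStructurallyUnambiguous)
    (hs : scanHedge (nodeVal W.series) Ts C s = none) : h.length + 1 ≤ Fintype.card N := by
  have hT := hI.valid.indep.length_le hW hI.valid.ctx
  have hN : 0 < Fintype.card N := Fintype.card_pos_iff.2 ⟨W.initial⟩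
  rcases hI.count with hc | ⟨-, hc⟩ | ⟨hc, -⟩ | ⟨-, hc, hne, hz⟩
  · omega
  · exact absurd hs hc
  · omega
  · exact absurd hs (scanHedge_ne_none_of_length_le_one hI.valid hc hz hne)

theorem LoopInv.counterexample (hI : LoopInv W p h Ts C s) (hW : W.IsStructurallyUnambiguous)
    (hp : W.RankLE p) (hs : scanHedge (nodeVal W.series) Ts C s = none)
    {s' : List (SkelTree (Fin a))}
    (hs' : (hyp (nodeVal W.series) p Ts C).toWCFG.series (.node s') ≠ W.series (.node s')) :
    scanHedge (nodeVal W.series) Ts C s' ≠ none ∧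
    LoopInv W p (h ++ [(hyp (nodeVal W.series) p Ts C, some (.node s'))]) Ts C s' := by
  have hne : scanHedge (nodeVal W.series) Ts C s' ≠ none := fun hn =>
    hs' (hI.valid.series_hyp (fun c hc v hv => nodeVal_plug_eq_zero_of_rankLE hW hp hc hv) hn)
  have hle := bigSize_append_le (Fintype.card N) p h
    [(hyp (nodeVal W.series) p Ts C, some (.node s'))]
  have hsz := size_le_bigSize (Fintype.card N) p h (hyp (nodeVal W.series) p Ts C) (.node s')
  refine ⟨hne, hI.valid, hI.length_ctx, fun t ht => (hI.cls_size t ht).trans (by omega),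
    fun c hc => (hI.ctx_size c hc).trans (by gcongr), ?_, ?_⟩
  · have := toVal_size_le (SkelTree.node s')
    rw [toVal_node] at this
    change hsize s' + 1 ≤ _ at this
    omega
  · rw [List.length_append, List.length_singleton]
    rcases hI.count with hc | ⟨-, hc⟩ | ⟨hc, hz⟩ | ⟨-, hc, hne, hz⟩
    · exact Or.inr (Or.inl ⟨hc, hne⟩)
    · exact absurd hs hc
    -- Without classes the hypothesis has the series 0, so the counterexample has a nonzero value
    -- and, trees of height one being zero, will yield two classes.
    · by_cases h0 : Ts.length = 0
      · refine Or.inr (Or.inr (Or.inr ⟨by omega, by omega, ?_, hz⟩))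
        obtain rfl := List.length_eq_zero_iff.1 h0
        intro h0
        exact hs' ((series_hyp_nil s').trans h0.symm)
      · exact Or.inr (Or.inl ⟨by omega, hne⟩)
    · exact absurd hs (scanHedge_ne_none_of_length_le_one hI.valid hc hz hne)

/-- What the learner achieves from a given state on, in at most `n` rounds. -/
def Succeeds (W : WCFG (Fin a) N) (τ : Teacher a) (p : ℕ) (h : History a) (x : Val) (n : ℕ) :
    Prop :=
  ∃ (H : Code a) (h' : History a) (t : ℕ),
    Eval W.series τ learner h [x] loopBody H.toVal (h ++ h') t ∧
    H.toWCFG.IsStructurallyUnambiguous ∧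
    (∀ s, H.toWCFG.series s = W.series s) ∧
    (W.IsNonneg → H.toWCFG.IsNonneg) ∧
    (h ++ h').length ≤ Fintype.card N ∧
    t ≤ n * (1000000 * bigSize (Fintype.card N) a p (h ++ h') ^ (p + 8))

-- The measure drops in every round: a new class lowers it by 2 and raises the indicator by at most
-- 1, and a counterexample always starts with a successful scan, which lowers the indicator. Costs
-- are expressed through the final history, whose size parameter dominates the earlier ones.
open Classical in
theorem LoopInv.succeeds (hW : W.IsStructurallyUnambiguous) (hp : W.RankLE p)
    (hτ : τ.IsCorrect W.series) (n : ℕ) : ∀ (h : History a) (Ts : List (Cls (Fin a)))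
    (C : List (List (Frame (Fin a)))) (s : List (SkelTree (Fin a))), LoopInv W p h Ts C s →
    2 * (Fintype.card N - Ts.length) +
      (if scanHedge (nodeVal W.series) Ts C s = none then 1 else 0) ≤ n →
    Succeeds W τ p h (loopArg p Ts C s) (n + 1) := by
  induction n using Nat.strong_induction_on with
  | _ n ih =>
  intro h Ts C s hI hn
  have hXlen := hI.length_add_le hW
  set X := bigSize (Fintype.card N) a p h with hX
  obtain ⟨t₁, ht₁, hscan⟩ := Runs.call (P := learner) (g := 7) rfl (hI.runs_scan (τ := τ) hW)
    (.cons (.arg (j := 0) (i := 2) (env := [loopArg p Ts C s]) rfl rfl)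
      (.cons (.arg (j := 0) (i := 3) rfl rfl) (.cons (.arg (j := 0) (i := 5) rfl rfl) .nil))) h
  rw [← hX] at ht₁
  have hXp := one_le_pow_add (X := X) (by omega) p
  cases hs : scanHedge (nodeVal W.series) Ts C s with
  | some e =>
    rw [hs] at hscan
    have hI' := hI.event hW hs
    have hlen := hI'.valid.indep.length_le hW hI'.valid.ctx
    rw [List.length_cons] at hlen
    rw [if_neg (by simp [hs])] at hn
    obtain ⟨H, h', t', hev, hSU, hser, hnn, hcard, ht⟩ := ih (n - 1) (by omega) h _ _ s hI' (by
      rw [List.length_cons]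
      split_ifs <;> omega)
    have hsz := (scanHedge_size (by omega) hI.cls_size hI.ctx_size hI.tree_size hs).1
    rw [← hX] at hsz
    obtain ⟨t₂, ht₂, hargs⟩ : ∃ t' ≤ 2 * hsize e.1 + 100, Eval W.series τ learner h
        [eventVal (some e), loopArg p Ts C s]
        (args₆ (arg₁ 0) (arg₁ 1) (.cons newClsExpr (arg₁ 2))
          (.cons (.tl (.var 0)) (arg₁ 3)) (.arith .add (arg₁ 4) (.const 1)) (arg₁ 5))
        (loopArg p (newCls (nodeVal W.series) (Ts.length + 1) e.1 :: Ts) (e.2 :: C) s) h t' :=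
      ((Runs.cons (.arg rfl rfl) (.cons (.arg rfl rfl) (.cons (.cons runs_newCls (.arg rfl rfl))
        (.cons (.cons (.tl (.var rfl)) (.arg rfl rfl)) (.cons (.succ (.arg rfl rfl))
          (.cons (.arg rfl rfl) .nil)))))).mono (by omega)) h
    refine ⟨H, h', _, .letIn hscan (.iteTrue (.var rfl) (by simp [eventVal])
      (.call hargs rfl hev)), hSU, hser, hnn, hcard, ?_⟩
    have hmono : X ^ (p + 8) ≤ bigSize (Fintype.card N) a p (h ++ h') ^ (p + 8) :=
      Nat.pow_le_pow_left (bigSize_append_le _ _ _ _) _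
    rw [Nat.sub_add_cancel (by omega)] at ht
    rw [Nat.succ_mul]
    omega
  | none =>
    rw [hs] at hscan
    rw [if_pos hs] at hn
    have hSU := hI.valid.hyp_isStructurallyUnambiguous (p := p)
    have hnn : W.IsNonneg → (hyp (nodeVal W.series) p Ts C).toWCFG.IsNonneg := fun hW' =>
      hI.valid.hyp_isNonneg (p := p) fun v => WCFG.series_nonneg hW' _
    obtain ⟨t₂, ht₂, hhyp⟩ := hI.runs_hyp hW (τ := τ) (x := eventVal none) h
    rw [← hX] at ht₂
    have hcard := hI.length_le hW hs
    have hsize : (hyp (nodeVal W.series) p Ts C).toVal.size ≤ 5 + 10 * X ^ (p + 8) := by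
      have h1 := hyp_toVal_size_le (F := nodeVal W.series) (Ts := Ts) (C := C) (p := p)
      have h2 := linear_cost_le (X := X) (p := p) (by omega) (hI.length_tuples_le hW)
        (i := 4 * p + 6) (by omega)
      omega
    cases hans : τ h (hyp (nodeVal W.series) p Ts C) with
    | none =>
      refine ⟨hyp (nodeVal W.series) p Ts C, [(hyp (nodeVal W.series) p Ts C, none)], _, .letIn hscan (.iteFalse (.var rfl)
        (.letIn hhyp (.letIn (.seqYes _ (.var rfl) hSU hans) (.iteFalse (.var rfl)
          (.var rfl))))), hSU, (hτ h _).1 hans, hnn, by simpa using hcard, ?_⟩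
      have hmono : X ^ (p + 8) ≤
          bigSize (Fintype.card N) a p (h ++ [(hyp (nodeVal W.series) p Ts C, none)]) ^ (p + 8) :=
        Nat.pow_le_pow_left (bigSize_append_le _ _ _ _) _
      rw [Nat.succ_mul]
      omega
    | some u =>
      have hu := (hτ h _).2 u hans
      -- Every series is 0 on a leaf, because start symbols are nonterminals.
      obtain ⟨s', rfl⟩ : ∃ s', u = .node s' := by
        cases u with
        | leaf x => exact absurd ((WCFG.series_leaf x).trans (WCFG.series_leaf x).symm) hu
        | node s' => exact ⟨s', rfl⟩
      obtain ⟨hs', hI'⟩ := hI.counterexample hW hp hs hu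
      obtain ⟨H, h', t', hev, hSU', hser, hnn', hcard', ht⟩ := ih (n - 1) (by omega) _ _ _ s' hI'
        (by rw [if_neg hs']; omega)
      rw [List.append_assoc] at hev hcard' ht
      obtain ⟨t₃, ht₃, hargs⟩ : ∃ t' ≤ 100, Eval W.series τ learner
          (h ++ [(hyp (nodeVal W.series) p Ts C, some (.node s'))])
          [.pair (SkelTree.node s').toVal (.num (W.series (.node s'))), (hyp (nodeVal W.series) p Ts C).toVal,
            eventVal (a := a) none, loopArg p Ts C s]
          (args₆ ((Expr.var 3).nth 0) ((Expr.var 3).nth 1) ((Expr.var 3).nth 2)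
              ((Expr.var 3).nth 3) ((Expr.var 3).nth 4) (.hd (.var 0)))
          (loopArg p Ts C s') (h ++ [(hyp (nodeVal W.series) p Ts C, some (.node s'))]) t' :=
        ((Runs.cons (.arg rfl rfl) (.cons (.arg rfl rfl) (.cons (.arg rfl rfl)
          (.cons (.arg rfl rfl) (.cons (.arg rfl rfl)
            (.cons (.hedge (.hd (.var rfl))) .nil)))))).mono (by omega)) _
      refine ⟨H, _, _, .letIn hscan (.iteFalse (.var rfl)
        (.letIn hhyp (.letIn (.seqNo _ _ (.var rfl) hSU hans) (.iteTrue (.var rfl) (by simp)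
          (.call hargs rfl hev))))), hSU', hser, hnn', hcard', ?_⟩
      have hmono : X ^ (p + 8) ≤ bigSize (Fintype.card N) a p
          (h ++ ([(hyp (nodeVal W.series) p Ts C, some (.node s'))] ++ h')) ^ (p + 8) :=
        Nat.pow_le_pow_left (bigSize_append_le _ _ _ _) _
      have hsz : (SkelTree.node s').toVal.size ≤ 2 * bigSize (Fintype.card N) a p
          (h ++ ([(hyp (nodeVal W.series) p Ts C, some (.node s'))] ++ h')) ^ (p + 8) := by
        have h1 := toVal_size_le (SkelTree.node s')
        have h2 := size_le_bigSize (Fintype.card N) p h (hyp (nodeVal W.series) p Ts C) (.node s')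
        have h3 := bigSize_append_le (Fintype.card N) p
          (h ++ [(hyp (nodeVal W.series) p Ts C, some (.node s'))]) h'
        rw [List.append_assoc] at h3
        have h4 := one_le_pow_add (X := bigSize (Fintype.card N) a p
          (h ++ ([(hyp (nodeVal W.series) p Ts C, some (.node s'))] ++ h'))) (by rw [bigSize]; omega) p
        omega
      rw [Nat.sub_add_cancel (by omega)] at ht
      rw [Nat.succ_mul]
      omega

theorem loopInv_start (hW : W.IsStructurallyUnambiguous) (hp : W.RankLE p) :
    LoopInv W p [] [] [[]]
      (firstNonzero (nodeVal W.series) (tuples (items a []) p)) := by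
  refine ⟨valid_nil, by simp, by simp, by simp [csize], ?_, ?_⟩
  · have := hsize_firstNonzero_le (F := nodeVal W.series) (M := 1 + 2 * p) (by omega)
      (hsize_leaf_tuple_le (a := a) (p := p))
    rw [bigSize]
    omega
  · by_cases h0 : nodeVal W.series (firstNonzero (nodeVal W.series) (tuples (items a []) p)) = 0
    · exact Or.inr (Or.inr (Or.inl ⟨rfl, flatZero_of_firstNonzero
        (fun c hc v hv => nodeVal_plug_eq_zero_of_rankLE hW hp hc hv) h0⟩))
    · exact Or.inr (Or.inl ⟨by simp, scanHedge_nil_ne_none h0⟩)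

end Loop

end StructLearn

end

theorem mainTheorem2 :
    ∃ (P : Program) (c : ℕ),
      ∀ (a p : ℕ) (N : Type) [Fintype N] (W : WCFG (Fin a) N),
        W.IsStructurallyUnambiguous → W.RankLE p →
        ∀ τ : Teacher a, τ.IsCorrect W.series →
          ∃ (H : Code a) (h : History a) (t : ℕ),
            P.Halts W.series τ (.pair (.num a) (.num p)) H.toVal h t ∧
            H.toWCFG.IsStructurallyUnambiguous ∧
            (∀ s : SkelTree (Fin a), H.toWCFG.series s = W.series s) ∧
            (W.IsNonneg → H.toWCFG.IsNonneg) ∧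
            h.length ≤ Fintype.card N ∧
            t ≤ c * (Fintype.card N + a + p + h.maxCex + 1) ^ (c * (p + 1)) := by
  -- One constant serves as the factor and in the exponent: the estimates below lead to about
  -- 4000000 · X^(p+9), and p + 9 is far below c(p + 1).
  refine ⟨learner, 10000000, fun a p N _ W hW hp τ hτ => ?_⟩
  obtain ⟨H, h, t, hev, hSU, hser, hnn, hcard, ht⟩ := LoopInv.succeeds hW hp hτ
    -- The measure of the initial state, which has no classes: 2|N| plus the indicator.
    (2 * Fintype.card N + 1) [] [] [[]] _ (loopInv_start hW hp) (by
      simp only [List.length_nil]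
      split_ifs <;> omega)
  rw [List.nil_append] at hev hcard ht
  have h1 := runs_leaves (f := W.series) (τ := τ) [] (le_refl a)
  set X := bigSize (Fintype.card N) a p h with hX
  have hXe : X = Fintype.card N + a + p + h.maxCex + 1 := rfl
  have hil := length_items_le (a := a) (Ts := [])
  simp only [List.length_nil] at hil
  have h2 := runs_tuples (f := W.series) (τ := τ) (items a []) (n := p) (E := X ^ p)
    (Nat.pow_le_pow_left (by omega) _)
  have h3 := runs_firstNonzero (f := W.series) (τ := τ) (hsize_leaf_tuple_le (a := a) (p := p))
  obtain ⟨t₁, ht₁, hargs⟩ := Runs.cons (P := learner)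
    (env := [.pair (.num (a : ℝ)) (.num (p : ℝ))]) (.hd (.var (i := 0) rfl))
    (.cons (.tl (.var (i := 0) rfl)) (.cons .nil (.cons (.cons .nil .nil) (.cons .const_one
      (.cons (.call (g := 13) rfl h3 (.cons (.call (g := 11) rfl h2
        (.cons (.tl (.var (i := 0) rfl)) (.cons (.call (g := 8) rfl h1
          (.cons (.hd (.var (i := 0) rfl)) (.cons .nil .nil))) .nil))) .nil)) .nil))))) []
  have harg : Val.pair (.num (a : ℝ)) (.pair (.num (p : ℝ)) (.pair .nil (.pair
      (.pair .nil .nil) (.pair (.num 1) (.pair (hval (firstNonzero (nodeVal W.series)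
        (tuples (items a []) p))) .nil))))) = loopArg p [] [[]]
          (firstNonzero (nodeVal W.series) (tuples (items a []) p)) := by
    simp [loopArg, Val.ofList, clssVal, ctxsVal, cval]
  rw [harg] at hargs
  refine ⟨H, h, _, .call (.var rfl) rfl (.call hargs rfl hev), hSU, hser, hnn, hcard, ?_⟩
  have c1 := tuples_cost_le (X := X) (p := p) (n := (items a ([] : List (Cls (Fin a)))).length)
    (by omega) (by omega)
  have c2 : (1 + 2 * p + 60) * ((tuples (items a ([] : List (Cls (Fin a)))) p).length + 1) ≤
      130 * X ^ (p + 8) := by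
    have hle : (tuples (items a ([] : List (Cls (Fin a)))) p).length ≤ X ^ p :=
      (length_tuples_le _ _).trans (Nat.pow_le_pow_left (by omega) _)
    have h1 : 1 ≤ X ^ p := Nat.one_le_pow _ _ (by omega)
    calc _ ≤ 63 * X * (2 * X ^ p) := by gcongr <;> omega
      _ = 126 * X ^ (p + 1) := by ring
      _ ≤ 130 * X ^ (p + 8) := by gcongr <;> omega
  have c3 := one_le_pow_add (X := X) (by omega) p
  have c4 : (2 * Fintype.card N + 1 + 1) * (1000000 * X ^ (p + 8)) ≤
      4000000 * X ^ (p + 9) := by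
    calc _ ≤ (4 * X) * (1000000 * X ^ (p + 8)) := by gcongr; omega
      _ = 4000000 * X ^ (p + 9) := by ring
  have c5 : X ^ (p + 8) ≤ X ^ (p + 9) := Nat.pow_le_pow_right (by omega) (by omega)
  have c6 : X ^ (p + 9) ≤ X ^ (10000000 * (p + 1)) := Nat.pow_le_pow_right (by omega) (by omega)
  rw [← hXe]
  omega
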